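/- Let $k\ge 2$ be an integer and $c\in\mathbb R$ be fixed, and let $m=m(n)=\frac n2(\log n+c)$, rounded up or down to an integer. Let $\mathcal G(n,m)$ be a graph chosen uniformly at random from all graphs with vertex set $\{1,\dots,n\}$ and exactly $m$ edges, and let each of its edges independently choose a set of exactly $k$ colours, uniformly at random among all $k$-element subsets of a fixed set $W$ of $n-1$ colours. A rainbow spanning tree is a spanning tree $T$ of $\mathcal G(n,m)$ for which one can select, for every edge of $T$, one of the $k$ colours chosen by that edge, so that the selected colours are pairwise different. Then, as $n\to\infty$, $$ \mathbb P\bigl(\mathcal G(n,m)\text{ has a rainbow spanning tree}\bigr)= \begin{cases} (1+o(1))\,e^{-2e^{-c}}, & \text{if } k=2,\\ (1+o(1))\,e^{-e^{-c}}, & \text{if } k\ge 3. \end{cases} $$ -/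

import Mathlib

open Filter Topology

/-- Given a graph `G` on `V` in which every edge `e` carries a set `col e` of colours (so `e` may be
viewed as a bundle of parallel edges, one for each colour of `col e`), there is a rainbow spanning
tree: a tree `T ⊆ G` on all vertices whose edges can be given pairwise different colours, each edge
receiving one of its own colours. -/
def HasRainbowSpanningTree {V W : Type*} (G : SimpleGraph V) (col : G.edgeSet → Finset W) : Prop :=
  ∃ (T : SimpleGraph V) (hT : T ≤ G), T.IsTree ∧
    ∃ f : T.edgeSet → W, Function.Injective f ∧
      ∀ e : T.edgeSet, f e ∈ col ⟨e.1, SimpleGraph.edgeSet_mono hT e.2⟩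

/-- The sample space of `G(n, m)` with `k` colours per edge: a graph on `n` vertices with exactly
`m` edges, together with a choice, for each of its edges, of a set of exactly `k` of the `n - 1`
colours. Since each graph has the same number of colourings, the uniform distribution on this
space is the law of a uniform graph with `m` edges, each edge of which independently picks a
uniform `k`-set of colours. -/
def ColouredGraph (n m k : ℕ) : Type :=
  Σ G : {G : SimpleGraph (Fin n) // G.edgeSet.ncard = m},
    (G.1.edgeSet → {S : Finset (Fin (n - 1)) // S.card = k})

/-- The probability that `G(n, m)` with `k` random colours per edge has a rainbow spanning tree:
the number of favourable outcomes divided by the number of all outcomes. -/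
noncomputable def rainbowProb (n m k : ℕ) : ℝ :=
  (Nat.card {ω : ColouredGraph n m k //
      HasRainbowSpanningTree ω.1.1 (fun e => (ω.2 e).1)} : ℝ) /
    (Nat.card (ColouredGraph n m k) : ℝ)

/-! Two obstructions are visible: an isolated vertex, and a colour that occurs on no edge (a rainbow
tree has n - 1 edges, hence uses all n - 1 colours). At m ~ n(log n + c)/2 the number of isolated
vertices is asymptotically Poisson with mean e^{-c}. A given colour is unused with probability (1 -
k/(n-1))^m, so for k = 2 the number of unused colours is also asymptotically Poisson with mean
e^{-c}, while for k ≥ 3 there are none with high probability. The chance that all colours occur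
depends on the graph only through its number of edges, so the two limits multiply. The Poisson
limits come from binomial moments and Bonferroni's inequalities (`tendsto_prob_forall_not`).

It remains to see that nothing else matters. Encode edges as vectors over F₂, so that rank n - 1
means connected. By Rado's theorem (`exists_linearIndependent_transversal`) a rainbow tree exists as
soon as, for every colour set I, the edges with a colour in I have rank at least |I|. Suppose this
fails, take a violating I of least size, and put J = Iᶜ, L = log n. The edges with a colour in I
leave at least |J| + 2 components, and every edge between different components has all its colours
in J.

The graph is with high probability pseudo-random (`IsNice`). If |I| ≤ n/L⁴, minimality forces two
rare colours to lie close together (`rareColours_of_violation`), which is unlikely. If |I| is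
larger, expansion yields so many edges between components that a first-moment bound excludes their
all being coloured inside J; the ranges of |J| above n/1000, between n/L⁴ and n/1000, and below n/L⁴
need different counts. `IsNice.cases_of_not_hasRainbowSpanningTree` is this deterministic split,
`IsDense.prob_not_isNice_le` and `IsDense.prob_not_hasRainbowSpanningTree_le` bound the bad events,
and `IsDense.prob_covered_sub_le_rainbowProb` combines them. -/

/-! ### Rado's theorem on independent transversals -/

open Finset in
/-- **Rado's theorem** for vectors: a family of finite sets of vectors has a linearly independent
transversal as soon as the union of any `i` of the sets spans a space of dimension at least `i`. -/
theorem exists_linearIndependent_transversal {K M W α : Type*} [Field K] [AddCommGroup M]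
    [Module K M] [FiniteDimensional K M] [Fintype W] (v : α → M) (A : W → Finset α)
    (h : ∀ I : Finset W,
      #I ≤ Module.finrank K (Submodule.span K (v '' {a | ∃ w ∈ I, a ∈ A w}))) :
    ∃ f : W → α, (∀ w, f w ∈ A w) ∧ LinearIndependent K (v ∘ f) := by
  classical
  -- Deletion argument: shrink the sets one element at a time until each has at most one element;
  -- then the condition for the full index set is linear independence.
  induction hN : ∑ w, #(A w) using Nat.strong_induction_on generalizing A with
  | _ N ih =>
  by_cases h1 : ∀ w, #(A w) ≤ 1
  · have hne : ∀ w, ∃ a, a ∈ A w := by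
      intro w
      by_contra hc
      push Not at hc
      have := h {w}
      have h2 : {a | ∃ w' ∈ ({w} : Finset W), a ∈ A w'} = ∅ := by
        ext a; simp [hc a]
      rw [h2] at this
      simp at this
    choose f hf using hne
    refine ⟨f, hf, ?_⟩
    rw [linearIndependent_iff_card_le_finrank_span]
    have h2 := h univ
    have h3 : v '' {a | ∃ w ∈ (univ : Finset W), a ∈ A w} = Set.range (v ∘ f) := by
      rw [Set.range_comp]
      congr 1
      ext a
      simp only [mem_univ, true_and, Set.mem_ofPred_eq, Set.mem_range]
      constructor
      · rintro ⟨w, hw⟩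
        exact ⟨w, card_le_one.1 (h1 w) _ (hf w) _ hw⟩
      · rintro ⟨w, rfl⟩
        exact ⟨w, hf w⟩
    rw [h3] at h2
    simpa [Set.finrank] using h2
  · push Not at h1
    obtain ⟨w₀, hw₀⟩ := h1
    obtain ⟨x, hx, y, hy, hxy⟩ := one_lt_card.1 hw₀
    -- removing one of `x`, `y` from `A w₀` keeps the condition
    have key : ∃ z ∈ A w₀, ∀ I : Finset W, #I ≤ Module.finrank K (Submodule.span K
        (v '' {a | ∃ w ∈ I, a ∈ Function.update A w₀ ((A w₀).erase z) w})) := by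
      by_contra hc
      push Not at hc
      obtain ⟨I₁, hI₁⟩ := hc x hx
      obtain ⟨I₂, hI₂⟩ := hc y hy
      have hmem : ∀ z, ∀ I : Finset W, Module.finrank K (Submodule.span K
        (v '' {a | ∃ w ∈ I, a ∈ Function.update A w₀ ((A w₀).erase z) w})) < #I → w₀ ∈ I := by
        intro z I hI
        by_contra hw
        have : {a | ∃ w ∈ I, a ∈ Function.update A w₀ ((A w₀).erase z) w} =
            {a | ∃ w ∈ I, a ∈ A w} := by
          ext a
          simp only [Set.mem_ofPred_eq]
          refine exists_congr fun w => and_congr_right fun hwI => ?_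
          rw [Function.update_of_ne]
          rintro rfl
          exact hw hwI
        rw [this] at hI
        exact absurd (h I) (not_le.2 hI)
      have hm1 := hmem x I₁ hI₁
      have hm2 := hmem y I₂ hI₂
      set S₁ := Submodule.span K (v '' {a | ∃ w ∈ I₁, a ∈ Function.update A w₀ ((A w₀).erase x) w})
        with hS₁
      set S₂ := Submodule.span K (v '' {a | ∃ w ∈ I₂, a ∈ Function.update A w₀ ((A w₀).erase y) w})
        with hS₂
      -- Submodularity. The two violators have rank sum at most |I₁| + |I₂| - 2. But S₁ ⊔ S₂
      -- contains all vectors of I₁ ∪ I₂ (x survives in S₂, y in S₁) and S₁ ⊓ S₂ contains those of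
      -- I₁ ∩ I₂ without w₀, which forces at least |I₁| + |I₂| - 1.
      have hsum := Submodule.finrank_sup_add_finrank_inf_eq S₁ S₂
      have hup : #(I₁ ∪ I₂) ≤ Module.finrank K ↥(S₁ ⊔ S₂) := by
        refine (h (I₁ ∪ I₂)).trans (Submodule.finrank_mono ?_)
        rw [Submodule.span_le]
        rintro _ ⟨a, ⟨w, hw, ha⟩, rfl⟩
        by_cases hww : w = w₀
        · subst hww
          by_cases hax : a = x
          · refine (le_sup_right : S₂ ≤ _) (Submodule.subset_span ⟨a, ⟨w, hm2, ?_⟩, rfl⟩)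
            rw [Function.update_self]
            exact mem_erase.2 ⟨by rw [hax]; exact hxy, ha⟩
          · refine (le_sup_left : S₁ ≤ _) (Submodule.subset_span ⟨a, ⟨w, hm1, ?_⟩, rfl⟩)
            rw [Function.update_self]
            exact mem_erase.2 ⟨hax, ha⟩
        · rcases mem_union.1 hw with hw | hw
          · refine (le_sup_left : S₁ ≤ _) (Submodule.subset_span ⟨a, ⟨w, hw, ?_⟩, rfl⟩)
            rwa [Function.update_of_ne hww]
          · refine (le_sup_right : S₂ ≤ _) (Submodule.subset_span ⟨a, ⟨w, hw, ?_⟩, rfl⟩)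
            rwa [Function.update_of_ne hww]
      have hlow : #((I₁ ∩ I₂).erase w₀) ≤ Module.finrank K ↥(S₁ ⊓ S₂) := by
        refine (h _).trans (Submodule.finrank_mono ?_)
        rw [Submodule.span_le]
        rintro _ ⟨a, ⟨w, hw, ha⟩, rfl⟩
        obtain ⟨hww, hw⟩ := mem_erase.1 hw
        obtain ⟨hw1, hw2⟩ := mem_inter.1 hw
        constructor
        · refine Submodule.subset_span ⟨a, ⟨w, hw1, ?_⟩, rfl⟩
          rwa [Function.update_of_ne hww]
        · refine Submodule.subset_span ⟨a, ⟨w, hw2, ?_⟩, rfl⟩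
          rwa [Function.update_of_ne hww]
      have hc1 := card_union_add_card_inter I₁ I₂
      have hc2 := card_erase_add_one (mem_inter.2 ⟨hm1, hm2⟩)
      omega
    obtain ⟨z, hz, hcond⟩ := key
    obtain ⟨f, hf, hlin⟩ := ih _ (by
      rw [← hN]
      refine sum_lt_sum (fun w _ => ?_) ⟨w₀, mem_univ _, ?_⟩
      · by_cases hww : w = w₀
        · subst hww; rw [Function.update_self]; exact card_erase_le
        · rw [Function.update_of_ne hww]
      · rw [Function.update_self]; exact card_erase_lt_of_mem hz) _ hcond rfl
    refine ⟨f, fun w => ?_, hlin⟩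
    have := hf w
    by_cases hww : w = w₀
    · subst hww; rw [Function.update_self] at this; exact mem_of_mem_erase this
    · rwa [Function.update_of_ne hww] at this

/-! ### Graphic rank over F₂ and the criterion for a rainbow spanning tree -/

section EdgeRank
open Finset

variable {V : Type*}

open Classical in
/-- The indicator vector of the set of endpoints of an edge. -/
noncomputable def edgeVec (e : Sym2 V) : V → ZMod 2 := fun v => if v ∈ e then 1 else 0

/-- The span of the indicator vectors of a set of edges. -/
noncomputable def edgeSpan (H : Finset (Sym2 V)) : Submodule (ZMod 2) (V → ZMod 2) :=
  Submodule.span (ZMod 2) (edgeVec '' (H : Set (Sym2 V)))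

/-- The rank of a set of edges (in the graphic matroid). -/
noncomputable def edgeRank (H : Finset (Sym2 V)) : ℕ := Module.finrank (ZMod 2) (edgeSpan H)

theorem edgeVec_mem_edgeSpan {H : Finset (Sym2 V)} {e : Sym2 V} (he : e ∈ H) :
    edgeVec e ∈ edgeSpan H :=
  Submodule.subset_span ⟨e, by exact_mod_cast he, rfl⟩

open Classical in
/-- The edges of `E` with at least one colour in `I`. -/
noncomputable def colourEdges {W : Type*} (E : Finset (Sym2 V)) (χ : Sym2 V → Finset W)
    (I : Finset W) : Finset (Sym2 V) :=
  E.filter fun e => ∃ w ∈ I, w ∈ χ e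

theorem mem_colourEdges {W : Type*} {E : Finset (Sym2 V)} {χ : Sym2 V → Finset W}
    {I : Finset W} {e : Sym2 V} : e ∈ colourEdges E χ I ↔ e ∈ E ∧ ∃ w ∈ I, w ∈ χ e := by
  simp [colourEdges]

variable [Fintype V]

theorem sum_edgeVec_mul (u v : V) (huv : u ≠ v) (f : V → ZMod 2) :
    ∑ x, edgeVec s(u, v) x * f x = f u + f v := by
  classical
  have : ∀ x, edgeVec s(u, v) x * f x = (if x = u then f x else 0) + (if x = v then f x else 0) := by
    intro x
    simp only [edgeVec, Sym2.mem_iff]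
    by_cases h1 : x = u
    · subst h1; simp [huv]
    · simp [h1]
  simp [this, Finset.sum_add_distrib]

/-- Rank–nullity for the incidence matrix: in characteristic 2, f u + f v = 0 means f u = f v, so
the kernel consists of the functions constant on components. -/
theorem edgeRank_add_card_connectedComponent (H : Finset (Sym2 V)) (hH : ∀ e ∈ H, ¬ e.IsDiag) :
    edgeRank H +
      Nat.card (SimpleGraph.fromEdgeSet (H : Set (Sym2 V))).ConnectedComponent =
      Fintype.card V := by
  classical
  set G := SimpleGraph.fromEdgeSet (H : Set (Sym2 V)) with hG
  let A : Matrix H V (ZMod 2) := Matrix.of fun e v => edgeVec e.1 v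
  have h1 : edgeRank H = A.rank := by
    have hrange : edgeVec '' (H : Set (Sym2 V)) = Set.range A.row := by
      ext x
      constructor
      · rintro ⟨e, he, rfl⟩
        exact ⟨⟨e, by exact_mod_cast he⟩, rfl⟩
      · rintro ⟨⟨e, he⟩, rfl⟩
        exact ⟨e, by exact_mod_cast he, rfl⟩
    rw [Matrix.rank_eq_finrank_span_row, edgeRank, edgeSpan, hrange]
  have h2 : LinearMap.ker A.mulVecLin =
      LinearMap.range (LinearMap.funLeft (ZMod 2) (ZMod 2) G.connectedComponentMk) := by
    ext f
    rw [LinearMap.mem_ker, LinearMap.mem_range]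
    have h3 : A.mulVecLin f = 0 ↔ ∀ u v, G.Adj u v → f u = f v := by
      constructor
      · intro hf u v huv
        rw [hG, SimpleGraph.fromEdgeSet_adj] at huv
        have := congrFun hf ⟨s(u, v), by exact_mod_cast huv.1⟩
        simp only [Matrix.mulVecLin_apply, Matrix.mulVec, dotProduct, A, Matrix.of_apply] at this
        rw [sum_edgeVec_mul u v huv.2] at this
        exact CharTwo.add_eq_zero.1 this
      · intro hf
        ext ⟨e, he⟩
        induction e with | _ u v =>
        have hne : u ≠ v := by simpa using hH _ he
        simp only [Matrix.mulVecLin_apply, Matrix.mulVec, dotProduct, A, Matrix.of_apply]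
        rw [sum_edgeVec_mul u v hne]
        exact CharTwo.add_eq_zero.2 (hf u v (by
          rw [hG, SimpleGraph.fromEdgeSet_adj]; exact ⟨by exact_mod_cast he, hne⟩))
    rw [h3]
    constructor
    · intro hf
      have hr : ∀ u v, G.Reachable u v → f u = f v := by
        rintro u v ⟨p⟩
        induction p with
        | nil => rfl
        | cons hadj _ ih => exact (hf _ _ hadj).trans ih
      refine ⟨fun C => C.lift f (fun u v p _ => hr u v p.reachable), ?_⟩
      ext v
      rfl
    · rintro ⟨g, rfl⟩ u v huv
      simp only [LinearMap.funLeft_apply]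
      rw [SimpleGraph.ConnectedComponent.sound huv.reachable]
  have h4 := LinearMap.finrank_range_add_finrank_ker A.mulVecLin
  rw [h2, LinearMap.finrank_range_of_inj (f := LinearMap.funLeft (ZMod 2) (ZMod 2)
    G.connectedComponentMk) (LinearMap.funLeft_injective_of_surjective _ _ _
      Quot.mk_surjective), Module.finrank_fintype_fun_eq_card,
    Module.finrank_fintype_fun_eq_card] at h4
  rw [h1, Matrix.rank, Nat.card_eq_fintype_card, h4]

/-- A function which is constant along the edges of `H` is constant along the edges spanned by
`H`. -/
theorem apply_eq_of_edgeVec_mem_edgeSpan {H : Finset (Sym2 V)} (hH : ∀ e ∈ H, ¬ e.IsDiag)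
    {u v : V} (huv : u ≠ v) (h : edgeVec s(u, v) ∈ edgeSpan H) (f : V → ZMod 2)
    (hf : ∀ x y, s(x, y) ∈ H → f x = f y) : f u = f v := by
  -- Pairing with f is linear, and in characteristic 2 it kills an edge exactly when f agrees at its
  -- ends.
  have key : ∀ g ∈ edgeSpan H, ∑ x, g x * f x = 0 := by
    intro g hg
    induction hg using Submodule.span_induction with
    | mem g hg =>
      obtain ⟨e, he, rfl⟩ := hg
      induction e with | _ x y =>
      have he' : s(x, y) ∈ H := by exact_mod_cast he
      rw [sum_edgeVec_mul x y (by simpa using hH _ he')]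
      exact CharTwo.add_eq_zero.2 (hf x y he')
    | zero => simp
    | add g g' _ _ h1 h2 => simp [add_mul, Finset.sum_add_distrib, h1, h2]
    | smul a g _ h1 => simp [mul_assoc, ← Finset.mul_sum, h1]
  have := key _ h
  rw [sum_edgeVec_mul u v huv] at this
  exact CharTwo.add_eq_zero.1 this

/-- The indicator of the component of `u` is constant along `H`, hence along every edge in the span.
-/
theorem connectedComponentMk_eq_of_edgeVec_mem_edgeSpan {H : Finset (Sym2 V)}
    (hH : ∀ e ∈ H, ¬ e.IsDiag) {u v : V} (huv : u ≠ v) (h : edgeVec s(u, v) ∈ edgeSpan H) :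
    (SimpleGraph.fromEdgeSet (H : Set (Sym2 V))).connectedComponentMk u =
      (SimpleGraph.fromEdgeSet (H : Set (Sym2 V))).connectedComponentMk v := by
  classical
  set G := SimpleGraph.fromEdgeSet (H : Set (Sym2 V)) with hG
  have := apply_eq_of_edgeVec_mem_edgeSpan hH huv h
    (fun x => if G.connectedComponentMk x = G.connectedComponentMk u then 1 else 0) (by
      intro x y hxy
      have hadj : G.Adj x y := by
        rw [hG, SimpleGraph.fromEdgeSet_adj]
        exact ⟨by exact_mod_cast hxy, by simpa using hH _ hxy⟩
      rw [SimpleGraph.ConnectedComponent.sound hadj.reachable])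
  by_contra hne
  simp [Ne.symm hne] at this

/-- An edge with an endpoint outside the edges of `H` raises the rank. -/
theorem edgeRank_add_one_le {H H' : Finset (Sym2 V)} {e : Sym2 V} (hHH : H ⊆ H') (he : e ∈ H')
    {v : V} (hv : v ∈ e) (hvH : ∀ f ∈ H, v ∉ f) : edgeRank H + 1 ≤ edgeRank H' := by
  classical
  refine Nat.succ_le_of_lt (Submodule.finrank_lt_finrank_of_lt (lt_of_le_of_ne
    (Submodule.span_mono (Set.image_mono (by exact_mod_cast hHH))) ?_))
  intro heq
  have h1 : edgeVec e ∈ edgeSpan H := by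
    rw [show edgeSpan H = edgeSpan H' from heq]
    exact edgeVec_mem_edgeSpan he
  -- The coordinate at v vanishes on the span of H, but is 1 at e.
  have h2 : edgeSpan H ≤ LinearMap.ker (LinearMap.proj (R := ZMod 2) (φ := fun _ : V => ZMod 2) v) := by
    rw [edgeSpan, Submodule.span_le]
    rintro _ ⟨f, hf, rfl⟩
    simp [edgeVec, hvH f (by exact_mod_cast hf)]
  have h3 := h2 h1
  simp [edgeVec, hv] at h3

/-- Every set of edges contains a spanning subset of size its rank. -/
theorem exists_edgeSpan_eq (H : Finset (Sym2 V)) :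
    ∃ S ⊆ H, #S = edgeRank H ∧ edgeSpan S = edgeSpan H := by
  classical
  obtain ⟨b, hb1, hb2, hb3⟩ := exists_linearIndependent (ZMod 2) (edgeVec '' (H : Set (Sym2 V)))
  have hfin : b.Finite := (Set.toFinite _).subset hb1
  -- The choice of representatives below needs a default edge.
  rcases isEmpty_or_nonempty (Sym2 V) with hemp | hnon
  · have hH0 : H = ∅ := eq_empty_of_isEmpty H
    exact ⟨H, subset_rfl, by rw [edgeRank, edgeSpan, hH0, coe_empty, Set.image_empty, Submodule.span_empty,
      finrank_bot, card_empty], rfl⟩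
  choose! g hg1 hg2 using fun x (hx : x ∈ b) => hb1 hx
  refine ⟨hfin.toFinset.image g, ?_, ?_, ?_⟩
  · intro e he
    obtain ⟨x, hx, rfl⟩ := mem_image.1 he
    exact_mod_cast hg1 x (by simpa using hx)
  · rw [card_image_of_injOn, edgeRank, edgeSpan, ← hb2]
    · have : Fintype b := hfin.fintype
      rw [finrank_span_set_eq_card hb3]
      congr 1
      ext; simp
    · intro x hx y hy hxy
      rw [← hg2 x (by simpa using hx), hxy, hg2 y (by simpa using hy)]
  · have : edgeVec '' ((hfin.toFinset.image g : Finset (Sym2 V)) : Set (Sym2 V)) = b := by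
      ext x
      simp only [coe_image, Set.Finite.coe_toFinset, Set.mem_image, exists_exists_and_eq_and]
      constructor
      · rintro ⟨y, hy, rfl⟩
        rwa [hg2 y hy]
      · intro hx
        exact ⟨x, hx, hg2 x hx⟩
    rw [edgeSpan, this, hb2, edgeSpan]

/-- The transversal picks n - 1 edges with independent vectors. Rank n - 1 leaves one component, and
a connected graph with n - 1 edges is a tree; each edge receives the colour that picked it. -/
theorem hasRainbowSpanningTree_of_card_le_edgeRank {n : ℕ} (hn : 0 < n)
    {E : Finset (Sym2 (Fin n))} (hE : ∀ e ∈ E, ¬ e.IsDiag)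
    (χ : Sym2 (Fin n) → Finset (Fin (n - 1)))
    (h : ∀ I : Finset (Fin (n - 1)), #I ≤ edgeRank (colourEdges E χ I)) :
    HasRainbowSpanningTree (SimpleGraph.fromEdgeSet (E : Set (Sym2 (Fin n))))
      (fun e => χ e.1) := by
  classical
  obtain ⟨f, hf, hlin⟩ := exists_linearIndependent_transversal (K := ZMod 2)
    (edgeVec : Sym2 (Fin n) → _) (fun w => E.filter fun e => w ∈ χ e) (by
      intro I
      refine (h I).trans (Submodule.finrank_mono (Submodule.span_mono (Set.image_mono ?_)))
      intro e he
      obtain ⟨he1, w, hw, he2⟩ := mem_colourEdges.1 (by exact_mod_cast he)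
      exact ⟨w, hw, by simp [he1, he2]⟩)
  have hinj : Function.Injective f := fun a b hab => hlin.injective (by simp [hab])
  set S : Finset (Sym2 (Fin n)) := univ.image f with hS
  have hSE : S ⊆ E := by
    intro e he
    obtain ⟨w, -, rfl⟩ := mem_image.1 he
    exact (mem_filter.1 (hf w)).1
  have hSd : ∀ e ∈ S, ¬ e.IsDiag := fun e he => hE e (hSE he)
  set T := SimpleGraph.fromEdgeSet (S : Set (Sym2 (Fin n))) with hT
  have hTS : T.edgeSet = S := by
    rw [hT, SimpleGraph.edgeSet_fromEdgeSet]
    ext e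
    simp only [Set.mem_sdiff, mem_coe, and_iff_left_iff_imp]
    exact fun he => hSd e he
  have hTE : T ≤ SimpleGraph.fromEdgeSet (E : Set (Sym2 (Fin n))) :=
    SimpleGraph.fromEdgeSet_mono (by exact_mod_cast hSE)
  have hcard : #S = n - 1 := by
    rw [hS, card_image_of_injective _ hinj]; simp
  have hrank : edgeRank S = n - 1 := by
    have := linearIndependent_iff_card_eq_finrank_span.1 hlin
    rw [Fintype.card_fin] at this
    rw [this, edgeRank, edgeSpan, Set.finrank, Set.range_comp, hS, coe_image, coe_univ,
      Set.image_univ]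
  have hcc := edgeRank_add_card_connectedComponent S hSd
  rw [hrank, ← hT, Fintype.card_fin] at hcc
  have hone : Nat.card T.ConnectedComponent = 1 := by omega
  have hconn : T.Connected := by
    have : Nonempty (Fin n) := ⟨⟨0, hn⟩⟩
    refine ⟨fun u v => ?_⟩
    rw [Nat.card_eq_one_iff_unique] at hone
    have := hone.1
    exact SimpleGraph.ConnectedComponent.exact (Subsingleton.elim _ _)
  have hinv : ∀ e : T.edgeSet, ∃ w, f w = e.1 := by
    rintro ⟨e, he⟩
    rw [hTS] at he
    obtain ⟨w, -, hw⟩ := mem_image.1 (mem_coe.1 he)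
    exact ⟨w, hw⟩
  choose g hg using hinv
  refine ⟨T, hTE, ?_, g, ?_, ?_⟩
  · rw [SimpleGraph.isTree_iff_connected_and_card]
    refine ⟨hconn, ?_⟩
    rw [hTS]
    simp only [Nat.card_eq_fintype_card, Fintype.card_coe, Fintype.card_fin, coe_sort_coe]
    omega
  · intro a b hab
    apply Subtype.ext
    rw [← hg a, ← hg b, hab]
  · intro e
    have := (mem_filter.1 (hf (g e))).2
    rwa [hg e] at this

/-- A rainbow spanning tree uses every vertex and every colour. -/
theorem HasRainbowSpanningTree.exists_mem {n : ℕ} (hn : 2 ≤ n)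
    {E : Finset (Sym2 (Fin n))} {χ : Sym2 (Fin n) → Finset (Fin (n - 1))}
    (h : HasRainbowSpanningTree (SimpleGraph.fromEdgeSet (E : Set (Sym2 (Fin n))))
      (fun e => χ e.1)) :
    (∀ v, ∃ e ∈ E, v ∈ e) ∧ ∀ w, ∃ e ∈ E, w ∈ χ e := by
  classical
  obtain ⟨T, hT, htree, f, hinj, hf⟩ := h
  have hmem : ∀ e ∈ T.edgeSet, e ∈ E := by
    intro e he
    have := SimpleGraph.edgeSet_mono hT he
    rw [SimpleGraph.edgeSet_fromEdgeSet] at this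
    exact_mod_cast this.1
  constructor
  · intro v
    have : Nontrivial (Fin n) := Fin.nontrivial_iff_two_le.2 hn
    obtain ⟨u, hu⟩ := htree.connected.preconnected.exists_adj_of_nontrivial v
    exact ⟨s(v, u), hmem _ hu, by simp⟩
  · intro w
    -- With as many tree edges as colours, an injective selection is onto.
    have hcard := (SimpleGraph.isTree_iff_connected_and_card.1 htree).2
    have hc2 : Fintype.card T.edgeSet = Fintype.card (Fin (n - 1)) := by
      rw [Nat.card_eq_fintype_card, Nat.card_eq_fintype_card, Fintype.card_fin] at hcard
      rw [Fintype.card_fin]; omega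
    obtain ⟨e, rfl⟩ := ((Fintype.bijective_iff_injective_and_card f).2 ⟨hinj, hc2⟩).2 w
    exact ⟨e.1, hmem _ e.2, hf e⟩

end EdgeRank

/-! ### Probability by counting, binomial moments, Bonferroni and the Poisson limit -/

section Prob
open Finset

variable {Ω : Type*}

open Classical in
/-- The probability of `P` under the uniform distribution on the finite set `s`. -/
noncomputable def prob (s : Finset Ω) (P : Ω → Prop) : ℝ := (#(s.filter P) : ℝ) / #s

theorem prob_nonneg (s : Finset Ω) (P : Ω → Prop) : 0 ≤ prob s P := by
  unfold prob; positivity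

theorem prob_mono {s : Finset Ω} {P Q : Ω → Prop} (h : ∀ ω ∈ s, P ω → Q ω) :
    prob s P ≤ prob s Q := by
  classical
  unfold prob
  gcongr with ω hω
  exact h ω hω

theorem prob_congr {s : Finset Ω} {P Q : Ω → Prop} (h : ∀ ω ∈ s, (P ω ↔ Q ω)) :
    prob s P = prob s Q :=
  le_antisymm (prob_mono fun ω hω => (h ω hω).1) (prob_mono fun ω hω => (h ω hω).2)

theorem prob_eq_sum (s : Finset Ω) (P : Ω → Prop) [DecidablePred P] :
    prob s P = (∑ ω ∈ s, if P ω then (1 : ℝ) else 0) / #s := by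
  simp only [prob, sum_boole]
  congr!

theorem prob_eq_zero {s : Finset Ω} {P : Ω → Prop} (h : ∀ ω ∈ s, ¬ P ω) : prob s P = 0 := by
  classical
  rw [prob_eq_sum, sum_eq_zero, zero_div]
  exact fun ω hω => if_neg (h ω hω)

/-- Markov's inequality. -/
theorem prob_le_sum_div {s : Finset Ω} {P : Ω → Prop} {f : Ω → ℝ} (h0 : ∀ ω ∈ s, 0 ≤ f ω)
    (h1 : ∀ ω ∈ s, P ω → 1 ≤ f ω) : prob s P ≤ (∑ ω ∈ s, f ω) / #s := by
  classical
  rw [prob_eq_sum]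
  gcongr with ω hω
  split_ifs with h
  · exact h1 ω hω h
  · exact h0 ω hω

theorem prob_exists_le {ι : Type*} {s : Finset Ω} (t : Finset ι) (P : ι → Ω → Prop) :
    prob s (fun ω => ∃ i ∈ t, P i ω) ≤ ∑ i ∈ t, prob s (P i) := by
  classical
  refine (prob_le_sum_div (f := fun ω => ∑ i ∈ t, if P i ω then (1 : ℝ) else 0)
    (fun ω _ => by positivity) ?_).trans ?_
  · rintro ω - ⟨i, hi, h⟩
    refine le_trans ?_ (single_le_sum (fun j _ => by positivity) hi)
    simp [h]
  · rw [sum_comm, sum_div]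
    simp_rw [prob_eq_sum]
    exact le_rfl

theorem prob_or_le {s : Finset Ω} (P Q : Ω → Prop) :
    prob s (fun ω => P ω ∨ Q ω) ≤ prob s P + prob s Q := by
  classical
  refine (prob_le_sum_div (f := fun ω => (if P ω then (1 : ℝ) else 0) + if Q ω then 1 else 0)
    (fun ω _ => by positivity) ?_).trans ?_
  · rintro ω - (h | h) <;> simp only [h, if_true] <;> split_ifs <;> norm_num
  · rw [sum_add_distrib, add_div, ← prob_eq_sum, ← prob_eq_sum]

theorem prob_product {Ω' : Type*} (s : Finset Ω) (t : Finset Ω') (P : Ω → Ω' → Prop) :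
    prob (s ×ˢ t) (fun ω => P ω.1 ω.2) = (∑ a ∈ s, prob t (P a)) / #s := by
  classical
  rw [prob_eq_sum, sum_product, card_product]
  simp_rw [prob_eq_sum]
  rw [← sum_div, div_div, Nat.cast_mul, mul_comm (#t : ℝ)]

theorem prob_product_le {Ω' : Type*} {s : Finset Ω} {t : Finset Ω'} {P : Ω → Ω' → Prop} {ε : ℝ}
    (hε : 0 ≤ ε) (h : ∀ a ∈ s, prob t (P a) ≤ ε) :
    prob (s ×ˢ t) (fun ω => P ω.1 ω.2) ≤ ε := by
  rw [prob_product]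
  rcases s.eq_empty_or_nonempty with rfl | hs
  · simpa using hε
  · rw [div_le_iff₀ (by exact_mod_cast hs.card_pos), mul_comm, ← nsmul_eq_mul]
    exact sum_le_card_nsmul _ _ _ h

/-- Bonferroni for one outcome: if X > 0, the alternating sum truncated after the term r equals
(-1)^r C(X - 1, r), so its sign depends on the parity of r. -/
theorem alternating_sum_choose_le (X t : ℕ) :
    ((if X = 0 then 1 else 0 : ℤ)) ≤ ∑ r ∈ range (2 * t + 1), (-1) ^ r * (X.choose r : ℤ) := by
  rcases X with _ | X
  · rw [sum_range_succ']
    simp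
  · rw [Int.alternating_sum_range_choose_eq_choose]
    simp

theorem le_alternating_sum_choose (X t : ℕ) :
    ∑ r ∈ range (2 * t + 2), (-1) ^ r * (X.choose r : ℤ) ≤ ((if X = 0 then 1 else 0 : ℤ)) := by
  rcases X with _ | X
  · rw [sum_range_succ']
    simp
  · rw [Int.alternating_sum_range_choose_eq_choose]
    simp [pow_succ]

variable {ι : Type*} [Fintype ι]

/-- The sum of the probabilities of all intersections of `r` of the events. -/
noncomputable def binomialMoment (s : Finset Ω) (A : ι → Ω → Prop) (r : ℕ) : ℝ :=
  ∑ R ∈ powersetCard r (univ : Finset ι), prob s (fun ω => ∀ i ∈ R, A i ω)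

-- Double counting: if X(ω) events occur at ω, then C(X(ω), r) of the r-sets do, so the sum is the
-- expectation of C(X, r).
open Classical in
theorem binomialMoment_eq (s : Finset Ω) (A : ι → Ω → Prop) (r : ℕ) :
    binomialMoment s A r = (∑ ω ∈ s, ((#(univ.filter fun i => A i ω)).choose r : ℝ)) / #s := by
  unfold binomialMoment
  simp_rw [prob_eq_sum]
  rw [← sum_div, sum_comm]
  congr 1
  refine sum_congr rfl fun ω _ => ?_
  rw [← card_powersetCard, ← sum_filter, sum_const, nsmul_eq_mul, mul_one]
  congr 2
  ext R
  simp only [mem_filter, mem_powersetCard, true_and, subset_iff, mem_univ]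
  tauto

theorem alternating_sum_binomialMoment (s : Finset Ω) (A : ι → Ω → Prop) (t : ℕ) :
    prob s (fun ω => ∀ i, ¬ A i ω) ≤ ∑ r ∈ range (2 * t + 1), (-1) ^ r * binomialMoment s A r ∧
    ∑ r ∈ range (2 * t + 2), (-1) ^ r * binomialMoment s A r ≤ prob s (fun ω => ∀ i, ¬ A i ω) := by
  classical
  have hsum : ∀ u, ∑ r ∈ range u, (-1) ^ r * binomialMoment s A r =
      (∑ ω ∈ s, ((∑ r ∈ range u, (-1) ^ r * ((#(univ.filter fun i => A i ω)).choose r : ℤ) : ℤ)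
        : ℝ)) / #s := by
    intro u
    simp_rw [binomialMoment_eq, ← mul_div_assoc, mul_sum]
    rw [← sum_div, sum_comm]
    push_cast
    rfl
  have hind : ∀ ω, (if ∀ i, ¬ A i ω then (1 : ℝ) else 0) =
      ((if #(univ.filter fun i => A i ω) = 0 then 1 else 0 : ℤ) : ℝ) := by
    intro ω
    simp [filter_eq_empty_iff]
  rw [hsum, hsum, prob_eq_sum]
  constructor <;> gcongr with ω hω <;> rw [hind]
  · exact_mod_cast alternating_sum_choose_le _ t
  · exact_mod_cast le_alternating_sum_choose _ t

end Prob

/-- If all binomial moments converge to those of a Poisson variable of mean `l`, then the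
probability that none of the events happens converges to `exp (-l)`. -/
theorem tendsto_prob_forall_not {Ω ι : ℕ → Type} [∀ n, Fintype (ι n)] (s : ∀ n, Finset (Ω n))
    (A : ∀ n, ι n → Ω n → Prop) (l : ℝ)
    (h : ∀ r : ℕ, Tendsto (fun n => binomialMoment (s n) (A n) r) atTop
      (𝓝 (l ^ r / (Nat.factorial r : ℝ)))) :
    Tendsto (fun n => prob (s n) (fun ω => ∀ i, ¬ A n i ω)) atTop (𝓝 (Real.exp (-l))) := by
  have hlim : ∀ u, Tendsto (fun n => ∑ r ∈ Finset.range u, (-1) ^ r * binomialMoment (s n) (A n) r)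
      atTop (𝓝 (∑ r ∈ Finset.range u, (-l) ^ r / (Nat.factorial r : ℝ))) := by
    intro u
    refine tendsto_finsetSum _ fun r _ => ?_
    have := (h r).const_mul ((-1 : ℝ) ^ r)
    rwa [← mul_div_assoc, ← mul_pow, neg_one_mul] at this
  have hexp : Tendsto (fun u => ∑ r ∈ Finset.range u, (-l) ^ r / (Nat.factorial r : ℝ)) atTop
      (𝓝 (Real.exp (-l))) := by
    rw [Real.exp_eq_exp_ℝ]
    exact (NormedSpace.expSeries_div_hasSum_exp (-l)).tendsto_sum_nat
  rw [Metric.tendsto_nhds]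
  intro ε hε
  have h2 := (Metric.tendsto_nhds.1 hexp (ε / 2) (by positivity))
  -- The truncation level is fixed before n grows, so only finitely many moments have to be close to
  -- their limits.
  obtain ⟨t, ht⟩ := eventually_atTop.1 h2
  have he := Metric.tendsto_nhds.1 (hlim (2 * t + 1)) (ε / 2) (by positivity)
  have ho := Metric.tendsto_nhds.1 (hlim (2 * t + 2)) (ε / 2) (by positivity)
  filter_upwards [he, ho] with n he ho
  have h3 := ht (2 * t + 1) (by omega)
  have h4 := ht (2 * t + 2) (by omega)
  obtain ⟨hu, hl⟩ := alternating_sum_binomialMoment (s n) (A n) t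
  rw [Real.dist_eq, abs_lt] at *
  constructor <;> linarith

/-! ### Ratios of binomial coefficients -/

section ChooseRatio

theorem descFactorial_mul_pow_le {a b : ℕ} (h : a ≤ b) (t : ℕ) :
    a.descFactorial t * b ^ t ≤ b.descFactorial t * a ^ t := by
  induction t with
  | zero => simp
  | succ t ih =>
    rw [Nat.descFactorial_succ, Nat.descFactorial_succ, pow_succ, pow_succ]
    have h1 : (a - t) * b ≤ (b - t) * a := by
      rcases le_total a t with h2 | h2
      · simp [Nat.sub_eq_zero_of_le h2]
      · obtain ⟨c, rfl⟩ := Nat.exists_eq_add_of_le h2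
        obtain ⟨d, rfl⟩ := Nat.exists_eq_add_of_le h
        have : t + c + d - t = c + d := by omega
        rw [this, Nat.add_sub_cancel_left]
        nlinarith [Nat.zero_le (t * d)]
    calc (a - t) * a.descFactorial t * (b ^ t * b)
        = ((a - t) * b) * (a.descFactorial t * b ^ t) := by ring
      _ ≤ ((b - t) * a) * (b.descFactorial t * a ^ t) := Nat.mul_le_mul h1 ih
      _ = _ := by ring

theorem choose_div_choose_le {a b : ℕ} (h : a ≤ b) (t : ℕ) :
    (a.choose t : ℝ) / b.choose t ≤ ((a : ℝ) / b) ^ t := by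
  rcases Nat.eq_zero_or_pos (b.choose t) with h0 | h0
  · rw [h0]; simp; positivity
  rcases Nat.eq_zero_or_pos b with hb | hb
  · subst hb
    obtain rfl : a = 0 := by omega
    rcases t with _ | t <;> simp
  rw [div_pow, div_le_div_iff₀ (by exact_mod_cast h0) (by positivity)]
  have h1 := descFactorial_mul_pow_le h t
  rw [Nat.descFactorial_eq_factorial_mul_choose, Nat.descFactorial_eq_factorial_mul_choose,
    mul_assoc, mul_assoc] at h1
  have h2 := Nat.le_of_mul_le_mul_left h1 t.factorial_pos
  calc (a.choose t : ℝ) * (b : ℝ) ^ t ≤ b.choose t * (a : ℝ) ^ t := by exact_mod_cast h2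
    _ = _ := by ring

/-- Each factor (a - s)/(b - s) with s ≤ t is at least (a - t)/(b - t). -/
theorem le_choose_div_choose {a b t : ℕ} (h : a ≤ b) (hta : t ≤ a) (htb : t < b) :
    (((a : ℝ) - t) / ((b : ℝ) - t)) ^ t ≤ (a.choose t : ℝ) / b.choose t := by
  have key : ∀ s ≤ t, (b.descFactorial s : ℝ) * ((a : ℝ) - t) ^ s ≤
      a.descFactorial s * ((b : ℝ) - t) ^ s := by
    intro s
    induction s with
    | zero => simp
    | succ s ih =>
      intro hs
      rw [Nat.descFactorial_succ, Nat.descFactorial_succ, pow_succ, pow_succ]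
      push_cast [Nat.cast_sub (show s ≤ b by omega), Nat.cast_sub (show s ≤ a by omega)]
      have h3 : (t : ℝ) ≤ a := by exact_mod_cast hta
      have h4 : (a : ℝ) ≤ b := by exact_mod_cast h
      have h5 : (s : ℝ) ≤ t := by exact_mod_cast (by omega : s ≤ t)
      have h1 : ((b : ℝ) - s) * (a - t) ≤ (a - s) * (b - t) := by nlinarith
      calc ((b : ℝ) - s) * b.descFactorial s * ((a - t) ^ s * (a - t))
          = ((b : ℝ) - s) * (a - t) * (b.descFactorial s * (a - t) ^ s) := by ring
        _ ≤ ((a : ℝ) - s) * (b - t) * (a.descFactorial s * (b - t) ^ s) := by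
            apply mul_le_mul h1 (ih (by omega))
            · have : (0 : ℝ) ≤ (a : ℝ) - t := by linarith
              positivity
            · apply mul_nonneg <;> linarith
        _ = _ := by ring
  have h0 : 0 < b.choose t := Nat.choose_pos htb.le
  have hbt : (0 : ℝ) < (b : ℝ) - t := by
    have : (t : ℝ) < b := by exact_mod_cast htb
    linarith
  rw [div_pow, div_le_div_iff₀ (by positivity) (by exact_mod_cast h0)]
  have h1 := key t le_rfl
  rw [Nat.descFactorial_eq_factorial_mul_choose, Nat.descFactorial_eq_factorial_mul_choose] at h1
  push_cast at h1
  have hf : (0 : ℝ) < t.factorial := by exact_mod_cast t.factorial_pos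
  rw [mul_assoc, mul_assoc] at h1
  have := le_of_mul_le_mul_left h1 hf
  linarith

end ChooseRatio

/-! ### Uniform m-subsets: inclusion, avoidance and lower tails -/

section UniformSubset
open Finset

variable {α : Type*} [DecidableEq α]

theorem card_filter_subset_disjoint_le {P T M : Finset α} (hT : T ⊆ P) (hM : M ⊆ P)
    (hTM : Disjoint T M) (m : ℕ) :
    #((powersetCard m P).filter fun E => T ⊆ E ∧ Disjoint E M) ≤
      (#P - #T - #M).choose (m - #T) := by
  have hc : #((P \ T) \ M) = #P - #T - #M := by
    rw [card_sdiff_of_subset, card_sdiff_of_subset hT]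
    intro x hx
    exact mem_sdiff.2 ⟨hM hx, fun h => disjoint_left.1 hTM h hx⟩
  rw [← hc, ← card_powersetCard]
  refine card_le_card_of_injOn (fun E => E \ T) ?_ ?_
  · intro E hE
    simp only [coe_filter, mem_powersetCard, Set.mem_ofPred_eq] at hE
    simp only [mem_coe, mem_powersetCard]
    refine ⟨fun x hx => ?_, ?_⟩
    · obtain ⟨h1, h2⟩ := mem_sdiff.1 hx
      exact mem_sdiff.2 ⟨mem_sdiff.2 ⟨hE.1.1 h1, h2⟩, disjoint_left.1 hE.2.2 h1⟩
    · rw [card_sdiff_of_subset hE.2.1, hE.1.2]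
  · intro E hE E' hE' h
    simp only [coe_filter, mem_powersetCard, Set.mem_ofPred_eq] at hE hE'
    simp only at h
    rw [← sdiff_union_of_subset hE.2.1, h, sdiff_union_of_subset hE'.2.1]

/-- The exact ratio factors into C(m, |T|)/C(|P|, |T|) and an avoidance term at most (1 - |M|/(|P| -
|T|))^(m - |T|). As with independent elements, the bound is multiplicative in |M|, which the
exponential moment below relies on. -/
theorem prob_subset_disjoint_le {P T M : Finset α} (hT : T ⊆ P) (hM : M ⊆ P)
    (hTM : Disjoint T M) {m : ℕ} (hTm : #T ≤ m) (hmP : m ≤ #P) (hP : 0 < #P) :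
    prob (powersetCard m P) (fun E => T ⊆ E ∧ Disjoint E M) ≤
      ((m : ℝ) / #P) ^ #T * Real.exp (-(((m : ℝ) - #T) / #P)) ^ #M := by
  classical
  have hTMc : #T + #M ≤ #P := by
    rw [← card_union_of_disjoint hTM]
    exact card_le_card (union_subset hT hM)
  have h1 : prob (powersetCard m P) (fun E => T ⊆ E ∧ Disjoint E M) ≤
      ((#P - #T - #M).choose (m - #T) : ℝ) / (#P).choose m := by
    unfold prob
    rw [card_powersetCard]
    have := card_filter_subset_disjoint_le hT hM hTM m
    gcongr
    refine le_of_eq_of_le ?_ this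
    congr!
  refine h1.trans ?_
  have hpos : (0 : ℝ) < (#P).choose m := by exact_mod_cast Nat.choose_pos hmP
  have hpos2 : (0 : ℝ) < (#P - #T).choose (m - #T) := by
    exact_mod_cast Nat.choose_pos (by omega)
  have h2 : ((#P - #T).choose (m - #T) : ℝ) / (#P).choose m = (m.choose #T : ℝ) / (#P).choose #T := by
    have hpos3 : (0 : ℝ) < (#P).choose #T := by exact_mod_cast Nat.choose_pos (by omega)
    rw [div_eq_div_iff hpos.ne' hpos3.ne']
    have := Nat.choose_mul (n := #P) (k := m) (s := #T) hTm
    have h3 : ((#P).choose m : ℝ) * m.choose #T = (#P).choose #T * (#P - #T).choose (m - #T) := by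
      exact_mod_cast this
    linarith
  have h3 : ((#P - #T - #M).choose (m - #T) : ℝ) / (#P).choose m =
      ((#P - #T).choose (m - #T) : ℝ) / (#P).choose m *
      (((#P - #T - #M).choose (m - #T) : ℝ) / (#P - #T).choose (m - #T)) := by
    field_simp
  rw [h3, h2]
  have h4 := choose_div_choose_le hmP #T
  have h5 := choose_div_choose_le (show #P - #T - #M ≤ #P - #T by omega) (m - #T)
  refine mul_le_mul h4 (h5.trans ?_) (by positivity) (by positivity)
  rcases Nat.eq_zero_or_pos (#P - #T) with h6 | h6
  · have h7 : m - #T = 0 := by omega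
    have h8 : (m : ℝ) - #T = 0 := by
      have : m = #T := by omega
      rw [this, sub_self]
    rw [h7, h8]; simp
  have hP' : (0 : ℝ) < #P := by exact_mod_cast hP
  have h6' : (0 : ℝ) < (#P - #T : ℕ) := by exact_mod_cast h6
  have hb : ((#P - #T - #M : ℕ) : ℝ) / (#P - #T : ℕ) ≤ Real.exp (-((#M : ℝ) / #P)) := by
    have : ((#P - #T - #M : ℕ) : ℝ) = (#P - #T : ℕ) - #M := by
      rw [Nat.cast_sub (by omega)]
    rw [this, sub_div, div_self h6'.ne']
    have h7 : (#M : ℝ) / #P ≤ (#M : ℝ) / (#P - #T : ℕ) := by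
      gcongr
      omega
    have h8 := Real.add_one_le_exp (-((#M : ℝ) / #P))
    linarith
  calc (((#P - #T - #M : ℕ) : ℝ) / (#P - #T : ℕ)) ^ (m - #T)
      ≤ Real.exp (-((#M : ℝ) / #P)) ^ (m - #T) := by gcongr
    _ = Real.exp (-(((m : ℝ) - #T) / #P)) ^ #M := by
      rw [← Real.exp_nat_mul, ← Real.exp_nat_mul, Nat.cast_sub hTm]
      congr 1
      ring

/-- If each element of R enters M independently with probability 1 - x, then M avoids E with
probability x^|E ∩ R|. This expresses an exponential moment through avoidance probabilities. -/
theorem pow_card_inter_eq_sum (E R : Finset α) (x : ℝ) :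
    x ^ #(E ∩ R) = ∑ M ∈ R.powerset,
      (1 - x) ^ #M * x ^ (#R - #M) * (if Disjoint E M then 1 else 0) := by
  have h1 := Finset.sum_pow_mul_eq_add_pow (1 - x) x (R \ E)
  simp only [sub_add_cancel, one_pow] at h1
  simp_rw [mul_ite, mul_one, mul_zero]
  rw [← sum_filter]
  have h2 : R.powerset.filter (fun M => Disjoint E M) = (R \ E).powerset := by
    ext M
    simp only [mem_filter, mem_powerset, subset_sdiff, disjoint_comm]
  rw [h2]
  have h5 : x ^ #(E ∩ R) = x ^ #(E ∩ R) *
      ∑ t ∈ (R \ E).powerset, (1 - x) ^ #t * x ^ (#(R \ E) - #t) := by rw [h1, mul_one]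
  rw [h5, mul_sum]
  refine sum_congr rfl fun M hM => ?_
  have h3 : #(R \ E) + #(E ∩ R) = #R := by rw [inter_comm]; exact card_sdiff_add_card_inter R E
  have h4 := card_le_card (mem_powerset.1 hM)
  rw [show #R - #M = #(E ∩ R) + (#(R \ E) - #M) by omega, pow_add]
  ring

/-- Lower tail of the number of elements of `R` in a random `m`-subset of `P`, jointly with the
event that the subset contains `T`. -/
theorem prob_subset_card_inter_le {P T R : Finset α} (hT : T ⊆ P) (hR : R ⊆ P)
    (hTR : Disjoint T R) {m : ℕ} (hTm : #T ≤ m) (hmP : 8 * m ≤ #P) (hP : 0 < #P) (b : ℝ) :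
    prob (powersetCard m P) (fun E => T ⊆ E ∧ (#(E ∩ R) : ℝ) ≤ b) ≤
      ((m : ℝ) / #P) ^ #T * Real.exp (2 * b - 4 / 5 * (((m : ℝ) - #T) / #P) * #R) := by
  classical
  -- Chernoff weight. Since 1 - x ≥ 6/7, and q ≤ 1/8 gives e^{-q} ≤ 1 - 15q/16, the base (1 -
  -- x)e^{-q} + x is at most 1 - (6/7)(15/16)q ≤ 1 - 4q/5.
  set x : ℝ := Real.exp (-2) with hx
  have hx0 : 0 < x := Real.exp_pos _
  have hx1 : x ≤ 1 / 7 := by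
    have : (7 : ℝ) ≤ Real.exp 2 := by
      have h1 := Real.exp_one_gt_d9
      rw [show (2 : ℝ) = 1 + 1 by norm_num, Real.exp_add]
      nlinarith
    rw [hx, Real.exp_neg, ← one_div]
    exact one_div_le_one_div_of_le (by norm_num) this
  set q : ℝ := ((m : ℝ) - #T) / #P with hq
  have hP' : (0 : ℝ) < #P := by exact_mod_cast hP
  have hq0 : 0 ≤ q := div_nonneg (sub_nonneg.2 (by exact_mod_cast hTm)) hP'.le
  have hq1 : q ≤ 1 / 8 := by
    rw [hq, div_le_iff₀ hP']
    have : (8 : ℝ) * m ≤ #P := by exact_mod_cast hmP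
    have : (0 : ℝ) ≤ #T := by positivity
    linarith
  have step : prob (powersetCard m P) (fun E => T ⊆ E ∧ (#(E ∩ R) : ℝ) ≤ b) ≤
      (∑ E ∈ powersetCard m P, Real.exp (2 * b) * ((if T ⊆ E then 1 else 0) * x ^ #(E ∩ R))) /
        #(powersetCard m P) := by
    refine prob_le_sum_div (fun E _ => by positivity) ?_
    rintro E - ⟨h1, h2⟩
    rw [if_pos h1, one_mul, hx, ← Real.exp_nat_mul, ← Real.exp_add]
    refine Real.one_le_exp ?_
    linarith
  refine step.trans ?_
  rw [← mul_sum, mul_div_assoc]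
  have step2 : (∑ E ∈ powersetCard m P, ((if T ⊆ E then 1 else 0) * x ^ #(E ∩ R))) /
        #(powersetCard m P) =
      ∑ M ∈ R.powerset, (1 - x) ^ #M * x ^ (#R - #M) *
        prob (powersetCard m P) (fun E => T ⊆ E ∧ Disjoint E M) := by
    simp_rw [prob_eq_sum, ← mul_div_assoc]
    rw [← sum_div]
    congr 1
    simp_rw [mul_sum]
    rw [sum_comm]
    refine sum_congr rfl fun E _ => ?_
    rw [pow_card_inter_eq_sum, mul_sum]
    refine sum_congr rfl fun M _ => ?_
    by_cases h1 : T ⊆ E <;> by_cases h2 : Disjoint E M <;> simp [h1, h2]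
  rw [step2]
  have hx2 : 0 ≤ 1 - x := by linarith
  have step3 : ∑ M ∈ R.powerset, (1 - x) ^ #M * x ^ (#R - #M) *
        prob (powersetCard m P) (fun E => T ⊆ E ∧ Disjoint E M) ≤
      ((m : ℝ) / #P) ^ #T * ((1 - x) * Real.exp (-q) + x) ^ #R := by
    rw [← Finset.sum_pow_mul_eq_add_pow, mul_sum]
    refine sum_le_sum fun M hM => ?_
    have hMR := mem_powerset.1 hM
    have := prob_subset_disjoint_le hT (hMR.trans hR) (hTR.mono_right hMR) hTm (by omega) hP
    calc _ ≤ (1 - x) ^ #M * x ^ (#R - #M) * (((m : ℝ) / #P) ^ #T * Real.exp (-q) ^ #M) := by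
          gcongr
      _ = _ := by rw [mul_pow]; ring
  calc _ ≤ Real.exp (2 * b) * (((m : ℝ) / #P) ^ #T * ((1 - x) * Real.exp (-q) + x) ^ #R) := by
        gcongr
    _ ≤ Real.exp (2 * b) * (((m : ℝ) / #P) ^ #T * Real.exp (-(4 / 5 * q)) ^ #R) := by
        gcongr
        have h1 : Real.exp (-q) ≤ 1 - 15 / 16 * q := by
          have h3 : Real.exp (-q) * Real.exp q = 1 := by rw [← Real.exp_add]; simp
          have h4 := Real.quadratic_le_exp_of_nonneg hq0
          have h5 : (1 - 15 / 16 * q) * (1 + q + q ^ 2 / 2) ≥ 1 := by nlinarith [mul_nonneg hq0 hq0]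
          by_contra hc
          push Not at hc
          have : (1 - 15 / 16 * q) * Real.exp q < 1 := by
            exact (mul_lt_mul_of_pos_right hc (Real.exp_pos _)).trans_eq h3
          have : (1 - 15 / 16 * q) * (1 + q + q ^ 2 / 2) ≤ (1 - 15 / 16 * q) * Real.exp q := by
            apply mul_le_mul_of_nonneg_left h4; linarith
          linarith
        have h2 := Real.add_one_le_exp (-(4 / 5 * q))
        nlinarith
    _ = _ := by
        rw [← Real.exp_nat_mul, sub_eq_add_neg, Real.exp_add]
        ring_nf

end UniformSubset

/-! ### Independent random colour sets -/

section Colourings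
open Finset

/-- All ways to give every element of `α` a set of exactly `k` colours. -/
noncomputable def colourings (α W : Type*) [Fintype α] [Fintype W] (k : ℕ) :
    Finset (α → Finset W) :=
  open Classical in Fintype.piFinset fun _ : α => powersetCard k (univ : Finset W)

variable {α W : Type*} [Fintype α] [Fintype W] {k : ℕ}

theorem mem_colourings {χ : α → Finset W} : χ ∈ colourings α W k ↔ ∀ e, #(χ e) = k := by
  simp [colourings, mem_powersetCard]

theorem card_colourings : #(colourings α W k) = (Fintype.card W).choose k ^ Fintype.card α := by
  simp [colourings]

/-- The colours of different elements are independent. -/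
theorem sum_prod_colourings (g : α → Finset W → ℝ) :
    (∑ χ ∈ colourings α W k, ∏ e, g e (χ e)) / #(colourings α W k) =
      ∏ e, (∑ c ∈ powersetCard k (univ : Finset W), g e c) /
        #(powersetCard k (univ : Finset W)) := by
  classical
  rw [prod_div_distrib, prod_univ_sum, colourings]
  simp

theorem prob_forall_colourings (hk : k ≤ Fintype.card W) (F : Finset α)
    (P : α → Finset W → Prop) :
    prob (colourings α W k) (fun χ => ∀ e ∈ F, P e (χ e)) =
      ∏ e ∈ F, prob (powersetCard k (univ : Finset W)) (P e) := by
  classical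
  have hpos : (#(powersetCard k (univ : Finset W)) : ℝ) ≠ 0 := by
    rw [card_powersetCard]
    exact_mod_cast (Nat.choose_pos (by simpa using hk)).ne'
  have h := sum_prod_colourings (α := α) (W := W) (k := k)
    (fun e c => if e ∈ F then (if P e c then 1 else 0) else 1)
  rw [prob_eq_sum]
  have h1 : ∀ χ : α → Finset W, (∏ e, if e ∈ F then (if P e (χ e) then (1 : ℝ) else 0) else 1) =
      if ∀ e ∈ F, P e (χ e) then 1 else 0 := by
    intro χ
    rw [prod_ite_mem, univ_inter]
    split_ifs with h2
    · exact prod_eq_one fun e he => if_pos (h2 e he)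
    · push Not at h2
      obtain ⟨e, he, h3⟩ := h2
      exact prod_eq_zero he (if_neg h3)
  simp_rw [h1] at h
  rw [h, ← prod_subset (subset_univ F)]
  · refine prod_congr rfl fun e he => ?_
    rw [prob_eq_sum]
    simp [he]
  · intro e _ he
    simp only [he, if_false, sum_const, nsmul_eq_mul, mul_one]
    exact div_self hpos

theorem prob_colour_subset (J : Finset W) :
    prob (powersetCard k (univ : Finset W)) (fun c => c ⊆ J) =
      ((#J).choose k : ℝ) / (Fintype.card W).choose k := by
  classical
  unfold prob
  rw [card_powersetCard, card_univ, ← card_powersetCard]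
  congr 3
  ext c
  simp [mem_powersetCard, and_comm]

/-- The ratio is at most 1, so the exponent 2 covers all k ≥ 2; the union bounds over colour sets
need no more. -/
theorem prob_colour_subset_le (hk : 2 ≤ k) (J : Finset W) :
    prob (powersetCard k (univ : Finset W)) (fun c => c ⊆ J) ≤
      ((#J : ℝ) / Fintype.card W) ^ 2 := by
  rw [prob_colour_subset]
  have hJ : #J ≤ Fintype.card W := card_le_univ J
  refine (choose_div_choose_le hJ k).trans (pow_le_pow_of_le_one (by positivity) ?_ hk)
  exact div_le_one_of_le₀ (by exact_mod_cast hJ) (by positivity)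

theorem prob_colours_subset_le (hk : 2 ≤ k) (hkW : k ≤ Fintype.card W) (F : Finset α)
    (J : Finset W) :
    prob (colourings α W k) (fun χ => ∀ e ∈ F, χ e ⊆ J) ≤
      ((#J : ℝ) / Fintype.card W) ^ (2 * #F) := by
  rw [prob_forall_colourings hkW F (fun _ c => c ⊆ J), prod_const, pow_mul]
  exact pow_le_pow_left₀ (prob_nonneg _ _) (prob_colour_subset_le hk J) _

theorem prob_superset_colour_le (hkW : k ≤ Fintype.card W) (hW : 0 < Fintype.card W)
    (A : Finset W) :
    prob (powersetCard k (univ : Finset W)) (fun c => A ⊆ c) ≤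
      ((k : ℝ) / Fintype.card W) ^ #A := by
  classical
  by_cases hA : #A ≤ k
  · have := prob_subset_disjoint_le (P := (univ : Finset W)) (T := A) (M := ∅) (m := k)
      (subset_univ _) (subset_univ _) (disjoint_empty_right _) hA (by simpa using hkW)
      (by simpa using hW)
    simpa using this
  · have : prob (powersetCard k (univ : Finset W)) (fun c => A ⊆ c) = 0 :=
      prob_eq_zero fun c hc hAc => hA ((card_le_card hAc).trans_eq (mem_powersetCard.1 hc).2)
    rw [this]
    positivity

open Classical in
/-- The probability that prescribed edges get prescribed colours, and that two given colours occur
only a few times. -/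
theorem prob_incidence_and_rare_le (hk : 2 ≤ k) (hkW : k ≤ Fintype.card W)
    (hW : 4 ≤ Fintype.card W) (Q : Finset (W × α)) (E : Finset α) {w₁ w₂ : W} (hw : w₁ ≠ w₂)
    (t : ℕ) :
    prob (colourings α W k) (fun χ => (∀ q ∈ Q, q.1 ∈ χ q.2) ∧
        #(E.filter fun e => w₁ ∈ χ e) ≤ t ∧ #(E.filter fun e => w₂ ∈ χ e) ≤ t) ≤
      ((k : ℝ) / Fintype.card W) ^ #Q *
        Real.exp (4 * t - 12 / 5 * (((#E : ℝ) - #Q) / Fintype.card W)) := by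
  set N : ℝ := (Fintype.card W : ℝ) with hN
  have hN4 : (4 : ℝ) ≤ N := by rw [hN]; exact_mod_cast hW
  set F := Q.image Prod.snd with hF
  set A : α → Finset W := fun e => univ.filter fun w => (w, e) ∈ Q with hA
  set x : ℝ := Real.exp (-2) with hx
  have hx0 : 0 < x := Real.exp_pos _
  have hx1 : x ≤ 1 / 7 := by
    have : (7 : ℝ) ≤ Real.exp 2 := by
      have h1 := Real.exp_one_gt_d9
      rw [show (2 : ℝ) = 1 + 1 by norm_num, Real.exp_add]
      nlinarith
    rw [hx, Real.exp_neg, ← one_div]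
    exact one_div_le_one_div_of_le (by norm_num) this
  -- Exponential weight: the edges of F only record their prescribed colours, and every other edge
  -- of E costs a factor x = e^{-2} if it has w₁ or w₂. On the event at most 2t edges do, so the
  -- product is at least e^{-4t}.
  set g : α → Finset W → ℝ := fun e c => if e ∈ F then (if A e ⊆ c then 1 else 0) else
    if e ∈ E then (if w₁ ∈ c ∨ w₂ ∈ c then x else 1) else 1 with hg
  have hg0 : ∀ e c, 0 ≤ g e c := by
    intro e c
    simp only [hg]
    split_ifs <;> positivity
  have hpos : (0 : ℝ) < #(powersetCard k (univ : Finset W)) := by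
    rw [card_powersetCard]
    exact_mod_cast (Nat.choose_pos (by simpa using hkW))
  have step : prob (colourings α W k) (fun χ => (∀ q ∈ Q, q.1 ∈ χ q.2) ∧
        #(E.filter fun e => w₁ ∈ χ e) ≤ t ∧ #(E.filter fun e => w₂ ∈ χ e) ≤ t) ≤
      (∑ χ ∈ colourings α W k, Real.exp (4 * t) * ∏ e, g e (χ e)) / #(colourings α W k) := by
    refine prob_le_sum_div (fun χ _ => mul_nonneg (Real.exp_pos _).le
      (prod_nonneg fun e _ => hg0 _ _)) ?_
    rintro χ - ⟨h1, h2, h3⟩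
    have h4 : ∏ e ∈ E.filter (fun e => w₁ ∈ χ e ∨ w₂ ∈ χ e), x ≤ ∏ e, g e (χ e) := by
      rw [show ∏ e ∈ E.filter (fun e => w₁ ∈ χ e ∨ w₂ ∈ χ e), x =
        ∏ e, if e ∈ E.filter (fun e => w₁ ∈ χ e ∨ w₂ ∈ χ e) then x else 1 by
          rw [prod_ite_mem, univ_inter]]
      refine prod_le_prod (fun e _ => by positivity) fun e _ => ?_
      have hle : (if e ∈ E.filter (fun e => w₁ ∈ χ e ∨ w₂ ∈ χ e) then x else 1) ≤ 1 := by
        split_ifs <;> linarith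
      simp only [hg]
      by_cases heF : e ∈ F
      · rw [if_pos heF, if_pos (show A e ⊆ χ e from fun w hw => h1 (w, e) (by simpa [hA] using hw))]
        exact hle
      · rw [if_neg heF]
        by_cases heE : e ∈ E
        · simp [heE]
        · simp [heE]
    have h5 : #(E.filter (fun e => w₁ ∈ χ e ∨ w₂ ∈ χ e)) ≤ 2 * t := by
      rw [filter_or]
      exact (card_union_le _ _).trans (by omega)
    rw [prod_const] at h4
    have h6 : Real.exp (-(4 * t)) ≤ ∏ e, g e (χ e) := by
      refine le_trans ?_ h4
      rw [hx, ← Real.exp_nat_mul]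
      apply Real.exp_le_exp.2
      have : (#(E.filter (fun e => w₁ ∈ χ e ∨ w₂ ∈ χ e)) : ℝ) ≤ 2 * t := by exact_mod_cast h5
      linarith
    calc (1 : ℝ) = Real.exp (4 * t) * Real.exp (-(4 * t)) := by rw [← Real.exp_add]; simp
      _ ≤ _ := by gcongr
  refine step.trans ?_
  rw [← mul_sum, mul_div_assoc, sum_prod_colourings]
  have havg1 : ∀ e ∈ F, (∑ c ∈ powersetCard k (univ : Finset W), g e c) /
      #(powersetCard k (univ : Finset W)) ≤ (k / N) ^ #(A e) := by
    intro e he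
    have := prob_superset_colour_le hkW (by omega) (A e)
    rw [prob_eq_sum] at this
    simpa [hg, he] using this
  have havg2 : ∀ e ∈ E \ F, (∑ c ∈ powersetCard k (univ : Finset W), g e c) /
      #(powersetCard k (univ : Finset W)) ≤ Real.exp (-(12 / 5 / N)) := by
    intro e he
    obtain ⟨he1, he2⟩ := mem_sdiff.1 he
    have h1 := prob_colour_subset_le hk ({w₁, w₂}ᶜ : Finset W)
    have hc : (#({w₁, w₂}ᶜ : Finset W) : ℝ) = N - 2 := by
      rw [card_compl, Nat.cast_sub (card_le_univ _), card_pair hw]; norm_num [hN]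
    rw [hc, ← hN, prob_eq_sum] at h1
    have h2 : (∑ c ∈ powersetCard k (univ : Finset W), g e c) /
      #(powersetCard k (univ : Finset W)) = x + (1 - x) *
        ((∑ c ∈ powersetCard k (univ : Finset W),
          if c ⊆ ({w₁, w₂}ᶜ : Finset W) then (1 : ℝ) else 0) /
            #(powersetCard k (univ : Finset W))) := by
      have h3 : ∀ c : Finset W, g e c = x + (1 - x) *
          (if c ⊆ ({w₁, w₂}ᶜ : Finset W) then (1 : ℝ) else 0) := by
        intro c
        have : c ⊆ ({w₁, w₂}ᶜ : Finset W) ↔ ¬ (w₁ ∈ c ∨ w₂ ∈ c) := by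
          rw [subset_compl_comm, insert_subset_iff, singleton_subset_iff, mem_compl, mem_compl]
          tauto
        simp only [hg, he1, he2, if_true, if_false, this]
        by_cases h : w₁ ∈ c ∨ w₂ ∈ c <;> simp [h]
      simp_rw [h3]
      rw [sum_add_distrib, ← mul_sum, sum_const, nsmul_eq_mul, add_div,
        mul_div_cancel_left₀ _ hpos.ne', mul_div_assoc]
    rw [h2]
    have h4 := Real.add_one_le_exp (-(12 / 5 / N))
    -- This needs N ≥ 4. The mean weight of an edge is then at most 1 - (6/7)(3/N), and 18/7 > 12/5.
    have h5 : ((N - 2) / N) ^ 2 ≤ 1 - 3 * (1 / N) := by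
      have hN0 : 0 < N := by linarith
      rw [div_pow, div_le_iff₀ (by positivity)]
      have : (1 - 3 * (1 / N)) * N ^ 2 = N ^ 2 - 3 * N := by field_simp
      rw [this]
      nlinarith
    have h6 : 12 / 5 / N = 12 / 5 * (1 / N) := by ring
    have h7 : (0 : ℝ) ≤ 1 / N := by positivity
    rw [h6] at h4 ⊢
    nlinarith
  have havg3 : ∀ e ∉ F, e ∉ E → (∑ c ∈ powersetCard k (univ : Finset W), g e c) /
      #(powersetCard k (univ : Finset W)) = 1 := by
    intro e he1 he2
    simp only [hg, he1, he2, if_false, sum_const, nsmul_eq_mul, mul_one]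
    exact div_self hpos.ne'
  have hprod : ∏ e, (∑ c ∈ powersetCard k (univ : Finset W), g e c) /
      #(powersetCard k (univ : Finset W)) ≤
      (∏ e ∈ F, (k / N) ^ #(A e)) * ∏ e ∈ E \ F, Real.exp (-(12 / 5 / N)) := by
    rw [← prod_subset (subset_univ (F ∪ E \ F)), prod_union disjoint_sdiff]
    · refine mul_le_mul (prod_le_prod (fun e _ => ?_) havg1) (prod_le_prod (fun e _ => ?_) havg2)
        (prod_nonneg fun e _ => ?_) (by positivity)
      all_goals exact div_nonneg (sum_nonneg fun c _ => hg0 _ _) hpos.le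
    · intro e _ he
      simp only [union_sdiff_self_eq_union, mem_union, not_or] at he
      exact havg3 e he.1 he.2
  refine (mul_le_mul_of_nonneg_left hprod (Real.exp_pos _).le).trans ?_
  have hQ : ∑ e ∈ F, #(A e) = #Q := by
    rw [card_eq_sum_card_image Prod.snd Q]
    refine sum_congr rfl fun e _ => ?_
    refine card_bij (fun w _ => (w, e)) ?_ ?_ ?_
    · intro w hw
      simpa [hA] using hw
    · intro a _ b _ h
      exact (Prod.mk.inj h).1
    · rintro ⟨w, e'⟩ hb
      obtain ⟨h1, h2⟩ := mem_filter.1 hb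
      simp only at h2
      subst h2
      exact ⟨w, by simpa [hA] using h1, rfl⟩
  rw [prod_pow_eq_pow_sum, hQ, prod_const, ← Real.exp_nat_mul]
  have hcard : (#E : ℝ) - #Q ≤ #(E \ F) := by
    have h1 : #E ≤ #(E \ F) + #F := by
      have := card_le_card_sdiff_add_card (s := E) (t := F)
      omega
    have h2 : #F ≤ #Q := card_image_le
    have : (#E : ℝ) ≤ #(E \ F) + #Q := by exact_mod_cast h1.trans (by omega)
    linarith
  rw [mul_left_comm, ← Real.exp_add]
  gcongr
  have hN0 : 0 < N := by linarith
  have : 12 / 5 * (((#E : ℝ) - #Q) / N) ≤ #(E \ F) * (12 / 5 / N) := by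
    rw [mul_div_assoc', mul_div_assoc', mul_comm (12 / 5 : ℝ)]
    gcongr
  linarith

end Colourings

/-! ### From coloured graphs to a product space -/

section Transfer
open Finset

/-- The potential edges of a graph on `Fin n`. -/
def edgePairs (n : ℕ) : Finset (Sym2 (Fin n)) := univ.filter fun e => ¬ e.IsDiag

theorem mem_edgePairs {n : ℕ} {e : Sym2 (Fin n)} : e ∈ edgePairs n ↔ ¬ e.IsDiag := by
  simp [edgePairs]

theorem card_edgePairs (n : ℕ) : #(edgePairs n) = n.choose 2 := by
  have := Sym2.card_subtype_not_diag (α := Fin n)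
  rw [Fintype.card_subtype, Fintype.card_fin] at this
  exact this

/-- Extending colourings of the edges of a subset to all edges multiplies the number of colourings
by a constant. -/
theorem card_filter_colourings {α W : Type} [Fintype α] [Fintype W] (k : ℕ) (S : Set α)
    (P : (S → {c : Finset W // #c = k}) → Prop) (P' : (α → Finset W) → Prop) [DecidablePred P']
    (h : ∀ χ : α → Finset W, ∀ hχ : ∀ e, #(χ e) = k, P' χ ↔ P fun e => ⟨χ e, hχ e⟩) :
    #((colourings α W k).filter P') =
      Nat.card {col // P col} * (Fintype.card W).choose k ^ (Fintype.card α - S.ncard) := by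
  classical
  have e1 : {χ // χ ∈ (colourings α W k).filter P'} ≃
      {col // P col} × ({e // e ∉ S} → {c : Finset W // #c = k}) :=
    { toFun := fun χ => (⟨fun e => ⟨χ.1 e, mem_colourings.1 (mem_filter.1 χ.2).1 e⟩,
          (h _ (mem_colourings.1 (mem_filter.1 χ.2).1)).1 (mem_filter.1 χ.2).2⟩,
        fun e => ⟨χ.1 e, mem_colourings.1 (mem_filter.1 χ.2).1 e⟩)
      invFun := fun p => ⟨fun e => if he : e ∈ S then (p.1.1 ⟨e, he⟩).1 else (p.2 ⟨e, he⟩).1, by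
        have hk : ∀ e, #(if he : e ∈ S then (p.1.1 ⟨e, he⟩).1 else (p.2 ⟨e, he⟩).1) = k := by
          intro e
          split_ifs with he
          · exact (p.1.1 ⟨e, he⟩).2
          · exact (p.2 ⟨e, he⟩).2
        refine mem_filter.2 ⟨mem_colourings.2 hk, (h _ hk).2 ?_⟩
        convert p.1.2 with e
        simp⟩
      left_inv := by
        rintro ⟨χ, hχ⟩
        ext e
        simp
      right_inv := by
        rintro ⟨⟨col, hcol⟩, d⟩
        ext e x
        · simp
        · have := e.2
          simp [this] }
  rw [← Fintype.card_coe, ← Nat.card_eq_fintype_card, Nat.card_congr e1, Nat.card_prod]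
  congr 1
  rw [Nat.card_eq_fintype_card, Fintype.card_fun, Fintype.card_subtype_compl,
    Fintype.card_finset_len, ← Nat.card_coe_set_eq, Nat.card_eq_fintype_card]

/-- All graphs considered have m edges, so a colouring of the edges extends to all pairs in the same
number of ways for each of them. After this extension the sample space is a product of edge sets and
colourings. -/
theorem card_colouredGraph_subtype (n m k : ℕ)
    (P : ∀ G : {G : SimpleGraph (Fin n) // G.edgeSet.ncard = m},
      (G.1.edgeSet → {S : Finset (Fin (n - 1)) // S.card = k}) → Prop)
    (P' : Finset (Sym2 (Fin n)) → (Sym2 (Fin n) → Finset (Fin (n - 1))) → Prop)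
    [∀ E, DecidablePred (P' E)]
    (h : ∀ G : {G : SimpleGraph (Fin n) // G.edgeSet.ncard = m}, ∀ E : Finset (Sym2 (Fin n)),
      (E : Set (Sym2 (Fin n))) = G.1.edgeSet → ∀ χ, ∀ hχ : ∀ e : Sym2 (Fin n), #(χ e) = k,
        (P' E χ ↔ P G fun e => ⟨χ e, hχ e⟩)) :
    #((powersetCard m (edgePairs n) ×ˢ colourings (Sym2 (Fin n)) (Fin (n - 1)) k).filter
        fun ω => P' ω.1 ω.2) =
      Nat.card {ω : ColouredGraph n m k // P ω.1 ω.2} *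
        (n - 1).choose k ^ (Fintype.card (Sym2 (Fin n)) - m) := by
  classical
  have e1 : {ω : ColouredGraph n m k // P ω.1 ω.2} ≃
      Σ G : {G : SimpleGraph (Fin n) // G.edgeSet.ncard = m}, {col // P G col} :=
    { toFun := fun ω => ⟨ω.1.1, ω.1.2, ω.2⟩
      invFun := fun p => ⟨⟨p.1, p.2.1⟩, p.2.2⟩
      left_inv := fun _ => rfl
      right_inv := fun _ => rfl }
  rw [Nat.card_congr e1, Nat.card_sigma, sum_mul, card_filter, sum_product]
  symm
  refine sum_bij (fun G _ => G.1.edgeFinset) ?_ ?_ ?_ ?_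
  · intro G _
    refine mem_powersetCard.2 ⟨fun e he => ?_, ?_⟩
    · rw [mem_edgePairs]
      exact G.1.not_isDiag_of_mem_edgeSet (SimpleGraph.mem_edgeFinset.1 he)
    · have := G.2
      rwa [← SimpleGraph.coe_edgeFinset, Set.ncard_coe_finset] at this
  · intro G _ G' _ hGG
    exact Subtype.ext (SimpleGraph.edgeFinset_inj.1 hGG)
  · intro E hE
    obtain ⟨h1, h2⟩ := mem_powersetCard.1 hE
    have hset : (SimpleGraph.fromEdgeSet (E : Set (Sym2 (Fin n)))).edgeSet = E := by
      rw [SimpleGraph.edgeSet_fromEdgeSet]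
      ext e
      simp only [Set.mem_sdiff, mem_coe, and_iff_left_iff_imp]
      exact fun he => mem_edgePairs.1 (h1 he)
    refine ⟨⟨SimpleGraph.fromEdgeSet (E : Set (Sym2 (Fin n))), ?_⟩, mem_univ _, ?_⟩
    · rw [hset, Set.ncard_coe_finset, h2]
    · apply coe_injective
      rw [SimpleGraph.coe_edgeFinset, hset]
  · intro G _
    rw [← card_filter]
    have := card_filter_colourings (W := Fin (n - 1)) k G.1.edgeSet (P G) (P' G.1.edgeFinset)
      (h G G.1.edgeFinset (SimpleGraph.coe_edgeFinset _))
    rw [this, G.2, Fintype.card_fin]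

theorem rainbowProb_eq_prob {n k : ℕ} (hk : k ≤ n - 1) (m : ℕ) :
    rainbowProb n m k =
      prob (powersetCard m (edgePairs n) ×ˢ colourings (Sym2 (Fin n)) (Fin (n - 1)) k)
        (fun ω => HasRainbowSpanningTree (SimpleGraph.fromEdgeSet (ω.1 : Set (Sym2 (Fin n))))
          (fun e => ω.2 e.1)) := by
  classical
  have h1 := card_colouredGraph_subtype n m k
    (fun G col => HasRainbowSpanningTree G.1 (fun e => (col e).1))
    (fun E χ => HasRainbowSpanningTree (SimpleGraph.fromEdgeSet (E : Set (Sym2 (Fin n))))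
          (fun e => χ e.1)) (by
      intro G E hE χ hχ
      have : SimpleGraph.fromEdgeSet (E : Set (Sym2 (Fin n))) = G.1 := by
        rw [hE, SimpleGraph.fromEdgeSet_edgeSet]
      generalize SimpleGraph.fromEdgeSet (E : Set (Sym2 (Fin n))) = H at this
      subst this
      rfl)
  have h2 := card_colouredGraph_subtype n m k (fun _ _ => True) (fun _ _ => True)
    (fun _ _ _ _ _ => Iff.rfl)
  rw [filter_true] at h2
  have h3 : Nat.card {ω : ColouredGraph n m k // True} = Nat.card (ColouredGraph n m k) :=
    Nat.card_congr (Equiv.subtypeUnivEquiv fun _ => trivial)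
  have hpos : (0 : ℝ) < ((n - 1).choose k ^ (Fintype.card (Sym2 (Fin n)) - m) : ℕ) := by
    exact_mod_cast pow_pos (Nat.choose_pos hk) _
  rw [h3] at h2
  unfold prob rainbowProb
  rw [h2]
  have h4 : ∀ s : Finset (Finset (Sym2 (Fin n)) × (Sym2 (Fin n) → Finset (Fin (n - 1)))),
    ∀ P : _ → Prop, ∀ _ : DecidablePred P, s.filter P = @Finset.filter _ P
      (fun a => Classical.propDecidable (P a)) s := by
    intro s P _; congr!
  rw [← h4, h1]
  push_cast
  push_cast at hpos
  rw [mul_div_mul_right _ _ hpos.ne']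

end Transfer

/-! ### Degrees, boundaries and crossing edges of nice graphs -/

section EdgeSets
open Finset

variable {V : Type*}

open Classical in
/-- The edges of `E` at the vertex `v`. -/
noncomputable def edgesAt (E : Finset (Sym2 V)) (v : V) : Finset (Sym2 V) :=
  E.filter fun e => v ∈ e

open Classical in
/-- The edges of `E` between `S` and its complement. -/
noncomputable def edgeBoundary (E : Finset (Sym2 V)) (S : Finset V) : Finset (Sym2 V) :=
  E.filter fun e => (∃ v ∈ e, v ∈ S) ∧ ∃ v ∈ e, v ∉ S

open Classical in
/-- The edges of `E` with both endpoints in `S`. -/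
noncomputable def edgesInside (E : Finset (Sym2 V)) (S : Finset V) : Finset (Sym2 V) :=
  E.filter fun e => ∀ v ∈ e, v ∈ S

open Classical in
/-- The edges of `E` joining different classes of the partition given by `c`. -/
noncomputable def crossingEdges {C : Type*} (E : Finset (Sym2 V)) (c : V → C) : Finset (Sym2 V) :=
  E.filter fun e => ∃ u ∈ e, ∃ v ∈ e, c u ≠ c v

theorem mem_edgesAt {E : Finset (Sym2 V)} {v : V} {e : Sym2 V} :
    e ∈ edgesAt E v ↔ e ∈ E ∧ v ∈ e := by simp [edgesAt]

theorem mem_edgeBoundary {E : Finset (Sym2 V)} {S : Finset V} {e : Sym2 V} :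
    e ∈ edgeBoundary E S ↔ e ∈ E ∧ (∃ v ∈ e, v ∈ S) ∧ ∃ v ∈ e, v ∉ S := by simp [edgeBoundary]

theorem mem_edgesInside {E : Finset (Sym2 V)} {S : Finset V} {e : Sym2 V} :
    e ∈ edgesInside E S ↔ e ∈ E ∧ ∀ v ∈ e, v ∈ S := by simp [edgesInside]

theorem mem_crossingEdges {C : Type*} {E : Finset (Sym2 V)} {c : V → C} {e : Sym2 V} :
    e ∈ crossingEdges E c ↔ e ∈ E ∧ ∃ u ∈ e, ∃ v ∈ e, c u ≠ c v := by simp [crossingEdges]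

theorem sum_card_edgesAt_le (E : Finset (Sym2 V)) (S : Finset V) :
    ∑ v ∈ S, #(edgesAt E v) ≤ #(edgeBoundary E S) + 2 * #(edgesInside E S) := by
  classical
  have h1 : ∑ v ∈ S, #(edgesAt E v) = ∑ e ∈ E, #(S.filter fun v => v ∈ e) := by
    simp_rw [edgesAt, card_filter]
    rw [sum_comm]
  have h2 : #(edgeBoundary E S) + 2 * #(edgesInside E S) = ∑ e ∈ E,
      ((if (∃ v ∈ e, v ∈ S) ∧ ∃ v ∈ e, v ∉ S then 1 else 0) +
        2 * if ∀ v ∈ e, v ∈ S then 1 else 0) := by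
    rw [sum_add_distrib, ← mul_sum, edgeBoundary, edgesInside, card_filter, card_filter]
  rw [h1, h2]
  refine sum_le_sum fun e _ => ?_
  induction e with | _ x y =>
  have h3 : S.filter (fun v => v ∈ s(x, y)) ⊆ ({x, y} : Finset V) := by
    intro v hv
    simpa using (mem_filter.1 hv).2
  by_cases hx : x ∈ S <;> by_cases hy : y ∈ S
  · have := (card_le_card h3).trans card_le_two
    simp [hx, hy]
    simpa using this
  · have : S.filter (fun v => v ∈ s(x, y)) ⊆ {x} := by
      intro v hv
      have h4 := h3 hv
      simp only [mem_insert, mem_singleton] at h4 ⊢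
      rcases h4 with rfl | rfl
      · rfl
      · exact absurd (mem_filter.1 hv).1 hy
    have := card_le_card this
    simp only [Sym2.mem_iff] at this
    simp [hx, hy]
    simpa using this
  · have : S.filter (fun v => v ∈ s(x, y)) ⊆ {y} := by
      intro v hv
      have h4 := h3 hv
      simp only [mem_insert, mem_singleton] at h4 ⊢
      rcases h4 with rfl | rfl
      · exact absurd (mem_filter.1 hv).1 hx
      · rfl
    have := card_le_card this
    simp only [Sym2.mem_iff] at this
    simp [hx, hy]
    simpa using this
  · have : S.filter (fun v => v ∈ s(x, y)) = ∅ := by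
      refine filter_eq_empty_iff.2 fun v hv hve => ?_
      rcases Sym2.mem_iff.1 hve with rfl | rfl
      · exact hx hv
      · exact hy hv
    rw [this]
    simp

open Classical in
/-- The class of a partition. -/
noncomputable def partitionClass [Fintype V] {C : Type*} (c : V → C) (a : C) : Finset V :=
  univ.filter fun v => c v = a

theorem mem_partitionClass [Fintype V] {C : Type*} {c : V → C} {a : C} {v : V} :
    v ∈ partitionClass c a ↔ c v = a := by simp [partitionClass]

/-- A crossing edge lies on the boundary of the classes of its two ends only. -/
theorem sum_card_edgeBoundary_le [Fintype V] {C : Type*} (E : Finset (Sym2 V))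
    (c : V → C) (D : Finset C) :
    ∑ a ∈ D, #(edgeBoundary E (partitionClass c a)) ≤ 2 * #(crossingEdges E c) := by
  classical
  have h1 : ∀ a, edgeBoundary E (partitionClass c a) =
      (crossingEdges E c).filter fun e => e ∈ edgeBoundary E (partitionClass c a) := by
    intro a
    ext e
    simp only [mem_filter, mem_crossingEdges, mem_edgeBoundary, mem_partitionClass]
    constructor
    · rintro ⟨he, ⟨u, hu, hua⟩, v, hv, hva⟩
      exact ⟨⟨he, u, hu, v, hv, fun h => hva (h ▸ hua)⟩, he, ⟨u, hu, hua⟩, v, hv, hva⟩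
    · exact fun h => h.2
  have h2 : ∑ a ∈ D, #(edgeBoundary E (partitionClass c a)) =
      ∑ e ∈ crossingEdges E c, #(D.filter fun a => e ∈ edgeBoundary E (partitionClass c a)) := by
    rw [sum_congr rfl fun a _ => congrArg card (h1 a)]
    simp_rw [card_filter]
    rw [sum_comm]
  rw [h2, mul_comm, ← smul_eq_mul]
  refine sum_le_card_nsmul _ _ _ fun e _ => ?_
  induction e with | _ x y =>
  have : (D.filter fun a => s(x, y) ∈ edgeBoundary E (partitionClass c a)) ⊆ {c x, c y} := by
    intro a ha
    obtain ⟨-, ⟨v, hv, hva⟩, -⟩ := mem_edgeBoundary.1 (mem_filter.1 ha).2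
    rw [mem_partitionClass] at hva
    rcases Sym2.mem_iff.1 hv with rfl | rfl <;> simp [hva]
  exact (card_le_card this).trans card_le_two

/-- Pseudo-random properties of a sparse graph with edge set `E`: vertices of degree at most `d`
are few and far apart, sets of at most `2 * u` vertices span few edges, and larger sets have large
boundary. -/
structure IsNice [Fintype V] (E : Finset (Sym2 V)) (d u l Δ : ℝ) : Prop where
  not_isDiag : ∀ e ∈ E, ¬ e.IsDiag
  not_adj : ∀ x y, x ≠ y → (#(edgesAt E x) : ℝ) ≤ d → (#(edgesAt E y) : ℝ) ≤ d → s(x, y) ∉ E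
  not_common : ∀ x y z, x ≠ y → (#(edgesAt E x) : ℝ) ≤ d → (#(edgesAt E y) : ℝ) ≤ d →
    s(x, z) ∈ E → s(y, z) ∉ E
  inside_le : ∀ U : Finset V, (#U : ℝ) ≤ 2 * u → #(edgesInside E U) ≤ 2 * #U
  boundary_ge : ∀ S : Finset V, u ≤ #S → 2 * #S ≤ Fintype.card V → 16 ≤ #(edgeBoundary E S)
  card_low_le : (Nat.card {v // (#(edgesAt E v) : ℝ) ≤ d} : ℝ) ≤ l
  card_edgesAt_le : ∀ v, (#(edgesAt E v) : ℝ) ≤ Δ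

variable [Fintype V] {E : Finset (Sym2 V)} {d u l Δ : ℝ}

/-- The point is |S| < u with at least two vertices. Low vertices of S have neighbours in S, are not
adjacent and share no neighbour, so they inject into the others: at least half of S has degree above
40. The degree sum is at least 20|S|, edges inside account for at most 4|S|, and 16|S| is left for
the boundary. -/
theorem IsNice.le_card_edgeBoundary (h : IsNice E d u l Δ) (hd : 40 ≤ d) {S : Finset V}
    (hS0 : S.Nonempty) (hSn : 2 * #S ≤ Fintype.card V)
    (hSc : 2 ≤ #S → ∀ v ∈ S, ∃ x ∈ S, s(v, x) ∈ E)
    (hlow : ∀ v, (#(edgesAt E v) : ℝ) ≤ d → S ≠ {v}) : 16 ≤ #(edgeBoundary E S) := by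
  classical
  rcases le_or_gt u #S with hu | hu
  · exact h.boundary_ge S hu hSn
  have hu0 : 0 < u := lt_of_le_of_lt (by positivity) hu
  have hsum := sum_card_edgesAt_le E S
  rcases Nat.lt_or_ge #S 2 with h2 | h2
  · have h1 : #S = 1 := by
      have := hS0.card_pos
      omega
    obtain ⟨v, rfl⟩ := card_eq_one.1 h1
    have hv : ¬ (#(edgesAt E v) : ℝ) ≤ d := fun hv => hlow v hv rfl
    have hin : edgesInside E {v} = ∅ := by
      refine eq_empty_of_forall_notMem fun e he => ?_
      obtain ⟨he1, he2⟩ := mem_edgesInside.1 he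
      induction e with | _ x y =>
      have hx : x = v := by simpa using he2 x (by simp)
      have hy : y = v := by simpa using he2 y (by simp)
      exact h.not_isDiag _ he1 (by simp [hx, hy])
    rw [hin, sum_singleton, card_empty, mul_zero, add_zero] at hsum
    have : (16 : ℝ) ≤ #(edgeBoundary E {v}) := by
      have : (#(edgesAt E v) : ℝ) ≤ #(edgeBoundary E {v}) := by exact_mod_cast hsum
      linarith
    exact_mod_cast this
  · have hin := h.inside_le S (by linarith)
    set A := S.filter fun v => (#(edgesAt E v) : ℝ) ≤ d with hA
    have hne : ∀ v ∈ S, ∃ x ∈ S, s(v, x) ∈ E := hSc h2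
    choose! g hg1 hg2 using hne
    have hAc : #A ≤ #(S \ A) := by
      refine card_le_card_of_injOn g ?_ ?_
      · intro v hv
        obtain ⟨hvS, hvd⟩ := mem_filter.1 (mem_coe.1 hv)
        refine mem_coe.2 (mem_sdiff.2 ⟨hg1 v hvS, fun hgA => ?_⟩)
        refine h.not_adj v (g v) ?_ hvd (mem_filter.1 hgA).2 (hg2 v hvS)
        intro heq
        exact h.not_isDiag _ (hg2 v hvS) (by simpa using heq)
      · intro v hv w hw hvw
        obtain ⟨hvS, hvd⟩ := mem_filter.1 (mem_coe.1 hv)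
        obtain ⟨hwS, hwd⟩ := mem_filter.1 (mem_coe.1 hw)
        by_contra hne
        refine h.not_common v w (g v) hne hvd hwd (hg2 v hvS) ?_
        rw [hvw]
        exact hg2 w hwS
    have hcard : #S ≤ 2 * #(S \ A) := by
      have := card_sdiff_add_card_eq_card (filter_subset (fun v => (#(edgesAt E v) : ℝ) ≤ d) S)
      rw [← hA] at this
      omega
    have hdeg : (40 : ℝ) * #(S \ A) ≤ ((∑ v ∈ S, #(edgesAt E v) : ℕ) : ℝ) := by
      rw [Nat.cast_sum]
      calc (40 : ℝ) * #(S \ A) = ∑ v ∈ S \ A, (40 : ℝ) := by simp [mul_comm]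
        _ ≤ ∑ v ∈ S \ A, (#(edgesAt E v) : ℝ) := by
          refine sum_le_sum fun v hv => ?_
          obtain ⟨hv1, hv2⟩ := mem_sdiff.1 hv
          have : ¬ (#(edgesAt E v) : ℝ) ≤ d := fun hvd => hv2 (mem_filter.2 ⟨hv1, hvd⟩)
          linarith
        _ ≤ ∑ v ∈ S, (#(edgesAt E v) : ℝ) :=
          sum_le_sum_of_subset_of_nonneg sdiff_subset fun _ _ _ => by positivity
    have hdeg' : 40 * #(S \ A) ≤ ∑ v ∈ S, #(edgesAt E v) := by exact_mod_cast hdeg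
    omega

open Classical in
/-- The edges at vertices of degree at most `d`. -/
noncomputable def lowEdges (E : Finset (Sym2 V)) (d : ℝ) : Finset (Sym2 V) :=
  E.filter fun e => ∃ v ∈ e, (#(edgesAt E v) : ℝ) ≤ d

theorem mem_lowEdges {e : Sym2 V} :
    e ∈ lowEdges E d ↔ e ∈ E ∧ ∃ v ∈ e, (#(edgesAt E v) : ℝ) ≤ d := by simp [lowEdges]

theorem IsNice.card_lowEdges_le (h : IsNice E d u l Δ) (hd : 0 ≤ d) :
    (#(lowEdges E d) : ℝ) ≤ l * d := by
  classical
  have h1 : lowEdges E d ⊆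
      (univ.filter fun v => (#(edgesAt E v) : ℝ) ≤ d).biUnion fun v => edgesAt E v := by
    intro e he
    obtain ⟨he1, v, hv, hvd⟩ := mem_lowEdges.1 he
    exact mem_biUnion.2 ⟨v, by simp [hvd], mem_edgesAt.2 ⟨he1, hv⟩⟩
  have h2 : (#(lowEdges E d) : ℝ) ≤ ∑ v ∈ univ.filter (fun v => (#(edgesAt E v) : ℝ) ≤ d), d := by
    calc (#(lowEdges E d) : ℝ)
        ≤ ((∑ v ∈ univ.filter (fun v => (#(edgesAt E v) : ℝ) ≤ d), #(edgesAt E v) : ℕ) : ℝ) := by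
          exact_mod_cast (card_le_card h1).trans card_biUnion_le
      _ ≤ _ := by
          rw [Nat.cast_sum]
          exact sum_le_sum fun v hv => (mem_filter.1 hv).2
  rw [sum_const, nsmul_eq_mul] at h2
  refine h2.trans ?_
  gcongr
  have := h.card_low_le
  rwa [Nat.card_eq_fintype_card, Fintype.card_subtype] at this

/-- If deleting the crossing edges of a partition into connected classes creates `j + 2` classes,
then there are many crossing edges, or many crossing edges at vertices of low degree. -/
theorem IsNice.crossingEdges_of_connected (h : IsNice E d u l Δ) (hd : 40 ≤ d)
    (hiso : ∀ v, ∃ e ∈ E, v ∈ e) {C : Type*} [Fintype C] (c : V → C)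
    (hc : Function.Surjective c)
    (hin : ∀ v x, v ≠ x → c v = c x → ∃ y, c y = c v ∧ s(v, y) ∈ E) (j : ℕ)
    (hj : j + 2 ≤ Fintype.card C) :
    2 * (j + 1) ≤ #(crossingEdges E c) ∨
      ∃ F ⊆ crossingEdges E c, F ⊆ lowEdges E d ∧ 3 * (j + 1) ≤ 4 * #F := by
  classical
  set D : Finset C := univ.filter fun a => 2 * #(partitionClass c a) ≤ Fintype.card V with hD
  have hne : ∀ a, (partitionClass c a).Nonempty := fun a => by
    obtain ⟨v, hv⟩ := hc a
    exact ⟨v, mem_partitionClass.2 hv⟩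
  -- Two disjoint classes cannot both contain more than half of the vertices, so at most one class
  -- is lost.
  have hDc : j + 1 ≤ #D := by
    have h1 : #(univ \ D) ≤ 1 := by
      refine card_le_one.2 fun a ha b hb => ?_
      simp only [hD, Finset.mem_sdiff, mem_univ, mem_filter, true_and, not_le] at ha hb
      by_contra hab
      have hdis : Disjoint (partitionClass c a) (partitionClass c b) := by
        rw [disjoint_left]
        intro v hva hvb
        exact hab ((mem_partitionClass.1 hva).symm.trans (mem_partitionClass.1 hvb))
      have := card_le_univ (partitionClass c a ∪ partitionClass c b)
      rw [card_union_of_disjoint hdis] at this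
      omega
    have h2 := card_sdiff_add_card_eq_card (subset_univ D)
    rw [Finset.card_univ] at h2
    omega
  set Dl : Finset C := D.filter fun a => ∃ v, (#(edgesAt E v) : ℝ) ≤ d ∧ partitionClass c a = {v}
    with hDl
  -- Either singleton low classes abound, and they have distinct edges because low vertices are not
  -- adjacent; or more than (j + 1)/4 classes have boundary at least 16, which after double counting
  -- leaves 2(j + 1) edges.
  by_cases hcase : 3 * (j + 1) ≤ 4 * #Dl
  · right
    have hex : ∀ a ∈ Dl, ∃ e ∈ crossingEdges E c, ∃ v ∈ e, c v = a ∧ (#(edgesAt E v) : ℝ) ≤ d := by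
      intro a ha
      obtain ⟨-, v, hvd, hv⟩ := mem_filter.1 ha
      obtain ⟨e, he, hve⟩ := hiso v
      have hcv : c v = a := mem_partitionClass.1 (by rw [hv]; simp)
      refine ⟨e, ?_, v, hve, hcv, hvd⟩
      obtain ⟨y, rfl⟩ := Sym2.mem_iff_exists.1 hve
      refine mem_crossingEdges.2 ⟨he, v, by simp, y, by simp, fun hcy => ?_⟩
      have : y ∈ partitionClass c a := mem_partitionClass.2 (hcy.symm.trans hcv)
      rw [hv, mem_singleton] at this
      exact h.not_isDiag _ he (by simp [this])
    have : Nonempty (Sym2 V) := by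
      obtain ⟨a⟩ := Fintype.card_pos_iff.1 (show 0 < Fintype.card C by omega)
      obtain ⟨v, -⟩ := hc a
      exact ⟨s(v, v)⟩
    choose! g hg1 hg2 using hex
    refine ⟨Dl.image g, ?_, ?_, ?_⟩
    · exact image_subset_iff.2 hg1
    · refine image_subset_iff.2 fun a ha => ?_
      obtain ⟨v, hv, -, hvd⟩ := hg2 a ha
      exact mem_lowEdges.2 ⟨(mem_crossingEdges.1 (hg1 a ha)).1, v, hv, hvd⟩
    · rw [card_image_of_injOn]
      · exact hcase
      · intro a ha b hb hab
        obtain ⟨v, hv, hva, hvd⟩ := hg2 a ha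
        obtain ⟨x, hx, hxb, hxd⟩ := hg2 b hb
        by_contra hne
        have hvx : v ≠ x := by
          rintro rfl
          exact hne (hva.symm.trans hxb)
        rw [← hab] at hx
        have := (Sym2.mem_and_mem_iff hvx).1 ⟨hv, hx⟩
        exact h.not_adj v x hvx hvd hxd (this ▸ (mem_crossingEdges.1 (hg1 a ha)).1)
  · left
    have h1 : ∀ a ∈ D \ Dl, 16 ≤ #(edgeBoundary E (partitionClass c a)) := by
      intro a ha
      obtain ⟨ha1, ha2⟩ := mem_sdiff.1 ha
      refine h.le_card_edgeBoundary hd (hne a) (mem_filter.1 ha1).2 ?_ ?_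
      · intro h2 v hv
        obtain ⟨x, hx, hxv⟩ := exists_mem_ne (by omega : 1 < #(partitionClass c a)) v
        rw [mem_partitionClass] at hv hx
        obtain ⟨y, hy, hE⟩ := hin v x hxv.symm (hv.trans hx.symm)
        exact ⟨y, mem_partitionClass.2 (hy.trans hv), hE⟩
      · intro v hvd hv
        exact ha2 (mem_filter.2 ⟨ha1, v, hvd, hv⟩)
    have h2 := sum_card_edgeBoundary_le E c (D \ Dl)
    have h3 := card_nsmul_le_sum _ _ _ h1
    have h4 := card_sdiff_add_card_eq_card (s := Dl) (t := D) (filter_subset _ _)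
    rw [smul_eq_mul] at h3
    omega

/-- A partition into many classes has many crossing edges. -/
theorem IsNice.le_card_crossingEdges (h : IsNice E d u l Δ) (hd : 8 ≤ d)
    {C : Type*} [Fintype C] (c : V → C) (hc : Function.Surjective c) {r : ℝ} (hr : 0 < r)
    (hrC : r ≤ Fintype.card C) (hru : Fintype.card V ≤ u * r) (hrl : 6 * l ≤ r) :
    r * d / 12 ≤ #(crossingEdges E c) := by
  classical
  have hne : ∀ a, (partitionClass c a).Nonempty := fun a => by
    obtain ⟨v, hv⟩ := hc a
    exact ⟨v, mem_partitionClass.2 hv⟩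
  set n : ℝ := (Fintype.card V : ℝ) with hn
  -- Discard the classes larger than 2n/r, at most r/2 of them, and those containing a low vertex,
  -- at most r/6. Each of the remaining r/3 is small enough for `inside_le` and has boundary at
  -- least (d - 4) times its size, hence at least d/2. Double counting costs the last factor 2.
  set B : Finset C := univ.filter fun a => 2 * n < #(partitionClass c a) * r with hB
  set A : Finset C := (univ.filter fun v => (#(edgesAt E v) : ℝ) ≤ d).image c with hA
  have htot : ∑ a, (#(partitionClass c a) : ℝ) = n := by
    have := card_eq_sum_card_fiberwise (s := (univ : Finset V)) (t := (univ : Finset C)) (f := c)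
      (fun _ _ => by simp)
    rw [hn, ← card_univ, this, Nat.cast_sum]
    refine sum_congr rfl fun a _ => ?_
    congr 2
  have hn0 : 0 ≤ n := by positivity
  have hBc : (#B : ℝ) ≤ r / 2 := by
    rcases hn0.eq_or_lt with hn0 | hn0
    · have : B = ∅ := by
        refine filter_eq_empty_iff.2 fun a _ => ?_
        have h1 : (#(partitionClass c a) : ℝ) ≤ ∑ a, (#(partitionClass c a) : ℝ) :=
          single_le_sum (f := fun a => (#(partitionClass c a) : ℝ)) (fun _ _ => by positivity)
            (mem_univ a)
        rw [htot, ← hn0] at h1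
        have h2 : (0 : ℝ) ≤ #(partitionClass c a) := by positivity
        have h3 : (#(partitionClass c a) : ℝ) = 0 := le_antisymm h1 h2
        rw [h3, ← hn0]
        simp
      rw [this]
      simp; linarith
    have h1 : (#B : ℝ) * (2 * n) ≤ n * r := by
      rw [← htot, sum_mul]
      calc (#B : ℝ) * (2 * ∑ a, (#(partitionClass c a) : ℝ)) = ∑ a ∈ B, (2 * n) := by
            rw [htot]; simp
        _ ≤ ∑ a ∈ B, #(partitionClass c a) * r := by
            exact sum_le_sum fun a ha => (mem_filter.1 ha).2.le
        _ ≤ ∑ a, #(partitionClass c a) * r :=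
            sum_le_sum_of_subset_of_nonneg (subset_univ _) fun _ _ _ => by positivity
    nlinarith
  have hAc : (#A : ℝ) ≤ r / 6 := by
    have h1 : (#A : ℝ) ≤ l := by
      refine le_trans ?_ h.card_low_le
      rw [Nat.card_eq_fintype_card, Fintype.card_subtype]
      exact_mod_cast card_image_le
    linarith
  set D : Finset C := univ \ (A ∪ B) with hD
  have hDc : r / 3 ≤ #D := by
    have h1 := card_sdiff_add_card_eq_card (subset_univ (A ∪ B))
    rw [card_univ, ← hD] at h1
    have h2 := card_union_le A B
    have h3 : (Fintype.card C : ℝ) ≤ #D + (#A + #B) := by exact_mod_cast (by omega)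
    linarith
  have hbd : ∀ a ∈ D, d / 2 ≤ (#(edgeBoundary E (partitionClass c a)) : ℝ) := by
    intro a ha
    simp only [hD, Finset.mem_sdiff, mem_univ, mem_union, true_and, not_or] at ha
    obtain ⟨haA, haB⟩ := ha
    have h1 : (#(partitionClass c a) : ℝ) * r ≤ 2 * n := by
      by_contra hcon
      exact haB (mem_filter.2 ⟨mem_univ _, not_le.1 hcon⟩)
    have h2 : (#(partitionClass c a) : ℝ) ≤ 2 * u := by
      refine le_of_mul_le_mul_right ?_ hr
      linarith
    have h3 := h.inside_le _ h2
    have h4 := sum_card_edgesAt_le E (partitionClass c a)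
    have h5 : (#(partitionClass c a) : ℝ) * d ≤
        ((∑ v ∈ partitionClass c a, #(edgesAt E v) : ℕ) : ℝ) := by
      rw [Nat.cast_sum, ← nsmul_eq_mul]
      refine card_nsmul_le_sum _ _ _ fun v hv => ?_
      by_contra hcon
      refine haA (mem_image.2 ⟨v, by simpa using (not_le.1 hcon).le, mem_partitionClass.1 hv⟩)
    have h6 : ((∑ v ∈ partitionClass c a, #(edgesAt E v) : ℕ) : ℝ) ≤
        #(edgeBoundary E (partitionClass c a)) + 4 * #(partitionClass c a) := by
      exact_mod_cast (by omega)
    have h7 : (1 : ℝ) ≤ #(partitionClass c a) := by exact_mod_cast (hne a).card_pos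
    nlinarith
  have h1 : (#D : ℝ) * (d / 2) ≤ 2 * #(crossingEdges E c) := by
    calc (#D : ℝ) * (d / 2) = ∑ a ∈ D, d / 2 := by simp
      _ ≤ ∑ a ∈ D, (#(edgeBoundary E (partitionClass c a)) : ℝ) := sum_le_sum hbd
      _ ≤ _ := by exact_mod_cast sum_card_edgeBoundary_le E c D
  nlinarith

end EdgeSets

/-! ### Small violating colour sets -/

section Violation
open Finset

variable {V W : Type*}

open Classical in
/-- The edges of `E` that have the colour `w`. -/
noncomputable def edgesOfColour (E : Finset (Sym2 V)) (χ : Sym2 V → Finset W) (w : W) :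
    Finset (Sym2 V) := E.filter fun e => w ∈ χ e

theorem mem_edgesOfColour {E : Finset (Sym2 V)} {χ : Sym2 V → Finset W} {w : W} {e : Sym2 V} :
    e ∈ edgesOfColour E χ w ↔ e ∈ E ∧ w ∈ χ e := by simp [edgesOfColour]

/-- Two edges touch if they are equal or share an endpoint. -/
def Touch (e f : Sym2 V) : Prop := ∃ v, v ∈ e ∧ v ∈ f

/-- Two different colours that occur at most `t` times have edges touching a common edge. -/
def RareColoursClose (E : Finset (Sym2 V)) (χ : Sym2 V → Finset W) (t : ℕ) : Prop :=
  ∃ w₁ w₂, w₁ ≠ w₂ ∧ #(edgesOfColour E χ w₁) ≤ t ∧ #(edgesOfColour E χ w₂) ≤ t ∧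
    ∃ f ∈ E, ∃ e₁ ∈ E, ∃ e₂ ∈ E, Touch e₁ f ∧ Touch e₂ f ∧ w₁ ∈ χ e₁ ∧ w₂ ∈ χ e₂

/-- Two different colours that occur at most `t` times have edges touching different edges of a
common third colour. -/
def RareColoursLinked (E : Finset (Sym2 V)) (χ : Sym2 V → Finset W) (t : ℕ) : Prop :=
  ∃ w₁ w₂, w₁ ≠ w₂ ∧ #(edgesOfColour E χ w₁) ≤ t ∧ #(edgesOfColour E χ w₂) ≤ t ∧
    ∃ w, w ≠ w₁ ∧ w ≠ w₂ ∧ ∃ f₁ ∈ E, ∃ f₂ ∈ E, f₁ ≠ f₂ ∧ ∃ e₁ ∈ E, ∃ e₂ ∈ E,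
      Touch e₁ f₁ ∧ Touch e₂ f₂ ∧ w ∈ χ f₁ ∧ w ∈ χ f₂ ∧ w₁ ∈ χ e₁ ∧ w₂ ∈ χ e₂

variable [Fintype V]

/-- A set of edges of rank less than `i` spans few edges. -/
theorem card_colourEdges_le {E : Finset (Sym2 V)} {χ : Sym2 V → Finset W} {I : Finset W} {u : ℝ}
    (hin : ∀ U : Finset V, (#U : ℝ) ≤ 2 * u → #(edgesInside E U) ≤ 2 * #U)
    (hu : (edgeRank (colourEdges E χ I) : ℝ) ≤ u) :
    #(colourEdges E χ I) ≤ 4 * edgeRank (colourEdges E χ I) := by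
  classical
  -- A spanning subset of rank-many edges covers at most twice as many vertices, and an edge leaving
  -- this vertex set would raise the rank.
  obtain ⟨S, hS1, hS2, hS3⟩ := exists_edgeSpan_eq (colourEdges E χ I)
  set U : Finset V := S.biUnion fun e => e.toFinset with hU
  have hUc : #U ≤ 2 * #S := by
    rw [mul_comm]
    refine card_biUnion_le_card_mul _ _ _ fun e _ => ?_
    induction e with | _ x y =>
    rw [Sym2.toFinset_mk_eq]
    exact card_le_two
  have hsub : colourEdges E χ I ⊆ edgesInside E U := by
    intro e he
    refine mem_edgesInside.2 ⟨(mem_colourEdges.1 he).1, fun v hv => ?_⟩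
    by_contra hvU
    have h1 := edgeRank_add_one_le hS1 he hv (fun f hf hvf =>
      hvU (mem_biUnion.2 ⟨f, hf, Sym2.mem_toFinset.2 hvf⟩))
    have h2 : edgeRank S = edgeRank (colourEdges E χ I) := by
      rw [edgeRank, hS3, edgeRank]
    omega
  have h1 := hin U (by
    have : (#U : ℝ) ≤ 2 * #S := by exact_mod_cast hUc
    rw [hS2] at this
    linarith)
  have h2 := card_le_card hsub
  omega

/-- A small minimal set of colours violating the rank condition produces rare colours that are
close to each other. -/
theorem rareColours_of_violation {E : Finset (Sym2 V)} {χ : Sym2 V → Finset W} {I : Finset W}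
    {u : ℝ} {k : ℕ} (hk : 0 < k)
    (hin : ∀ U : Finset V, (#U : ℝ) ≤ 2 * u → #(edgesInside E U) ≤ 2 * #U)
    (hχ : ∀ e, #(χ e) = k) (hcol : ∀ w, ∃ e ∈ E, w ∈ χ e)
    (hviol : edgeRank (colourEdges E χ I) < #I)
    (hmin : ∀ I' : Finset W, #I' < #I → #I' ≤ edgeRank (colourEdges E χ I'))
    (hIu : (#I : ℝ) ≤ u) : RareColoursClose E χ (16 * k) ∨ RareColoursLinked E χ (16 * k) := by
  classical
  by_contra hcon
  push Not at hcon
  obtain ⟨hclose, hlink⟩ := hcon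
  have hEI := card_colourEdges_le (χ := χ) (I := I) hin (le_trans (by exact_mod_cast hviol.le) hIu)
  -- Fewer than 4|I| edges have a colour in I, and each has k colours, so with threshold 16k fewer
  -- than a quarter of I is frequent. Without close or linked pairs, sending a rare colour to a
  -- colour it touches injects A into B, which is absurd.
  set A := I.filter fun w => #(edgesOfColour E χ w) ≤ 16 * k with hA
  set B := I.filter fun w => ¬ #(edgesOfColour E χ w) ≤ 16 * k with hB
  have hAB : #A + #B = #I := card_filter_add_card_filter_not _
  -- frequent colours are few
  have hBc : 16 * k * #B ≤ k * #(colourEdges E χ I) := by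
    calc 16 * k * #B = ∑ w ∈ B, 16 * k := by simp [mul_comm]
      _ ≤ ∑ w ∈ B, #(edgesOfColour E χ w) :=
          sum_le_sum fun w hw => (not_le.1 (mem_filter.1 hw).2).le
      _ = ∑ w ∈ B, ∑ e ∈ colourEdges E χ I, if w ∈ χ e then 1 else 0 := by
          refine sum_congr rfl fun w hw => ?_
          rw [← card_filter]
          congr 1
          ext e
          simp only [mem_edgesOfColour, mem_filter, mem_colourEdges]
          constructor
          · rintro ⟨h1, h2⟩
            exact ⟨⟨h1, w, (mem_filter.1 hw).1, h2⟩, h2⟩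
          · rintro ⟨h1, h2⟩
            exact ⟨h1.1, h2⟩
      _ = ∑ e ∈ colourEdges E χ I, #(B.filter fun w => w ∈ χ e) := by
          rw [sum_comm]
          simp_rw [card_filter]
      _ ≤ ∑ e ∈ colourEdges E χ I, k := by
          refine sum_le_sum fun e _ => ?_
          rw [← hχ e]
          exact card_le_card fun w hw => (mem_filter.1 hw).2
      _ = _ := by simp [mul_comm]
  have hBc' : 16 * #B ≤ #(colourEdges E χ I) := by
    refine Nat.le_of_mul_le_mul_left ?_ hk
    linarith [hBc]
  -- every rare colour touches another colour of `I`
  have htouch : ∀ w ∈ A, ∃ w' ∈ I, w' ≠ w ∧ ∃ e ∈ E, ∃ f ∈ E, w ∈ χ e ∧ w' ∈ χ f ∧ Touch e f := by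
    intro w hw
    have hwI := (mem_filter.1 hw).1
    obtain ⟨e, he, hwe⟩ := hcol w
    by_contra hno
    push Not at hno
    have hcard := card_erase_add_one hwI
    -- If w touched no other colour of I, dropping it would lower the rank by at least one, and the
    -- smaller set would still violate the rank condition.
    have h1 := hmin (I.erase w) (by omega)
    have hsub : colourEdges E χ (I.erase w) ⊆ colourEdges E χ I := by
      intro f hf
      obtain ⟨hf1, w', hw', hf2⟩ := mem_colourEdges.1 hf
      exact mem_colourEdges.2 ⟨hf1, w', mem_of_mem_erase hw', hf2⟩
    obtain ⟨v, hv⟩ : ∃ v, v ∈ e := by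
      induction e with | _ x y => exact ⟨x, by simp⟩
    have h2 := edgeRank_add_one_le hsub (mem_colourEdges.2 ⟨he, w, hwI, hwe⟩) hv (by
      intro f hf hvf
      obtain ⟨hf1, w', hw', hf2⟩ := mem_colourEdges.1 hf
      obtain ⟨hne, hw'I⟩ := mem_erase.1 hw'
      exact hno w' hw'I hne e he f hf1 hwe hf2 ⟨v, hv, hvf⟩)
    omega
  rcases I.eq_empty_or_nonempty with hI | ⟨w₀, hw₀⟩
  · simp [hI] at hviol
  have : Nonempty W := ⟨w₀⟩
  have : Nonempty (Sym2 V) := ⟨(hcol w₀).choose⟩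
  choose! g hgI hgne he he1 hf hf1 hwe hwf ht using htouch
  have hself : ∀ f : Sym2 V, Touch f f := by
    intro f
    induction f with | _ x y => exact ⟨x, by simp, by simp⟩
  have hAB' : #A ≤ #B := by
    refine card_le_card_of_injOn g ?_ ?_
    · intro w hw
      have hw := mem_coe.1 hw
      refine mem_coe.2 (mem_filter.2 ⟨hgI w hw, fun hrare => ?_⟩)
      exact hclose ⟨w, g w, (hgne w hw).symm, (mem_filter.1 hw).2, hrare, hf w, hf1 w hw, he w,
        he1 w hw, hf w, hf1 w hw, ht w hw, hself _, hwe w hw, hwf w hw⟩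
    · intro w₁ h₁ w₂ h₂ h12
      have h₁ := mem_coe.1 h₁
      have h₂ := mem_coe.1 h₂
      by_contra hne
      by_cases hff : hf w₁ = hf w₂
      · exact hclose ⟨w₁, w₂, hne, (mem_filter.1 h₁).2, (mem_filter.1 h₂).2, hf w₁, hf1 w₁ h₁,
          he w₁, he1 w₁ h₁, he w₂, he1 w₂ h₂, ht w₁ h₁, hff ▸ ht w₂ h₂, hwe w₁ h₁, hwe w₂ h₂⟩
      · exact hlink ⟨w₁, w₂, hne, (mem_filter.1 h₁).2, (mem_filter.1 h₂).2, g w₁, hgne w₁ h₁,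
          h12 ▸ hgne w₂ h₂, hf w₁, hf1 w₁ h₁, hf w₂, hf1 w₂ h₂, hff, he w₁, he1 w₁ h₁, he w₂,
          he1 w₂ h₂, ht w₁ h₁, ht w₂ h₂, hwf w₁ h₁, h12 ▸ hwf w₂ h₂, hwe w₁ h₁, hwe w₂ h₂⟩
  omega

end Violation

/-! ### Components and the case split for a violating colour set -/

section Dichotomy
open Finset

/-- The map sending a vertex to its component in the graph with edge set `S`. -/
def componentMap {V : Type*} (S : Finset (Sym2 V)) :
    V → (SimpleGraph.fromEdgeSet (S : Set (Sym2 V))).ConnectedComponent :=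
  (SimpleGraph.fromEdgeSet (S : Set (Sym2 V))).connectedComponentMk

variable {V : Type*}

theorem componentMap_surjective (S : Finset (Sym2 V)) : Function.Surjective (componentMap S) :=
  Quot.mk_surjective

theorem componentMap_eq_of_mem {S : Finset (Sym2 V)} {u v : V} (h : s(u, v) ∈ S) :
    componentMap S u = componentMap S v := by
  by_cases huv : u = v
  · rw [huv]
  · refine SimpleGraph.ConnectedComponent.sound (SimpleGraph.Adj.reachable ?_)
    rw [SimpleGraph.fromEdgeSet_adj]
    exact ⟨by exact_mod_cast h, huv⟩

theorem exists_of_componentMap_eq {S : Finset (Sym2 V)} {v x : V} (hvx : v ≠ x)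
    (h : componentMap S v = componentMap S x) :
    ∃ y, componentMap S y = componentMap S v ∧ s(v, y) ∈ S := by
  obtain ⟨p⟩ := SimpleGraph.ConnectedComponent.exact h
  cases p with
  | nil => exact absurd rfl hvx
  | cons hadj _ =>
    rename_i y _
    rw [SimpleGraph.fromEdgeSet_adj] at hadj
    have hmem : s(v, y) ∈ S := by exact_mod_cast hadj.1
    exact ⟨y, (componentMap_eq_of_mem hmem).symm, hmem⟩

variable [Fintype V]

theorem edgeRank_le_card (S : Finset (Sym2 V)) : edgeRank S ≤ #S := by
  classical
  rw [edgeRank, edgeSpan, ← coe_image]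
  exact (finrank_span_finset_le_card _).trans card_image_le

/-- If `I` violates the rank condition and `S` contains a spanning subset of the edges with colours
in `I`, then crossing edges of the components of `S` have no colour in `I`. -/
theorem subset_compl_of_mem_crossingEdges {W : Type*} [Fintype W] [DecidableEq W]
    {E S : Finset (Sym2 V)} {χ : Sym2 V → Finset W} {I : Finset W}
    (hS : ∀ e ∈ S, ¬ e.IsDiag) (hspan : edgeSpan (colourEdges E χ I) ≤ edgeSpan S)
    {e : Sym2 V} (he : e ∈ crossingEdges E (componentMap S)) : χ e ⊆ Iᶜ := by
  intro w hw
  rw [mem_compl]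
  intro hwI
  obtain ⟨heE, u, hu, v, hv, huv⟩ := mem_crossingEdges.1 he
  have hne : u ≠ v := by rintro rfl; exact huv rfl
  have hes := (Sym2.mem_and_mem_iff hne).1 ⟨hu, hv⟩
  subst hes
  exact huv (connectedComponentMk_eq_of_edgeVec_mem_edgeSpan hS hne
    (hspan (edgeVec_mem_edgeSpan (mem_colourEdges.2 ⟨heE, w, hwI, hw⟩))))

/-- In a nice graph, the failure of the rainbow spanning tree property is due to an isolated vertex,
a missing colour, or to one of a list of unlikely configurations. -/
theorem IsNice.cases_of_not_hasRainbowSpanningTree {n k : ℕ} {E : Finset (Sym2 (Fin n))}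
    {d u l Δ b : ℝ} (h : IsNice E d u l Δ) (hd : 40 ≤ d) (hk : 2 ≤ k) (hu0 : 0 < u)
    (hun : (n : ℝ) ≤ u * u) (hul : 6 * l ≤ u) (hn : 0 < n) (hEn : n ≤ #E)
    {χ : Sym2 (Fin n) → Finset (Fin (n - 1))} (hχ : ∀ e, #(χ e) = k)
    (hiso : ∀ v, ∃ e ∈ E, v ∈ e) (hcol : ∀ w, ∃ e ∈ E, w ∈ χ e)
    (hno : ¬ HasRainbowSpanningTree (SimpleGraph.fromEdgeSet (E : Set (Sym2 (Fin n))))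
      (fun e => χ e.1)) :
    RareColoursClose E χ (16 * k) ∨ RareColoursLinked E χ (16 * k) ∨
    (∃ I : Finset (Fin (n - 1)), u < #I ∧ b < #Iᶜ ∧ ∃ S ⊆ E, #S = #I ∧
      ∀ e ∈ crossingEdges E (componentMap S), χ e ⊆ Iᶜ) ∨
    (∃ J : Finset (Fin (n - 1)), u ≤ #J ∧ #J ≤ b ∧ ∃ F ⊆ E, #J * d / 12 ≤ #F ∧
      ∀ e ∈ F, χ e ⊆ J) ∨
    (∃ J : Finset (Fin (n - 1)), 1 ≤ #J ∧ #J < u ∧ ∃ F ⊆ E, 2 * (#J + 1) ≤ #F ∧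
      ∀ e ∈ F, χ e ⊆ J) ∨
    (∃ J : Finset (Fin (n - 1)), 1 ≤ #J ∧ #J < u ∧ ∃ F ⊆ lowEdges E d, 3 * (#J + 1) ≤ 4 * #F ∧
      ∀ e ∈ F, χ e ⊆ J) := by
  classical
  have hex : ∃ I : Finset (Fin (n - 1)), edgeRank (colourEdges E χ I) < #I := by
    by_contra hcon
    push Not at hcon
    exact hno (hasRainbowSpanningTree_of_card_le_edgeRank hn h.not_isDiag χ hcon)
  obtain ⟨I, hI, hmin⟩ : ∃ I : Finset (Fin (n - 1)), edgeRank (colourEdges E χ I) < #I ∧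
      ∀ I' : Finset (Fin (n - 1)), #I' < #I → #I' ≤ edgeRank (colourEdges E χ I') := by
    obtain ⟨I, hI1, hI2⟩ := exists_min_image
      (univ.filter fun I : Finset (Fin (n - 1)) => edgeRank (colourEdges E χ I) < #I) card
      (by obtain ⟨I, hI⟩ := hex; exact ⟨I, by simpa using hI⟩)
    refine ⟨I, (mem_filter.1 hI1).2, fun I' hI' => ?_⟩
    by_contra hcon
    exact absurd (hI2 I' (mem_filter.2 ⟨mem_univ _, not_le.1 hcon⟩)) (not_le.2 hI')
  rcases le_or_gt (#I : ℝ) u with hIu | hIu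
  · rcases rareColours_of_violation (by omega) h.inside_le hχ hcol hI hmin hIu with h1 | h1
    · exact Or.inl h1
    · exact Or.inr (Or.inl h1)
  right; right
  have hIc : #I + #Iᶜ = n - 1 := by rw [card_add_card_compl, Fintype.card_fin]
  rcases lt_or_ge b (#Iᶜ : ℝ) with hb | hb
  · left
    obtain ⟨S₀, hS₀, hS₀c, hS₀s⟩ := exists_edgeSpan_eq (colourEdges E χ I)
    have hCE : colourEdges E χ I ⊆ E := fun e he => (mem_colourEdges.1 he).1
    -- Padding to exactly |I| edges lets S range over a family fixed before the colours are drawn,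
    -- as a union bound requires. The component count stays at least |Iᶜ| + 1.
    obtain ⟨S, hS1, hS2, hS3⟩ := exists_subsuperset_card_eq (hS₀.trans hCE)
      (show #S₀ ≤ #I by omega) (show #I ≤ #E by omega)
    refine ⟨I, hIu, hb, S, hS2, hS3, fun e he => ?_⟩
    refine subset_compl_of_mem_crossingEdges (fun e he => h.not_isDiag e (hS2 he)) ?_ he
    rw [← hS₀s]
    exact Submodule.span_mono (Set.image_mono (by exact_mod_cast hS1))
  right
  have hCd : ∀ e ∈ colourEdges E χ I, ¬ e.IsDiag :=
    fun e he => h.not_isDiag e (mem_colourEdges.1 he).1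
  have hcc := edgeRank_add_card_connectedComponent (colourEdges E χ I) hCd
  rw [Nat.card_eq_fintype_card, Fintype.card_fin] at hcc
  -- The rank is at most |I| - 1, and |I| + |Iᶜ| = n - 1.
  have hcc' : #Iᶜ + 2 ≤ Fintype.card
      (SimpleGraph.fromEdgeSet (colourEdges E χ I : Set (Sym2 (Fin n)))).ConnectedComponent := by
    omega
  have hJ : ∀ e ∈ crossingEdges E (componentMap (colourEdges E χ I)), χ e ⊆ Iᶜ :=
    fun e he => subset_compl_of_mem_crossingEdges hCd le_rfl he
  have hXE : crossingEdges E (componentMap (colourEdges E χ I)) ⊆ E :=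
    fun e he => (mem_crossingEdges.1 he).1
  rcases le_or_gt u (#Iᶜ : ℝ) with hJu | hJu
  · left
    refine ⟨Iᶜ, hJu, hb, _, hXE, ?_, hJ⟩
    refine h.le_card_crossingEdges (by linarith) _ (componentMap_surjective _) (by linarith)
      (by exact_mod_cast (by omega)) ?_ (by linarith)
    rw [Fintype.card_fin]
    nlinarith
  right
  have hcross := h.crossingEdges_of_connected hd hiso (componentMap (colourEdges E χ I))
    (componentMap_surjective _) (by
      intro v x hvx hc
      obtain ⟨y, hy, hyS⟩ := exists_of_componentMap_eq hvx hc
      exact ⟨y, hy, (mem_colourEdges.1 hyS).1⟩) #Iᶜ hcc'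
  -- If Iᶜ were empty, no crossing edge could carry its k ≥ 2 colours, yet a nice graph without
  -- isolated vertices has crossing edges. The connectedness of the graph is hidden here.
  have hJ1 : 1 ≤ #Iᶜ := by
    by_contra hJ0
    have hX : ∀ e, e ∉ crossingEdges E (componentMap (colourEdges E χ I)) := by
      intro e he
      have := card_le_card (hJ e he)
      rw [hχ e] at this
      omega
    rcases hcross with h1 | ⟨F, hF, -, h1⟩
    · rw [eq_empty_of_forall_notMem hX, card_empty] at h1
      omega
    · rw [eq_empty_of_forall_notMem hX, subset_empty] at hF
      rw [hF, card_empty] at h1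
      omega
  rcases hcross with h1 | ⟨F, hF1, hF2, h1⟩
  · left
    exact ⟨Iᶜ, hJ1, hJu, _, hXE, h1, hJ⟩
  · right
    exact ⟨Iᶜ, hJ1, hJu, F, hF2, h1, fun e he => hJ e (hF1 he)⟩

end Dichotomy

/-! ### Counting vertex pairs; elementary estimates -/

section Pairs
open Finset

variable {n : ℕ}

theorem le_card_edgesAt_edgePairs (v : Fin n) : n - 1 ≤ #(edgesAt (edgePairs n) v) := by
  classical
  have h1 : (univ.erase v).image (fun w => s(v, w)) ⊆ edgesAt (edgePairs n) v := by
    intro e he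
    obtain ⟨w, hw, rfl⟩ := mem_image.1 he
    have := ne_of_mem_erase hw
    exact mem_edgesAt.2 ⟨mem_edgePairs.2 (by simpa using this.symm), by simp⟩
  have h2 := card_le_card h1
  rwa [card_image_of_injective _ (fun a b hab => Sym2.congr_right.1 hab),
    card_erase_of_mem (mem_univ _), card_univ, Fintype.card_fin] at h2

open Classical in
theorem card_edgesInside_edgePairs (U : Finset (Fin n)) :
    #(edgesInside (edgePairs n) U) = (#U).choose 2 := by
  rw [← Sym2.card_image_offDiag]
  congr 1
  ext e
  induction e using Sym2.ind with
  | _ x y =>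
    simp only [mem_edgesInside, mem_edgePairs, Sym2.mk_isDiag_iff, Sym2.mem_iff, mem_image,
      mem_offDiag, Prod.exists, Function.uncurry_apply_pair, Sym2.eq_iff]
    constructor
    · rintro ⟨h1, h2⟩
      exact ⟨x, y, ⟨h2 x (Or.inl rfl), h2 y (Or.inr rfl), h1⟩, Or.inl ⟨rfl, rfl⟩⟩
    · rintro ⟨a, b, ⟨ha, hb, hab⟩, ⟨rfl, rfl⟩ | ⟨rfl, rfl⟩⟩
      · refine ⟨hab, ?_⟩
        rintro v (rfl | rfl) <;> assumption
      · refine ⟨Ne.symm hab, ?_⟩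
        rintro v (rfl | rfl) <;> assumption

theorem le_card_edgeBoundary_edgePairs (S : Finset (Fin n)) :
    #S * (n - #S) ≤ #(edgeBoundary (edgePairs n) S) := by
  classical
  have h1 : (S ×ˢ Sᶜ).image (fun p => s(p.1, p.2)) ⊆ edgeBoundary (edgePairs n) S := by
    intro e he
    obtain ⟨⟨x, y⟩, hxy, rfl⟩ := mem_image.1 he
    obtain ⟨hx, hy⟩ := mem_product.1 hxy
    simp only [mem_compl] at hx hy
    refine mem_edgeBoundary.2 ⟨mem_edgePairs.2 ?_, ⟨x, by simp, hx⟩, y, by simp, hy⟩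
    simp only [Sym2.mk_isDiag_iff]
    rintro rfl
    exact hy hx
  have h2 := card_le_card h1
  rw [card_image_of_injOn, card_product, card_compl, Fintype.card_fin] at h2
  · exact h2
  · rintro ⟨x, y⟩ hxy ⟨x', y'⟩ hxy' heq
    simp only [coe_product, Set.mem_prod, mem_coe, mem_compl] at hxy hxy'
    rcases Sym2.eq_iff.1 heq with ⟨h3, h4⟩ | ⟨h3, h4⟩
    · exact Prod.ext h3 h4
    · simp only at h3 h4
      subst h3 h4
      exact absurd hxy.1 hxy'.2

theorem le_card_edgesAt_union_edgePairs {x y : Fin n} (hxy : x ≠ y) :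
    2 * (n - 2) ≤ #((edgePairs n).filter fun e => x ∈ e ∨ y ∈ e) := by
  classical
  set A : Finset (Fin n) := ({x, y} : Finset (Fin n))ᶜ with hA
  have hAc : #A = n - 2 := by rw [hA, card_compl, Fintype.card_fin, card_pair hxy]
  have hmem : ∀ w ∈ A, w ≠ x ∧ w ≠ y := by
    intro w hw
    simpa [hA] using hw
  have h1 : A.image (fun w => s(x, w)) ∪ A.image (fun w => s(y, w)) ⊆
      (edgePairs n).filter fun e => x ∈ e ∨ y ∈ e := by
    intro e he
    rcases mem_union.1 he with he | he <;> obtain ⟨w, hw, rfl⟩ := mem_image.1 he <;>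
      obtain ⟨h2, h3⟩ := hmem w hw
    · exact mem_filter.2 ⟨mem_edgePairs.2 (by simpa using h2.symm), by simp⟩
    · exact mem_filter.2 ⟨mem_edgePairs.2 (by simpa using h3.symm), by simp⟩
  have h2 := card_le_card h1
  rw [card_union_of_disjoint, card_image_of_injective _ (fun a b hab => Sym2.congr_right.1 hab),
    card_image_of_injective _ (fun a b hab => Sym2.congr_right.1 hab), hAc] at h2
  · omega
  · rw [disjoint_left]
    intro e he he'
    obtain ⟨w, hw, rfl⟩ := mem_image.1 he
    obtain ⟨w', hw', heq⟩ := mem_image.1 he'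
    rcases Sym2.eq_iff.1 heq with ⟨h3, -⟩ | ⟨h3, -⟩
    · exact hxy h3.symm
    · exact (hmem w hw).2 h3.symm

theorem choose_le_exp_mul_div_pow (N a : ℕ) :
    (N.choose a : ℝ) ≤ (Real.exp 1 * N / a) ^ a := by
  rcases Nat.eq_zero_or_pos a with rfl | ha
  · simp
  have ha' : (0 : ℝ) < a := by exact_mod_cast ha
  have h1 := Nat.choose_le_pow_div (α := ℝ) a N
  have h2 := Real.pow_div_factorial_le_exp (a : ℝ) ha'.le a
  have hf : (0 : ℝ) < a.factorial := by exact_mod_cast a.factorial_pos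
  refine h1.trans ?_
  rw [div_pow, mul_pow, ← Real.exp_nat_mul, mul_one, div_le_div_iff₀ hf (by positivity)]
  rw [div_le_iff₀ hf] at h2
  calc (N : ℝ) ^ a * (a : ℝ) ^ a ≤ (N : ℝ) ^ a * (Real.exp a * a.factorial) := by gcongr
    _ = _ := by ring

theorem sum_pow_le_two_mul {r : ℝ} (h0 : 0 ≤ r) (h1 : r ≤ 1 / 2) (s : Finset ℕ)
    (hs : ∀ a ∈ s, 1 ≤ a) : ∑ a ∈ s, r ^ a ≤ 2 * r := by
  have hsum : Summable fun a : ℕ => r ^ a := summable_geometric_of_lt_one h0 (by linarith)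
  have h2 : ∑ a ∈ s, r ^ a ≤ ∑ a ∈ s, r * r ^ (a - 1) := by
    refine sum_le_sum fun a ha => ?_
    rw [← pow_succ', Nat.sub_add_cancel (hs a ha)]
  refine h2.trans ?_
  rw [← mul_sum, mul_comm]
  refine mul_le_mul_of_nonneg_right ?_ h0
  have h3 : ∑ a ∈ s, r ^ (a - 1) = ∑ b ∈ s.image (fun a => a - 1), r ^ b := by
    rw [sum_image]
    intro a ha b hb hab
    have := hs a ha
    have := hs b hb
    simp only at hab
    omega
  rw [h3]
  refine (hsum.sum_le_tsum _ fun _ _ => by positivity).trans ?_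
  rw [tsum_geometric_of_lt_one h0 (by linarith), inv_le_comm₀ (by linarith) (by norm_num)]
  linarith

end Pairs

/-! ### A random graph with m edges is nice -/

section NiceProb
open Finset

/-- The number of edges is about `n log n / 2`, and `n` is large. -/
structure IsDense (n m : ℕ) : Prop where
  lower : 49 / 100 * (n * Real.log n) ≤ m
  upper : m ≤ 51 / 100 * (n * Real.log n)
  log_ge : 1000 ≤ Real.log n
  log_pow_le : Real.log n ^ 10 ≤ n

variable {n m : ℕ}

theorem IsDense.log_pos (h : IsDense n m) : 0 < Real.log n := by linarith [h.log_ge]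

theorem IsDense.log_mul_le (h : IsDense n m) : 1000 * Real.log n ≤ n := by
  have h1 := h.log_ge
  have h0 := h.log_pos
  have h2 := h.log_pow_le
  calc 1000 * Real.log n ≤ Real.log n ^ 2 := by nlinarith
    _ ≤ Real.log n ^ 10 := pow_le_pow_right₀ (by linarith) (by norm_num)
    _ ≤ n := h2

theorem IsDense.large (h : IsDense n m) : (1000000 : ℝ) ≤ n := by
  linarith [h.log_mul_le, h.log_ge]

theorem IsDense.pos (h : IsDense n m) : (0 : ℝ) < n := by linarith [h.large]

theorem IsDense.exp_log (h : IsDense n m) : Real.exp (Real.log n) = n := Real.exp_log h.pos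

theorem cast_card_edgePairs (n : ℕ) : (#(edgePairs n) : ℝ) = n * (n - 1) / 2 := by
  rw [card_edgePairs, Nat.cast_choose_two]

theorem IsDense.eight_mul_le (h : IsDense n m) : 8 * m ≤ #(edgePairs n) := by
  have h1 : (8 * m : ℝ) ≤ #(edgePairs n) := by
    rw [cast_card_edgePairs]
    have h2 := h.upper
    have h3 := h.log_mul_le
    have h4 := h.large
    nlinarith
  exact_mod_cast h1

theorem IsDense.card_edgePairs_pos (h : IsDense n m) : 0 < #(edgePairs n) := by
  have h1 : (0 : ℝ) < #(edgePairs n) := by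
    rw [cast_card_edgePairs]
    have := h.large
    have : (0 : ℝ) < n * (n - 1) := by nlinarith
    linarith
  exact_mod_cast h1

theorem IsDense.density_le (h : IsDense n m) :
    (m : ℝ) / #(edgePairs n) ≤ 2 * Real.log n / n := by
  have h2 := h.upper
  have h4 := h.large
  have h5 := h.pos
  have hN : (0 : ℝ) < #(edgePairs n) := by exact_mod_cast h.card_edgePairs_pos
  rw [div_le_div_iff₀ hN h5, cast_card_edgePairs]
  have h6 := h.log_pos
  have h7 : (n : ℝ) * Real.log n * n ≤ n * Real.log n * (n + (n - 1000000)) := by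
    have : 0 ≤ (n : ℝ) * Real.log n := by positivity
    nlinarith
  nlinarith

/-- The density is at least about 0.98 L/n with L = log n, and 0.98 · 4/5 > 3/4. This is the rate of
all lower-tail bounds for edges. -/
theorem IsDense.le_density (h : IsDense n m) {t : ℕ} (ht : t ≤ 2) :
    3 / 4 * (Real.log n / n) ≤ 4 / 5 * (((m : ℝ) - t) / #(edgePairs n)) := by
  have h2 := h.lower
  have h4 := h.large
  have h5 := h.pos
  have h6 := h.log_ge
  have hN : (0 : ℝ) < #(edgePairs n) := by exact_mod_cast h.card_edgePairs_pos
  have ht' : (t : ℝ) ≤ 2 := by exact_mod_cast ht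
  rw [mul_div_assoc', mul_div_assoc', div_le_div_iff₀ h5 hN, cast_card_edgePairs]
  have h7 : 0 ≤ Real.log n * n := by positivity
  have h8 : 3 / 4 * Real.log n * (n * (n - 1) / 2) ≤ 3 / 8 * (Real.log n * n) * n := by
    nlinarith
  have h9 : (1000000000 : ℝ) ≤ Real.log n * n := by nlinarith
  have h10 : 3 / 8 * (Real.log n * n) ≤ 4 / 5 * ((m : ℝ) - t) := by nlinarith
  calc _ ≤ _ := h8
    _ ≤ _ := by gcongr

theorem IsDense.prob_subset_le (h : IsDense n m) {T : Finset (Sym2 (Fin n))}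
    (hT : T ⊆ edgePairs n) :
    prob (powersetCard m (edgePairs n)) (fun E => T ⊆ E) ≤ (2 * Real.log n / n) ^ #T := by
  classical
  have hL := h.log_pos
  have hn := h.pos
  by_cases hTm : #T ≤ m
  · have h1 := prob_subset_disjoint_le (M := ∅) hT (empty_subset _) (disjoint_empty_right _) hTm
      (by have := h.eight_mul_le; omega) h.card_edgePairs_pos
    simp only [disjoint_empty_right, and_true, card_empty, pow_zero, mul_one] at h1
    exact h1.trans (pow_le_pow_left₀ (by positivity) h.density_le _)
  · rw [prob_eq_zero]
    · positivity
    · intro E hE hTE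
      exact hTm ((card_le_card hTE).trans_eq (mem_powersetCard.1 hE).2)

theorem IsDense.prob_subset_card_inter_le (h : IsDense n m) {T R : Finset (Sym2 (Fin n))}
    (hT : T ⊆ edgePairs n) (hR : R ⊆ edgePairs n) (hTR : Disjoint T R) (hT2 : #T ≤ 2) (b : ℝ) :
    prob (powersetCard m (edgePairs n)) (fun E => T ⊆ E ∧ (#(E ∩ R) : ℝ) ≤ b) ≤
      (2 * Real.log n / n) ^ #T * Real.exp (2 * b - 3 / 4 * (Real.log n / n) * #R) := by
  have hm2 : 2 ≤ m := by
    have h1 := h.lower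
    have h2 := h.large
    have h3 := h.log_ge
    have : (2 : ℝ) ≤ m := by nlinarith
    exact_mod_cast this
  refine (_root_.prob_subset_card_inter_le hT hR hTR (by omega) h.eight_mul_le
    h.card_edgePairs_pos b).trans ?_
  have h1 := h.density_le
  have h2 := h.le_density hT2
  gcongr

theorem edgesAt_eq_inter {E : Finset (Sym2 (Fin n))} (hE : E ⊆ edgePairs n) (v : Fin n) :
    E ∩ edgesAt (edgePairs n) v = edgesAt E v := by
  ext e
  simp only [mem_inter, mem_edgesAt]
  exact ⟨fun h => ⟨h.1, h.2.2⟩, fun h => ⟨h.1, hE h.1, h.2⟩⟩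

/-- The tail bound gives exponent -(3/4)L, of which the threshold L/20 gives back L/10. The spare 1
pays for degree n - 1 instead of n. -/
theorem IsDense.prob_low_le (h : IsDense n m) (v : Fin n) :
    prob (powersetCard m (edgePairs n)) (fun E => (#(edgesAt E v) : ℝ) ≤ Real.log n / 20) ≤
      Real.exp (1 - 13 / 20 * Real.log n) := by
  classical
  have h1 := h.prob_subset_card_inter_le (T := ∅) (R := edgesAt (edgePairs n) v) (empty_subset _)
    (fun e he => (mem_edgesAt.1 he).1) (disjoint_empty_left _) (by simp) (Real.log n / 20)
  refine (prob_mono fun E hE hlow => ?_).trans (h1.trans ?_)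
  · refine ⟨empty_subset _, ?_⟩
    rwa [edgesAt_eq_inter (mem_powersetCard.1 hE).1]
  · rw [card_empty, pow_zero, one_mul]
    apply Real.exp_le_exp.2
    have h2 : ((n : ℝ) - 1) ≤ #(edgesAt (edgePairs n) v) := by
      have := le_card_edgesAt_edgePairs v
      have : (n : ℝ) ≤ #(edgesAt (edgePairs n) v) + 1 := by exact_mod_cast (by omega)
      linarith
    have hn := h.pos
    have hL := h.log_pos
    have h3 : Real.log n / n ≤ 1 := by
      rw [div_le_one hn]
      linarith [h.log_mul_le]
    have h4 : Real.log n / n * n = Real.log n := by field_simp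
    have h5 : 0 ≤ Real.log n / n := by positivity
    nlinarith

/-- Two vertices meet about 2n pairs, so the exponent doubles. The edges of T are removed from the
tail event to keep it disjoint from T; the spare 5 pays for the at most six pairs missing from 2n.
-/
theorem IsDense.prob_low_low_le (h : IsDense n m) {x y : Fin n} (hxy : x ≠ y)
    {T : Finset (Sym2 (Fin n))} (hT : T ⊆ edgePairs n) (hT2 : #T ≤ 2) :
    prob (powersetCard m (edgePairs n)) (fun E => T ⊆ E ∧
      (#(edgesAt E x) : ℝ) ≤ Real.log n / 20 ∧ (#(edgesAt E y) : ℝ) ≤ Real.log n / 20) ≤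
      (2 * Real.log n / n) ^ #T * Real.exp (5 - 13 / 10 * Real.log n) := by
  classical
  set A := (edgePairs n).filter fun e => x ∈ e ∨ y ∈ e with hA
  have h1 := h.prob_subset_card_inter_le (T := T) (R := A \ T) hT
    (sdiff_subset.trans (filter_subset _ _)) disjoint_sdiff hT2 (Real.log n / 10)
  have hn := h.pos
  have hL := h.log_pos
  refine (prob_mono fun E hE hlow => ?_).trans (h1.trans ?_)
  · refine ⟨hlow.1, ?_⟩
    have h2 : E ∩ (A \ T) ⊆ edgesAt E x ∪ edgesAt E y := by
      intro e he
      obtain ⟨he1, he2⟩ := mem_inter.1 he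
      obtain ⟨-, he3⟩ := mem_filter.1 (mem_sdiff.1 he2).1
      rcases he3 with he3 | he3
      · exact mem_union_left _ (mem_edgesAt.2 ⟨he1, he3⟩)
      · exact mem_union_right _ (mem_edgesAt.2 ⟨he1, he3⟩)
    have h3 : (#(E ∩ (A \ T)) : ℝ) ≤ #(edgesAt E x) + #(edgesAt E y) := by
      exact_mod_cast (card_le_card h2).trans (card_union_le _ _)
    linarith [hlow.2.1, hlow.2.2]
  · refine mul_le_mul_of_nonneg_left (Real.exp_le_exp.2 ?_) (by positivity)
    have h2 : (2 * (n : ℝ) - 6) ≤ #(A \ T) := by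
      have h3 := le_card_edgesAt_union_edgePairs hxy
      rw [← hA] at h3
      have h4 := card_le_card_sdiff_add_card (s := A) (t := T)
      have : (2 * n : ℝ) ≤ #(A \ T) + 6 := by exact_mod_cast (by omega)
      linarith
    have h3 : Real.log n / n ≤ 1 := by
      rw [div_le_one hn]
      linarith [h.log_mul_le]
    have h4 : Real.log n / n * n = Real.log n := by field_simp
    have h5 : 0 ≤ Real.log n / n := by positivity
    nlinarith

/-- Markov's inequality: the expected number of low vertices is at most e n^{7/20}, well below √n.
-/
theorem IsDense.prob_card_low_le (h : IsDense n m) :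
    prob (powersetCard m (edgePairs n)) (fun E => ¬
      (Nat.card {v // (#(edgesAt E v) : ℝ) ≤ Real.log n / 20} : ℝ) ≤ √n) ≤
      Real.exp (1 - 3 / 20 * Real.log n) := by
  classical
  have hn := h.pos
  have hs : (0 : ℝ) < √n := Real.sqrt_pos.2 hn
  refine (prob_le_sum_div (f := fun E => ∑ v : Fin n,
    (if (#(edgesAt E v) : ℝ) ≤ Real.log n / 20 then (1 : ℝ) else 0) / √n)
    (fun E _ => by positivity) ?_).trans ?_
  · intro E _ hE
    rw [← sum_div, one_le_div hs]
    rw [not_le, Nat.card_eq_fintype_card, Fintype.card_subtype] at hE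
    rw [sum_boole]
    exact hE.le
  · rw [sum_comm, sum_div]
    calc _ = ∑ v : Fin n, prob (powersetCard m (edgePairs n))
            (fun E => (#(edgesAt E v) : ℝ) ≤ Real.log n / 20) / √n := by
          refine sum_congr rfl fun v _ => ?_
          rw [prob_eq_sum, ← sum_div, div_right_comm]
      _ ≤ ∑ v : Fin n, Real.exp (1 - 13 / 20 * Real.log n) / √n := by
          gcongr with v
          exact h.prob_low_le v
      _ = n / √n * Real.exp (1 - 13 / 20 * Real.log n) := by
          rw [sum_const, card_univ, Fintype.card_fin, nsmul_eq_mul]; ring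
      _ = _ := by
          rw [Real.div_sqrt, Real.sqrt_eq_rpow, Real.rpow_def_of_pos hn, ← Real.exp_add]
          congr 1
          ring

/-- There are at most n² ordered pairs; an edge costs 2L/n and two low degrees cost n^{-13/10}, up
to constants. -/
theorem IsDense.prob_adj_low_le (h : IsDense n m) :
    prob (powersetCard m (edgePairs n)) (fun E => ¬ ∀ x y, x ≠ y →
      (#(edgesAt E x) : ℝ) ≤ Real.log n / 20 → (#(edgesAt E y) : ℝ) ≤ Real.log n / 20 →
        s(x, y) ∉ E) ≤ 2 * Real.log n * Real.exp (5 - 3 / 10 * Real.log n) := by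
  classical
  have hn := h.pos
  have hL := h.log_pos
  set I := (univ : Finset (Fin n × Fin n)).filter (fun p => p.1 ≠ p.2) with hI
  refine (prob_mono (Q := fun E => ∃ p ∈ I, (({s(p.1, p.2)} : Finset (Sym2 (Fin n))) ⊆ E ∧ (#(edgesAt E p.1) : ℝ) ≤ Real.log n / 20 ∧
      (#(edgesAt E p.2) : ℝ) ≤ Real.log n / 20)) ?_).trans ((prob_exists_le _ _).trans ?_)
  · intro E _ hE
    push Not at hE
    obtain ⟨x, y, hxy, hx, hy, hE⟩ := hE
    exact ⟨(x, y), mem_filter.2 ⟨mem_univ _, hxy⟩, singleton_subset_iff.2 hE, hx, hy⟩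
  · calc _ ≤ ∑ p ∈ I, (2 * Real.log n / n) ^ 1 * Real.exp (5 - 13 / 10 * Real.log n) := by
          refine sum_le_sum fun p hp => ?_
          have hp := (mem_filter.1 hp).2
          have hc : #({s(p.1, p.2)} : Finset (Sym2 (Fin n))) = 1 := card_singleton _
          refine (h.prob_low_low_le hp (T := {s(p.1, p.2)}) ?_ (by omega)).trans (by rw [hc])
          exact singleton_subset_iff.2 (mem_edgePairs.2 hp)
      _ ≤ n ^ 2 * ((2 * Real.log n / n) ^ 1 * Real.exp (5 - 13 / 10 * Real.log n)) := by
          rw [sum_const, nsmul_eq_mul]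
          gcongr
          have : #I ≤ n ^ 2 := (card_le_univ _).trans (by simp [sq])
          exact_mod_cast this
      _ = 2 * Real.log n * (Real.exp (Real.log n) * Real.exp (5 - 13 / 10 * Real.log n)) := by
          rw [h.exp_log]; field_simp
      _ = _ := by rw [← Real.exp_add]; congr 2; ring

/-- Compared with adjacent low vertices, the third vertex gains n and the second edge costs 2L/n, so
only a logarithm is lost. -/
theorem IsDense.prob_common_low_le (h : IsDense n m) :
    prob (powersetCard m (edgePairs n)) (fun E => ¬ ∀ x y z, x ≠ y →
      (#(edgesAt E x) : ℝ) ≤ Real.log n / 20 → (#(edgesAt E y) : ℝ) ≤ Real.log n / 20 →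
        s(x, z) ∈ E → s(y, z) ∉ E) ≤ 4 * Real.log n ^ 2 * Real.exp (5 - 3 / 10 * Real.log n) := by
  classical
  have hn := h.pos
  have hL := h.log_pos
  set I := (univ : Finset (Fin n × Fin n × Fin n)).filter
    (fun p => p.1 ≠ p.2.1 ∧ p.1 ≠ p.2.2 ∧ p.2.1 ≠ p.2.2) with hI
  refine (prob_mono (Q := fun E => ∃ p ∈ I,
    (({s(p.1, p.2.2), s(p.2.1, p.2.2)} : Finset (Sym2 (Fin n))) ⊆ E ∧ (#(edgesAt E p.1) : ℝ) ≤ Real.log n / 20 ∧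
      (#(edgesAt E p.2.1) : ℝ) ≤ Real.log n / 20)) ?_).trans ((prob_exists_le _ _).trans ?_)
  · intro E hE0 hE
    push Not at hE
    obtain ⟨x, y, z, hxy, hx, hy, h1, h2⟩ := hE
    have hsub := (mem_powersetCard.1 hE0).1
    have h3 : x ≠ z := by simpa using mem_edgePairs.1 (hsub h1)
    have h4 : y ≠ z := by simpa using mem_edgePairs.1 (hsub h2)
    exact ⟨(x, y, z), by simp [hI, hxy, h3, h4], by
      intro e he
      rcases mem_insert.1 he with rfl | he
      · exact h1
      · rw [mem_singleton.1 he]; exact h2, hx, hy⟩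
  · calc _ ≤ ∑ p ∈ I, (2 * Real.log n / n) ^ 2 * Real.exp (5 - 13 / 10 * Real.log n) := by
          refine sum_le_sum fun p hp => ?_
          obtain ⟨hp1, hp2, hp3⟩ := (mem_filter.1 hp).2
          have hc : #({s(p.1, p.2.2), s(p.2.1, p.2.2)} : Finset (Sym2 (Fin n))) = 2 := by
            refine card_pair fun heq => hp1 ?_
            rw [Sym2.congr_left] at heq
            exact heq
          refine (h.prob_low_low_le hp1 (T := {s(p.1, p.2.2), s(p.2.1, p.2.2)}) ?_
            hc.le).trans (by rw [hc])
          intro e he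
          rcases mem_insert.1 he with rfl | he
          · exact mem_edgePairs.2 (by simpa using hp2)
          · rw [mem_singleton.1 he]; exact mem_edgePairs.2 (by simpa using hp3)
      _ ≤ n ^ 3 * ((2 * Real.log n / n) ^ 2 * Real.exp (5 - 13 / 10 * Real.log n)) := by
          rw [sum_const, nsmul_eq_mul]
          gcongr
          have : #I ≤ n ^ 3 := (card_le_univ _).trans (by simp [pow_succ, mul_assoc])
          exact_mod_cast this
      _ = 4 * Real.log n ^ 2 * (Real.exp (Real.log n) * Real.exp (5 - 13 / 10 * Real.log n)) := by
          rw [h.exp_log]; field_simp; ring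
      _ = _ := by rw [← Real.exp_add]; congr 2; ring

/-- Summing over subsets by their size. -/
theorem sum_subsets_le {α : Type*} [Fintype α] (s : Finset (Finset α)) (f : ℕ → ℝ) {K r : ℝ}
    (hK : 0 ≤ K) (hr0 : 0 ≤ r) (hr : r ≤ 1 / 2) (hs : ∀ U ∈ s, 1 ≤ #U)
    (hf : ∀ U ∈ s, ((Fintype.card α).choose #U : ℝ) * f #U ≤ K * r ^ #U) :
    ∑ U ∈ s, f #U ≤ K * (2 * r) := by
  classical
  have hpos : ∀ U ∈ s, (0 : ℝ) < (Fintype.card α).choose #U := fun U _ => by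
    exact_mod_cast Nat.choose_pos (card_le_univ U)
  calc ∑ U ∈ s, f #U = ∑ a ∈ s.image card, ∑ U ∈ s.filter (fun U => #U = a), f #U :=
        (sum_fiberwise_of_maps_to (fun U hU => mem_image_of_mem _ hU) _).symm
    _ ≤ ∑ a ∈ s.image card, K * r ^ a := by
        refine sum_le_sum fun a ha => ?_
        obtain ⟨U₀, hU₀, rfl⟩ := mem_image.1 ha
        have h1 : ∑ U ∈ s.filter (fun U => #U = #U₀), f #U =
            #(s.filter (fun U => #U = #U₀)) * f #U₀ := by
          rw [← nsmul_eq_mul, ← sum_const]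
          exact sum_congr rfl fun U hU => by rw [(mem_filter.1 hU).2]
        have h2 : #(s.filter (fun U => #U = #U₀)) ≤ (Fintype.card α).choose #U₀ := by
          rw [← card_univ, ← card_powersetCard]
          refine card_le_card fun U hU => mem_powersetCard.2 ⟨subset_univ _, (mem_filter.1 hU).2⟩
        rw [h1]
        rcases le_or_gt 0 (f #U₀) with hf0 | hf0
        · refine le_trans ?_ (hf U₀ hU₀)
          gcongr
        · have h3 : (#(s.filter (fun U => #U = #U₀)) : ℝ) * f #U₀ ≤ 0 :=
            mul_nonpos_of_nonneg_of_nonpos (by positivity) hf0.le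
          exact h3.trans (by positivity)
    _ = K * ∑ a ∈ s.image card, r ^ a := by rw [mul_sum]
    _ ≤ K * (2 * r) := by
        gcongr
        refine sum_pow_le_two_mul hr0 hr _ fun a ha => ?_
        obtain ⟨U, hU, rfl⟩ := mem_image.1 ha
        exact hs U hU

theorem exp_one_pow_three_le : Real.exp 1 ^ 3 ≤ 21 := by
  have h1 := Real.exp_one_lt_d9
  have h2 : Real.exp 1 ^ 3 ≤ 2.7182818286 ^ 3 :=
    pow_le_pow_left₀ (Real.exp_pos 1).le h1.le 3
  exact h2.trans (by norm_num)

/-- The union bound over sets U of size a and their 2a-sets of pairs is (e³aL²/(4n))^a with L = log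
n; for a ≤ 2n/L⁴ the ratio is O(L⁻²). -/
theorem IsDense.prob_inside_le (h : IsDense n m) :
    prob (powersetCard m (edgePairs n)) (fun E => ¬ ∀ U : Finset (Fin n),
      (#U : ℝ) ≤ 2 * (n / Real.log n ^ 4) → #(edgesInside E U) ≤ 2 * #U) ≤
      24 / Real.log n ^ 2 := by
  classical
  have hn := h.pos
  have hL := h.log_pos
  set L := Real.log n with hLdef
  set s := (univ : Finset (Finset (Fin n))).filter
    (fun U => 1 ≤ #U ∧ (#U : ℝ) ≤ 2 * (n / L ^ 4)) with hs
  refine (prob_mono (Q := fun E => ∃ U ∈ s, ∃ T ∈ powersetCard (2 * #U)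
    (edgesInside (edgePairs n) U), T ⊆ E) ?_).trans ((prob_exists_le _ _).trans ?_)
  · intro E hE0 hE
    push Not at hE
    obtain ⟨U, hU1, hU2⟩ := hE
    have hsub := (mem_powersetCard.1 hE0).1
    refine ⟨U, mem_filter.2 ⟨mem_univ _, ?_, hU1⟩, ?_⟩
    · by_contra hU0
      have hU0 : U = ∅ := card_eq_zero.1 (by omega)
      have : edgesInside E U = ∅ := by
        refine eq_empty_of_forall_notMem fun e he => ?_
        obtain ⟨-, he2⟩ := mem_edgesInside.1 he
        induction e with | _ x y =>
        have := he2 x (by simp)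
        simp [hU0] at this
      rw [this] at hU2
      simp at hU2
    · obtain ⟨T, hT1, hT2⟩ := exists_subset_card_eq hU2.le
      refine ⟨T, mem_powersetCard.2 ⟨fun e he => ?_, hT2⟩, fun e he => ?_⟩
      · obtain ⟨h1, h2⟩ := mem_edgesInside.1 (hT1 he)
        exact mem_edgesInside.2 ⟨hsub h1, h2⟩
      · exact (mem_edgesInside.1 (hT1 he)).1
  · have h1 : ∀ U ∈ s, prob (powersetCard m (edgePairs n)) (fun E => ∃ T ∈ powersetCard (2 * #U)
        (edgesInside (edgePairs n) U), T ⊆ E) ≤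
        (((#U).choose 2).choose (2 * #U) : ℝ) * (2 * L / n) ^ (2 * #U) := by
      intro U _
      refine (prob_exists_le _ _).trans ?_
      calc _ ≤ ∑ T ∈ powersetCard (2 * #U) (edgesInside (edgePairs n) U),
            (2 * L / n) ^ (2 * #U) := by
            refine sum_le_sum fun T hT => ?_
            obtain ⟨hT1, hT2⟩ := mem_powersetCard.1 hT
            rw [← hT2]
            exact h.prob_subset_le fun e he => (mem_edgesInside.1 (hT1 he)).1
        _ ≤ _ := by
            rw [sum_const, nsmul_eq_mul, card_powersetCard]
            gcongr
            exact (card_edgesInside_edgePairs U).le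
    refine (sum_le_sum h1).trans ?_
    have hL2 : (1000 : ℝ) ≤ L := h.log_ge
    have h24 : 1 * (2 * (12 / L ^ 2)) = 24 / L ^ 2 := by ring
    rw [← h24]
    refine sum_subsets_le s
      (fun a : ℕ => ((a.choose 2).choose (2 * a) : ℝ) * (2 * L / n) ^ (2 * a))
      zero_le_one (by positivity) ?_ (fun U hU => (mem_filter.1 hU).2.1) ?_
    · rw [div_le_iff₀ (by positivity)]
      nlinarith
    · intro U hU
      obtain ⟨-, hU1, hU2⟩ := mem_filter.1 hU
      set a := #U with ha
      have ha0 : (0 : ℝ) < a := by exact_mod_cast hU1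
      have h2 := choose_le_exp_mul_div_pow n a
      have h3 := choose_le_exp_mul_div_pow (a.choose 2) (2 * a)
      have h4 : Real.exp 1 * (a.choose 2 : ℝ) / ((2 * a : ℕ) : ℝ) ≤ Real.exp 1 * a / 4 := by
        rw [Nat.cast_choose_two]
        push_cast
        rw [div_le_div_iff₀ (by positivity) (by norm_num)]
        have := Real.exp_pos 1
        nlinarith [mul_pos this ha0]
      have h5 : ((a.choose 2).choose (2 * a) : ℝ) ≤ (Real.exp 1 * a / 4) ^ (2 * a) := by
        refine h3.trans (pow_le_pow_left₀ (by positivity) h4 _)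
      rw [Fintype.card_fin, one_mul]
      calc (n.choose a : ℝ) * (((a.choose 2).choose (2 * a) : ℝ) * (2 * L / n) ^ (2 * a))
          ≤ (Real.exp 1 * n / a) ^ a * ((Real.exp 1 * a / 4) ^ (2 * a) * (2 * L / n) ^ (2 * a)) := by
            gcongr
        _ = (Real.exp 1 ^ 3 * a * L ^ 2 / (4 * n)) ^ a := by
            rw [pow_mul, pow_mul, ← mul_pow, ← mul_pow]
            congr 1
            field_simp
            norm_num
        _ ≤ (12 / L ^ 2) ^ a := by
            refine pow_le_pow_left₀ (by positivity) ?_ _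
            rw [div_le_div_iff₀ (by positivity) (by positivity)]
            have h6 : (a : ℝ) * L ^ 4 ≤ 2 * n := by
              have := mul_le_mul_of_nonneg_right hU2 (by positivity : 0 ≤ L ^ 4)
              rwa [show 2 * (n / L ^ 4) * L ^ 4 = 2 * (n : ℝ) by field_simp] at this
            have h7 := exp_one_pow_three_le
            calc Real.exp 1 ^ 3 * a * L ^ 2 * L ^ 2 = Real.exp 1 ^ 3 * (a * L ^ 4) := by ring
              _ ≤ 21 * (2 * (n : ℝ)) := by gcongr
              _ ≤ 12 * (4 * (n : ℝ)) := by linarith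

/-- A set of size s ≤ n/2 has at least sn/2 boundary pairs, so its boundary is small with
probability at most e^{32 - 3Ls/8}. This beats the number of sets, C(n, s) ≤ (eL⁴)^s, because s ≥
n/L⁴. -/
theorem IsDense.prob_boundary_le (h : IsDense n m)
    (hr : Real.exp 1 * Real.log n ^ 4 * Real.exp (-(3 / 8 * Real.log n)) ≤ 1 / 2) :
    prob (powersetCard m (edgePairs n)) (fun E => ¬ ∀ S : Finset (Fin n),
      n / Real.log n ^ 4 ≤ #S → 2 * #S ≤ Fintype.card (Fin n) → 16 ≤ #(edgeBoundary E S)) ≤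
      Real.exp 32 * (2 * (Real.exp 1 * Real.log n ^ 4 * Real.exp (-(3 / 8 * Real.log n)))) := by
  classical
  have hn := h.pos
  have hL := h.log_pos
  set L := Real.log n with hLdef
  set s := (univ : Finset (Finset (Fin n))).filter
    (fun S => n / L ^ 4 ≤ #S ∧ 2 * #S ≤ n) with hs
  have hs0 : ∀ S ∈ s, (0 : ℝ) < #S := by
    intro S hS
    have := (mem_filter.1 hS).2.1
    have h2 : 0 < n / L ^ 4 := by positivity
    linarith
  refine (prob_mono (Q := fun E => ∃ S ∈ s, (∅ : Finset (Sym2 (Fin n))) ⊆ E ∧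
    (#(E ∩ edgeBoundary (edgePairs n) S) : ℝ) ≤ 16) ?_).trans ((prob_exists_le _ _).trans ?_)
  · intro E hE0 hE
    push Not at hE
    obtain ⟨S, hS1, hS2, hS3⟩ := hE
    rw [Fintype.card_fin] at hS2
    refine ⟨S, mem_filter.2 ⟨mem_univ _, hS1, hS2⟩, empty_subset _, ?_⟩
    have h1 : E ∩ edgeBoundary (edgePairs n) S ⊆ edgeBoundary E S := by
      intro e he
      obtain ⟨h1, h2⟩ := mem_inter.1 he
      exact mem_edgeBoundary.2 ⟨h1, (mem_edgeBoundary.1 h2).2⟩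
    exact_mod_cast (card_le_card h1).trans hS3.le
  · have h1 : ∀ S ∈ s, prob (powersetCard m (edgePairs n)) (fun E =>
        (∅ : Finset (Sym2 (Fin n))) ⊆ E ∧ (#(E ∩ edgeBoundary (edgePairs n) S) : ℝ) ≤ 16) ≤
        Real.exp 32 * Real.exp (-(3 / 8 * L)) ^ #S := by
      intro S hS
      refine (h.prob_subset_card_inter_le (empty_subset _)
        (fun e he => (mem_edgeBoundary.1 he).1) (disjoint_empty_left _) (by simp) 16).trans ?_
      rw [card_empty, pow_zero, one_mul, ← Real.exp_nat_mul, ← Real.exp_add]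
      refine Real.exp_le_exp.2 ?_
      have h2 := le_card_edgeBoundary_edgePairs S
      have h3 := (mem_filter.1 hS).2.2
      have h4 : ((#S : ℝ) * (n - #S)) ≤ #(edgeBoundary (edgePairs n) S) := by
        have : ((#S * (n - #S) : ℕ) : ℝ) ≤ #(edgeBoundary (edgePairs n) S) := by exact_mod_cast h2
        rwa [Nat.cast_mul, Nat.cast_sub (by omega)] at this
      have h5 : (2 * #S : ℝ) ≤ n := by exact_mod_cast h3
      have h6 : (#S : ℝ) * (n / 2) ≤ #(edgeBoundary (edgePairs n) S) := by
        have := hs0 S hS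
        nlinarith
      have h7 : 3 / 4 * (L / n) * ((#S : ℝ) * (n / 2)) ≤
          3 / 4 * (L / n) * #(edgeBoundary (edgePairs n) S) := by gcongr
      have h8 : 3 / 4 * (L / n) * ((#S : ℝ) * (n / 2)) = #S * (3 / 8 * L) := by field_simp; ring
      linarith
    refine (sum_le_sum h1).trans ?_
    refine sum_subsets_le s (fun a : ℕ => Real.exp 32 * Real.exp (-(3 / 8 * L)) ^ a)
      (Real.exp_pos _).le (by positivity) hr
      (fun S hS => by exact_mod_cast hs0 S hS) ?_
    intro S hS
    obtain ⟨-, hS1, hS2⟩ := mem_filter.1 hS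
    have hS0 := hs0 S hS
    rw [Fintype.card_fin, mul_left_comm, mul_pow]
    gcongr
    refine (choose_le_exp_mul_div_pow n #S).trans (pow_le_pow_left₀ (by positivity) ?_ _)
    rw [mul_div_assoc]
    gcongr
    rw [div_le_iff₀ hS0]
    rw [div_le_iff₀ (by positivity)] at hS1
    linarith

/-- For b = ⌈L²⌉ edges at one vertex the union bound is (2eL/b)^b ≤ e^{-2b}, small enough to sum
over n vertices. -/
theorem IsDense.prob_degree_le (h : IsDense n m) :
    prob (powersetCard m (edgePairs n)) (fun E => ¬ ∀ v,
      (#(edgesAt E v) : ℝ) ≤ Real.log n ^ 2) ≤ Real.exp (-Real.log n) := by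
  classical
  have hn := h.pos
  have hL := h.log_ge
  have hL0 := h.log_pos
  have hexp := h.exp_log
  set L := Real.log n with hLdef
  set b := ⌈L ^ 2⌉₊ with hb
  have hb1 : L ^ 2 ≤ b := Nat.le_ceil _
  have hb0 : (0 : ℝ) < b := lt_of_lt_of_le (by positivity) hb1
  have hRv : ∀ v : Fin n, #(edgesAt (edgePairs n) v) ≤ n := by
    intro v
    have h1 : edgesAt (edgePairs n) v ⊆ univ.image fun w => s(v, w) := by
      intro e he
      obtain ⟨w, rfl⟩ := Sym2.mem_iff_exists.1 (mem_edgesAt.1 he).2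
      exact mem_image_of_mem _ (mem_univ _)
    exact (card_le_card h1).trans (card_image_le.trans (by simp))
  refine (prob_mono (Q := fun E => ∃ v ∈ (univ : Finset (Fin n)),
    ∃ T ∈ powersetCard b (edgesAt (edgePairs n) v), T ⊆ E) ?_).trans
      ((prob_exists_le _ _).trans ?_)
  · intro E hE0 hE
    push Not at hE
    obtain ⟨v, hv⟩ := hE
    have hv' : b ≤ #(edgesAt E v) := Nat.ceil_le.2 hv.le
    obtain ⟨T, hT1, hT2⟩ := exists_subset_card_eq hv'
    have hsub := (mem_powersetCard.1 hE0).1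
    refine ⟨v, mem_univ _, T, mem_powersetCard.2 ⟨fun e he => ?_, hT2⟩,
      fun e he => (mem_edgesAt.1 (hT1 he)).1⟩
    obtain ⟨h1, h2⟩ := mem_edgesAt.1 (hT1 he)
    exact mem_edgesAt.2 ⟨hsub h1, h2⟩
  · have h1 : ∀ v ∈ (univ : Finset (Fin n)), prob (powersetCard m (edgePairs n)) (fun E =>
        ∃ T ∈ powersetCard b (edgesAt (edgePairs n) v), T ⊆ E) ≤ Real.exp (-2) ^ b := by
      intro v _
      refine (prob_exists_le _ _).trans ?_
      calc _ ≤ ∑ T ∈ powersetCard b (edgesAt (edgePairs n) v), (2 * L / n) ^ b := by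
            refine sum_le_sum fun T hT => ?_
            obtain ⟨hT1, hT2⟩ := mem_powersetCard.1 hT
            rw [← hT2]
            exact h.prob_subset_le fun e he => (mem_edgesAt.1 (hT1 he)).1
        _ ≤ (n.choose b : ℝ) * (2 * L / n) ^ b := by
            rw [sum_const, nsmul_eq_mul, card_powersetCard]
            gcongr
            exact hRv v
        _ ≤ (Real.exp 1 * n / b) ^ b * (2 * L / n) ^ b := by
            gcongr
            exact choose_le_exp_mul_div_pow n b
        _ = (2 * Real.exp 1 * L / b) ^ b := by
            rw [← mul_pow]
            congr 1
            field_simp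
        _ ≤ Real.exp (-2) ^ b := by
            refine pow_le_pow_left₀ (by positivity) ?_ _
            rw [div_le_iff₀ hb0, Real.exp_neg, inv_mul_eq_div, le_div_iff₀ (Real.exp_pos _)]
            have h3 := exp_one_pow_three_le
            have h4 : Real.exp 2 = Real.exp 1 ^ 2 := by rw [← Real.exp_nat_mul]; norm_num
            calc 2 * Real.exp 1 * L * Real.exp 2 = 2 * Real.exp 1 ^ 3 * L := by rw [h4]; ring
              _ ≤ 2 * 21 * L := by gcongr
              _ ≤ L ^ 2 := by nlinarith
              _ ≤ b := hb1
    refine (sum_le_sum h1).trans ?_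
    rw [sum_const, card_univ, Fintype.card_fin, nsmul_eq_mul, ← Real.exp_nat_mul]
    nth_rw 1 [← hexp]
    rw [← Real.exp_add]
    refine Real.exp_le_exp.2 ?_
    nlinarith

/-- The error bound for a random graph to be nice. -/
noncomputable def niceError (L : ℝ) : ℝ :=
  2 * L * Real.exp (5 - 3 / 10 * L) + 4 * L ^ 2 * Real.exp (5 - 3 / 10 * L) + 24 / L ^ 2 +
    Real.exp 32 * (2 * (Real.exp 1 * L ^ 4 * Real.exp (-(3 / 8 * L)))) +
    Real.exp (1 - 3 / 20 * L) + Real.exp (-L)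

theorem IsDense.prob_not_isNice_le (h : IsDense n m)
    (hr : Real.exp 1 * Real.log n ^ 4 * Real.exp (-(3 / 8 * Real.log n)) ≤ 1 / 2) :
    prob (powersetCard m (edgePairs n)) (fun E => ¬ IsNice E (Real.log n / 20)
      (n / Real.log n ^ 4) (√n) (Real.log n ^ 2)) ≤ niceError (Real.log n) := by
  have h1 := h.prob_adj_low_le
  have h2 := h.prob_common_low_le
  have h3 := h.prob_inside_le
  have h4 := h.prob_boundary_le hr
  have h5 := h.prob_card_low_le
  have h6 := h.prob_degree_le
  unfold niceError
  refine le_trans ?_ (add_le_add (add_le_add (add_le_add (add_le_add (add_le_add h1 h2) h3) h4)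
    h5) h6)
  refine le_trans ?_ (add_le_add (add_le_add (add_le_add (add_le_add
    (prob_or_le _ _) le_rfl) le_rfl) le_rfl) le_rfl)
  refine le_trans ?_ (add_le_add (add_le_add (add_le_add (prob_or_le _ _) le_rfl) le_rfl) le_rfl)
  refine le_trans ?_ (add_le_add (add_le_add (prob_or_le _ _) le_rfl) le_rfl)
  refine le_trans ?_ (add_le_add (prob_or_le _ _) le_rfl)
  refine le_trans ?_ (prob_or_le _ _)
  refine prob_mono fun E hE hnot => ?_
  by_contra hcon
  push Not at hcon
  obtain ⟨⟨⟨⟨⟨c1, c2⟩, c3⟩, c4⟩, c5⟩, c6⟩ := hcon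
  exact hnot ⟨fun e he => mem_edgePairs.1 ((mem_powersetCard.1 hE).1 he), c1, c2, c3, c4, c5, c6⟩

end NiceProb

/-! ### Rare colours are far apart -/

section RareColours
open Finset

theorem prob_exists_le_mul {Ω ι : Type*} {s : Finset Ω} {t : Finset ι} {P : ι → Ω → Prop}
    {A c : ℝ} (hA : (#t : ℝ) ≤ A) (hc : 0 ≤ c) (h : ∀ i ∈ t, prob s (P i) ≤ c) :
    prob s (fun ω => ∃ i ∈ t, P i ω) ≤ A * c := by
  refine (prob_exists_le t P).trans ((sum_le_sum h).trans ?_)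
  rw [sum_const, nsmul_eq_mul]
  gcongr

open Classical in
/-- The edges of `E` that touch `f`. -/
noncomputable def touchingEdges {V : Type*} (E : Finset (Sym2 V)) (f : Sym2 V) :
    Finset (Sym2 V) := E.filter fun e => Touch e f

theorem mem_touchingEdges {V : Type*} {E : Finset (Sym2 V)} {e f : Sym2 V} :
    e ∈ touchingEdges E f ↔ e ∈ E ∧ Touch e f := by simp [touchingEdges]

theorem card_touchingEdges_le {V : Type*} {E : Finset (Sym2 V)} {Δ : ℝ}
    (h : ∀ v, (#(edgesAt E v) : ℝ) ≤ Δ) (f : Sym2 V) : (#(touchingEdges E f) : ℝ) ≤ 2 * Δ := by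
  classical
  induction f with | _ x y =>
  have h1 : touchingEdges E s(x, y) ⊆ edgesAt E x ∪ edgesAt E y := by
    intro e he
    obtain ⟨he1, v, hv1, hv2⟩ := mem_touchingEdges.1 he
    rcases Sym2.mem_iff.1 hv2 with rfl | rfl
    · exact mem_union_left _ (mem_edgesAt.2 ⟨he1, hv1⟩)
    · exact mem_union_right _ (mem_edgesAt.2 ⟨he1, hv1⟩)
  have h2 : (#(touchingEdges E s(x, y)) : ℝ) ≤ #(edgesAt E x) + #(edgesAt E y) := by
    exact_mod_cast (card_le_card h1).trans (card_union_le _ _)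
  linarith [h x, h y]

variable {n m k : ℕ}

theorem IsDense.cast_sub_one (h : IsDense n m) : ((n - 1 : ℕ) : ℝ) = n - 1 := by
  have h1 : 1 ≤ n := by
    have := h.large
    have : (1 : ℝ) ≤ n := by linarith
    exact_mod_cast this
  rw [Nat.cast_sub h1, Nat.cast_one]

/-- As (12/5)(49/100) > 117/100, the rarity of two colours costs more than a factor 1/n. The excess
n^{-17/100} beats the powers of log n produced by the counting. -/
theorem IsDense.exp_le (h : IsDense n m) (k : ℕ) {q : ℕ} (hq : q ≤ 4) :
    Real.exp (4 * (16 * k : ℕ) - 12 / 5 * (((m : ℝ) - q) / (n - 1 : ℕ))) ≤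
      Real.exp (64 * k + 1) * (n : ℝ)⁻¹ * Real.exp (-(17 / 100 * Real.log n)) := by
  have hinv : (n : ℝ)⁻¹ = Real.exp (-Real.log n) := by rw [Real.exp_neg, h.exp_log]
  rw [hinv, ← Real.exp_add, ← Real.exp_add]
  refine Real.exp_le_exp.2 ?_
  rw [h.cast_sub_one]
  have h1 := h.lower
  have h2 := h.large
  have h3 := h.log_pos
  have hq' : (q : ℝ) ≤ 4 := by exact_mod_cast hq
  have h4 : 49 / 100 * Real.log n - 1 / 10 ≤ ((m : ℝ) - q) / (n - 1) := by
    rw [le_div_iff₀ (by linarith)]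
    nlinarith
  push_cast
  nlinarith

/-- With M = n - 1 there are M² colour pairs, at most nL edges f and (2L²)² touching pairs. The two
incidences cost (k/M)², and rarity cancels the remaining n. -/
theorem IsDense.prob_rareColoursClose_le (h : IsDense n m) (hk : 2 ≤ k) (hkn : k ≤ n - 1)
    {E : Finset (Sym2 (Fin n))} (hE : #E = m)
    (hdeg : ∀ v, (#(edgesAt E v) : ℝ) ≤ Real.log n ^ 2) :
    prob (colourings (Sym2 (Fin n)) (Fin (n - 1)) k) (fun χ => RareColoursClose E χ (16 * k)) ≤
      4 * k ^ 2 * Real.exp (64 * k + 1) *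
        (Real.log n ^ 5 * Real.exp (-(17 / 100 * Real.log n))) := by
  classical
  have hn := h.pos
  have hL := h.log_pos
  have h2 := h.large
  have hM := h.cast_sub_one
  have hM0 : (0 : ℝ) < (n - 1 : ℕ) := by rw [hM]; linarith
  have hM4 : 4 ≤ n - 1 := by
    have : (4 : ℝ) ≤ (n - 1 : ℕ) := by rw [hM]; linarith
    exact_mod_cast this
  set L := Real.log n with hLdef
  set M : ℝ := ((n - 1 : ℕ) : ℝ) with hMdef
  set c : ℝ := (k / M) ^ 2 * (Real.exp (64 * k + 1) * (n : ℝ)⁻¹ * Real.exp (-(17 / 100 * L))) with hc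
  have hc0 : 0 ≤ c := by positivity
  have hW : (#(univ : Finset (Fin (n - 1))) : ℝ) ≤ M := by simp [hMdef]
  have hmL : (#E : ℝ) ≤ n * L := by
    rw [hE]
    have := h.upper
    nlinarith [mul_pos hn hL]
  refine (prob_mono (Q := fun χ => ∃ w₁ ∈ (univ : Finset (Fin (n - 1))),
    ∃ w₂ ∈ (univ : Finset (Fin (n - 1))), ∃ f ∈ E, ∃ e₁ ∈ touchingEdges E f,
      ∃ e₂ ∈ touchingEdges E f, w₁ ≠ w₂ ∧ w₁ ∈ χ e₁ ∧ w₂ ∈ χ e₂ ∧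
        #(edgesOfColour E χ w₁) ≤ 16 * k ∧ #(edgesOfColour E χ w₂) ≤ 16 * k) ?_).trans ?_
  · rintro χ - ⟨w₁, w₂, hw, h1, h2, f, hf, e₁, he₁, e₂, he₂, ht1, ht2, hc1, hc2⟩
    exact ⟨w₁, mem_univ _, w₂, mem_univ _, f, hf, e₁, mem_touchingEdges.2 ⟨he₁, ht1⟩, e₂,
      mem_touchingEdges.2 ⟨he₂, ht2⟩, hw, hc1, hc2, h1, h2⟩
  have hmain : prob (colourings (Sym2 (Fin n)) (Fin (n - 1)) k)
      (fun χ => ∃ w₁ ∈ (univ : Finset (Fin (n - 1))),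
    ∃ w₂ ∈ (univ : Finset (Fin (n - 1))), ∃ f ∈ E, ∃ e₁ ∈ touchingEdges E f,
      ∃ e₂ ∈ touchingEdges E f, w₁ ≠ w₂ ∧ w₁ ∈ χ e₁ ∧ w₂ ∈ χ e₂ ∧
        #(edgesOfColour E χ w₁) ≤ 16 * k ∧ #(edgesOfColour E χ w₂) ≤ 16 * k) ≤
      M * (M * ((n * L) * ((2 * L ^ 2) * ((2 * L ^ 2) * c)))) := by
    refine prob_exists_le_mul hW (by positivity) fun w₁ _ => ?_
    refine prob_exists_le_mul hW (by positivity) fun w₂ _ => ?_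
    refine prob_exists_le_mul hmL (by positivity) fun f _ => ?_
    refine prob_exists_le_mul (card_touchingEdges_le hdeg f) (by positivity) fun e₁ _ => ?_
    refine prob_exists_le_mul (card_touchingEdges_le hdeg f) (by positivity) fun e₂ _ => ?_
    by_cases hw : w₁ = w₂
    · rw [prob_eq_zero]
      · exact hc0
      · exact fun χ _ hχ => hχ.1 hw
    -- The edges may coincide; distinct colours keep the incidences distinct.
    have hQ : #({(w₁, e₁), (w₂, e₂)} : Finset (Fin (n - 1) × Sym2 (Fin n))) = 2 :=
      card_pair fun heq => hw (Prod.mk.inj heq).1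
    have h3 := prob_incidence_and_rare_le (α := Sym2 (Fin n)) hk (by simpa using hkn)
      (by simpa using hM4) {(w₁, e₁), (w₂, e₂)} E hw (16 * k)
    rw [hQ, Fintype.card_fin, hE] at h3
    refine (prob_mono fun χ _ hχ => ?_).trans (h3.trans ?_)
    · obtain ⟨-, hc1, hc2, h1, h2⟩ := hχ
      refine ⟨fun q hq => ?_, h1, h2⟩
      rcases mem_insert.1 hq with rfl | hq
      · exact hc1
      · rw [mem_singleton.1 hq]; exact hc2
    · exact mul_le_mul_of_nonneg_left (h.exp_le k (by norm_num)) (by positivity)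
  refine hmain.trans (le_of_eq ?_)
  rw [hc]
  field_simp
  ring

theorem IsDense.prob_rareColoursLinked_le (h : IsDense n m) (hk : 2 ≤ k) (hkn : k ≤ n - 1)
    {E : Finset (Sym2 (Fin n))} (hE : #E = m)
    (hdeg : ∀ v, (#(edgesAt E v) : ℝ) ≤ Real.log n ^ 2) :
    prob (colourings (Sym2 (Fin n)) (Fin (n - 1)) k) (fun χ => RareColoursLinked E χ (16 * k)) ≤
      4 * k ^ 4 * Real.exp (64 * k + 1) *
        (Real.log n ^ 6 * Real.exp (-(17 / 100 * Real.log n))) := by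
  classical
  have hn := h.pos
  have hL := h.log_pos
  have h2 := h.large
  have hM := h.cast_sub_one
  have hM0 : (0 : ℝ) < (n - 1 : ℕ) := by rw [hM]; linarith
  have hM4 : 4 ≤ n - 1 := by
    have : (4 : ℝ) ≤ (n - 1 : ℕ) := by rw [hM]; linarith
    exact_mod_cast this
  -- The slack 3/4 absorbs the factor n/(n - 1) left over at the end.
  have hmL : (#E : ℝ) ≤ 3 / 4 * (n * Real.log n) := by
    rw [hE]
    have := h.upper
    nlinarith [mul_pos hn hL]
  set L := Real.log n with hLdef
  set M : ℝ := ((n - 1 : ℕ) : ℝ) with hMdef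
  set c : ℝ := (k / M) ^ 4 * (Real.exp (64 * k + 1) * (n : ℝ)⁻¹ * Real.exp (-(17 / 100 * L))) with hc
  have hc0 : 0 ≤ c := by positivity
  have hW : (#(univ : Finset (Fin (n - 1))) : ℝ) ≤ M := by simp [hMdef]
  refine (prob_mono (Q := fun χ => ∃ w₁ ∈ (univ : Finset (Fin (n - 1))),
    ∃ w₂ ∈ (univ : Finset (Fin (n - 1))), ∃ w ∈ (univ : Finset (Fin (n - 1))), ∃ f₁ ∈ E, ∃ f₂ ∈ E,
      ∃ e₁ ∈ touchingEdges E f₁, ∃ e₂ ∈ touchingEdges E f₂, (w₁ ≠ w₂ ∧ w ≠ w₁ ∧ w ≠ w₂ ∧ f₁ ≠ f₂) ∧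
        w₁ ∈ χ e₁ ∧ w₂ ∈ χ e₂ ∧ w ∈ χ f₁ ∧ w ∈ χ f₂ ∧
        #(edgesOfColour E χ w₁) ≤ 16 * k ∧ #(edgesOfColour E χ w₂) ≤ 16 * k) ?_).trans ?_
  · rintro χ - ⟨w₁, w₂, hw, h1, h2, w, hw1, hw2, f₁, hf₁, f₂, hf₂, hff, e₁, he₁, e₂, he₂, ht1, ht2,
      hc3, hc4, hc1, hc2⟩
    exact ⟨w₁, mem_univ _, w₂, mem_univ _, w, mem_univ _, f₁, hf₁, f₂, hf₂, e₁,
      mem_touchingEdges.2 ⟨he₁, ht1⟩, e₂, mem_touchingEdges.2 ⟨he₂, ht2⟩, ⟨hw, hw1, hw2, hff⟩,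
      hc1, hc2, hc3, hc4, h1, h2⟩
  have hmain : prob (colourings (Sym2 (Fin n)) (Fin (n - 1)) k)
      (fun χ => ∃ w₁ ∈ (univ : Finset (Fin (n - 1))),
    ∃ w₂ ∈ (univ : Finset (Fin (n - 1))), ∃ w ∈ (univ : Finset (Fin (n - 1))), ∃ f₁ ∈ E, ∃ f₂ ∈ E,
      ∃ e₁ ∈ touchingEdges E f₁, ∃ e₂ ∈ touchingEdges E f₂, (w₁ ≠ w₂ ∧ w ≠ w₁ ∧ w ≠ w₂ ∧ f₁ ≠ f₂) ∧
        w₁ ∈ χ e₁ ∧ w₂ ∈ χ e₂ ∧ w ∈ χ f₁ ∧ w ∈ χ f₂ ∧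
        #(edgesOfColour E χ w₁) ≤ 16 * k ∧ #(edgesOfColour E χ w₂) ≤ 16 * k) ≤
      M * (M * (M * ((3 / 4 * (n * L)) * ((3 / 4 * (n * L)) *
        ((2 * L ^ 2) * ((2 * L ^ 2) * c)))))) := by
    refine prob_exists_le_mul hW (by positivity) fun w₁ _ => ?_
    refine prob_exists_le_mul hW (by positivity) fun w₂ _ => ?_
    refine prob_exists_le_mul hW (by positivity) fun w _ => ?_
    refine prob_exists_le_mul hmL (by positivity) fun f₁ _ => ?_
    refine prob_exists_le_mul hmL (by positivity) fun f₂ _ => ?_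
    refine prob_exists_le_mul (card_touchingEdges_le hdeg f₁) (by positivity) fun e₁ _ => ?_
    refine prob_exists_le_mul (card_touchingEdges_le hdeg f₂) (by positivity) fun e₂ _ => ?_
    by_cases hw : w₁ ≠ w₂ ∧ w ≠ w₁ ∧ w ≠ w₂ ∧ f₁ ≠ f₂
    swap
    · rw [prob_eq_zero]
      · exact hc0
      · exact fun χ _ hχ => hw hχ.1
    obtain ⟨hw12, hw1, hw2, hff⟩ := hw
    have hQ : #({(w₁, e₁), (w₂, e₂), (w, f₁), (w, f₂)} :
        Finset (Fin (n - 1) × Sym2 (Fin n))) = 4 := by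
      rw [card_insert_of_notMem, card_insert_of_notMem, card_insert_of_notMem, card_singleton]
      · simp [hff]
      · simp [hw2.symm]
      · simp [hw12, hw1.symm]
    have h3 := prob_incidence_and_rare_le (α := Sym2 (Fin n)) hk (by simpa using hkn)
      (by simpa using hM4) {(w₁, e₁), (w₂, e₂), (w, f₁), (w, f₂)} E hw12 (16 * k)
    rw [hQ, Fintype.card_fin, hE] at h3
    refine (prob_mono fun χ _ hχ => ?_).trans (h3.trans ?_)
    · obtain ⟨-, hc1, hc2, hc3, hc4, h1, h2⟩ := hχ
      refine ⟨fun q hq => ?_, h1, h2⟩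
      simp only [mem_insert, mem_singleton] at hq
      rcases hq with rfl | rfl | rfl | rfl <;> assumption
    · exact mul_le_mul_of_nonneg_left (h.exp_le k (by norm_num)) (by positivity)
  refine hmain.trans ?_
  have h5 : M * (M * (M * ((3 / 4 * (n * L)) * ((3 / 4 * (n * L)) *
        ((2 * L ^ 2) * ((2 * L ^ 2) * c)))))) =
      9 / 16 * (n / M) * (4 * k ^ 4 * Real.exp (64 * k + 1) * (L ^ 6 * Real.exp (-(17 / 100 * L)))) := by
    rw [hc]
    field_simp
    ring
  rw [h5]
  refine mul_le_of_le_one_left (by positivity) ?_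
  rw [mul_div_assoc', div_le_one hM0, hM]
  linarith

end RareColours

/-! ### Union bounds over colour sets and edge sets -/

section ColourUnion
open Finset

variable {n m k : ℕ}

/-- The required number of edges depends on J only through its size, so the sum can afterwards be
grouped by size. -/
theorem prob_exists_colours_subset_le {α W : Type*} [Fintype α] [Fintype W] (hk : 2 ≤ k)
    (hkW : k ≤ Fintype.card W) (s : Finset (Finset W)) (B : Finset α) (x : ℕ → ℕ) :
    prob (colourings α W k) (fun χ => ∃ J ∈ s, ∃ F ∈ powersetCard (x #J) B, ∀ e ∈ F, χ e ⊆ J) ≤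
      ∑ J ∈ s, ((#B).choose (x #J) : ℝ) * ((#J : ℝ) / Fintype.card W) ^ (2 * x #J) := by
  refine (prob_exists_le _ _).trans (sum_le_sum fun J _ => ?_)
  rw [← card_powersetCard]
  refine prob_exists_le_mul le_rfl (by positivity) fun F hF => ?_
  rw [← (mem_powersetCard.1 hF).2]
  exact prob_colours_subset_le hk hkW F J

theorem IsDense.le_sub_one (h : IsDense n m) : 999 / 1000 * (n : ℝ) ≤ (n - 1 : ℕ) := by
  rw [h.cast_sub_one]
  linarith [h.large]

theorem IsDense.sub_one_le (h : IsDense n m) : ((n - 1 : ℕ) : ℝ) ≤ n := by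
  rw [h.cast_sub_one]
  linarith

theorem IsDense.upper' (h : IsDense n m) : (m : ℝ) ≤ 52 / 100 * ((n - 1 : ℕ) * Real.log n) := by
  have h1 := h.upper
  have h2 := h.le_sub_one
  have h3 := h.log_pos
  nlinarith

/-- Few colours contain twice as many edges. -/
theorem IsDense.prob_two_mul_le (h : IsDense n m) (hk : 2 ≤ k) (hkn : k ≤ n - 1)
    {E : Finset (Sym2 (Fin n))} (hE : #E = m) :
    prob (colourings (Sym2 (Fin n)) (Fin (n - 1)) k) (fun χ =>
      ∃ J : Finset (Fin (n - 1)), 1 ≤ #J ∧ #J < n / Real.log n ^ 4 ∧ ∃ F ⊆ E, 2 * (#J + 1) ≤ #F ∧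
        ∀ e ∈ F, χ e ⊆ J) ≤ 4 / Real.log n ^ 2 := by
  classical
  have hn := h.pos
  have hL := h.log_pos
  have hL1 := h.log_ge
  have hM1 := h.le_sub_one
  have hm := h.upper'
  have hM0 : (0 : ℝ) < (n - 1 : ℕ) := by linarith
  set L := Real.log n with hLdef
  set M : ℝ := ((n - 1 : ℕ) : ℝ) with hMdef
  set s := (univ : Finset (Finset (Fin (n - 1)))).filter
    (fun J => 1 ≤ #J ∧ (#J : ℝ) < n / L ^ 4) with hs
  refine (prob_mono (Q := fun χ => ∃ J ∈ s, ∃ F ∈ powersetCard (2 * (#J + 1)) E,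
    ∀ e ∈ F, χ e ⊆ J) ?_).trans ?_
  · rintro χ - ⟨J, hJ1, hJ2, F, hFE, hF, hJ⟩
    obtain ⟨F', hF'1, hF'2⟩ := exists_subset_card_eq hF
    exact ⟨J, mem_filter.2 ⟨mem_univ _, hJ1, hJ2⟩, F',
      mem_powersetCard.2 ⟨hF'1.trans hFE, hF'2⟩, fun e he => hJ e (hF'1 he)⟩
  refine (prob_exists_colours_subset_le hk (by simpa using hkn) s E
    (fun a => 2 * (a + 1))).trans ?_
  rw [hE, Fintype.card_fin, ← hMdef]
  have h4 : 1 * (2 * (2 / L ^ 2)) = 4 / L ^ 2 := by ring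
  rw [← h4]
  refine sum_subsets_le s
    (fun a : ℕ => (m.choose (2 * (a + 1)) : ℝ) * ((a : ℝ) / M) ^ (2 * (2 * (a + 1))))
    zero_le_one (by positivity) ?_ (fun J hJ => (mem_filter.1 hJ).2.1) ?_
  · rw [div_le_iff₀ (by positivity)]
    nlinarith
  intro J hJ
  obtain ⟨-, hJ1, hJ2⟩ := mem_filter.1 hJ
  set a := #J with ha
  have ha0 : (0 : ℝ) < a := by exact_mod_cast hJ1
  have h6 : (a : ℝ) * L ^ 4 ≤ n := by
    rw [lt_div_iff₀ (by positivity)] at hJ2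
    exact hJ2.le
  -- y bounds the cost per edge. As y ≤ 1, the two surplus edges can be dropped; each colour then
  -- contributes (eM/a)y², of order aL²/n ≤ L⁻².
  set y : ℝ := Real.exp 1 * m * a / (2 * M ^ 2) with hy
  have he3 := exp_one_pow_three_le
  have he1 : Real.exp 1 ≤ 2.7182818286 := Real.exp_one_lt_d9.le
  have hy1 : y ≤ 1 := by
    rw [hy, div_le_one (by positivity)]
    have h7 : (a : ℝ) * L ≤ n := by
      refine le_trans ?_ h6
      gcongr
      exact le_self_pow₀ (by linarith) (by norm_num)
    calc Real.exp 1 * m * a ≤ 2.7182818286 * (52 / 100 * (M * L)) * a := by gcongr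
      _ = 2.7182818286 * (52 / 100) * M * (a * L) := by ring
      _ ≤ 2.7182818286 * (52 / 100) * M * (1000 / 999 * M) :=
            mul_le_mul_of_nonneg_left (by linarith) (by positivity)
      _ ≤ 2 * M ^ 2 := by nlinarith [mul_pos hM0 hM0]
  have h2 := choose_le_exp_mul_div_pow (n - 1) a
  have h3 := choose_le_exp_mul_div_pow m (2 * (a + 1))
  rw [Fintype.card_fin, one_mul]
  calc ((n - 1).choose a : ℝ) *
        ((m.choose (2 * (a + 1)) : ℝ) * ((a : ℝ) / M) ^ (2 * (2 * (a + 1))))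
      ≤ (Real.exp 1 * M / a) ^ a * ((Real.exp 1 * m / (2 * (a + 1) : ℕ)) ^ (2 * (a + 1)) *
          ((a : ℝ) / M) ^ (2 * (2 * (a + 1)))) := by gcongr
    _ = (Real.exp 1 * M / a) ^ a * (Real.exp 1 * m / (2 * (a + 1) : ℕ) *
          ((a : ℝ) / M) ^ 2) ^ (2 * (a + 1)) := by rw [pow_mul (_ / M), ← mul_pow]
    _ ≤ (Real.exp 1 * M / a) ^ a * y ^ (2 * (a + 1)) := by
        gcongr
        rw [hy, div_pow, div_mul_div_comm, div_le_div_iff₀ (by positivity) (by positivity)]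
        push_cast
        have : Real.exp 1 * m * a ^ 2 * (2 * M ^ 2) = Real.exp 1 * m * a * (2 * a * M ^ 2) := by
          ring
        rw [this]
        gcongr
        linarith
    _ ≤ (Real.exp 1 * M / a) ^ a * y ^ (2 * a) := by
        refine mul_le_mul_of_nonneg_left ?_ (by positivity)
        exact pow_le_pow_of_le_one (by positivity) hy1 (by omega)
    _ = (Real.exp 1 ^ 3 * m ^ 2 * a / (4 * M ^ 3)) ^ a := by
        rw [pow_mul, ← mul_pow, hy]
        congr 1
        field_simp
        norm_num
    _ ≤ (2 / L ^ 2) ^ a := by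
        refine pow_le_pow_left₀ (by positivity) ?_ _
        rw [div_le_div_iff₀ (by positivity) (by positivity)]
        calc Real.exp 1 ^ 3 * m ^ 2 * a * L ^ 2
            ≤ 21 * (52 / 100 * (M * L)) ^ 2 * a * L ^ 2 := by gcongr
          _ = 21 * (52 / 100) ^ 2 * M ^ 2 * (a * L ^ 4) := by ring
          _ ≤ 21 * (52 / 100) ^ 2 * M ^ 2 * (1000 / 999 * M) :=
            mul_le_mul_of_nonneg_left (by linarith) (by positivity)
          _ ≤ 2 * (4 * M ^ 3) := by nlinarith [pow_pos hM0 3]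

/-- Few colours contain many edges at vertices of low degree. -/
theorem IsDense.prob_lowEdges_le (h : IsDense n m) (hk : 2 ≤ k) (hkn : k ≤ n - 1)
    {B : Finset (Sym2 (Fin n))} (hB : (#B : ℝ) ≤ √n * (Real.log n / 20))
    (hr : Real.log n * Real.exp (-(1 / 8 * Real.log n)) ≤ 1 / 2) :
    prob (colourings (Sym2 (Fin n)) (Fin (n - 1)) k) (fun χ =>
      ∃ J : Finset (Fin (n - 1)), 1 ≤ #J ∧ #J < n / Real.log n ^ 4 ∧ ∃ F ⊆ B,
        3 * (#J + 1) ≤ 4 * #F ∧ ∀ e ∈ F, χ e ⊆ J) ≤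
      2 * (Real.log n * Real.exp (-(1 / 8 * Real.log n))) := by
  classical
  have hn := h.pos
  have hL := h.log_pos
  have hL1 := h.log_ge
  have hM1 := h.le_sub_one
  have hM0 : (0 : ℝ) < (n - 1 : ℕ) := by linarith
  have hsq : √(n : ℝ) = Real.exp (1 / 2 * Real.log n) := by
    rw [Real.sqrt_eq_rpow, Real.rpow_def_of_pos hn, mul_comm]
  have hexp := h.exp_log
  set L := Real.log n with hLdef
  set M : ℝ := ((n - 1 : ℕ) : ℝ) with hMdef
  set s := (univ : Finset (Finset (Fin (n - 1)))).filter
    (fun J => 1 ≤ #J ∧ (#J : ℝ) < n / L ^ 4) with hs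
  -- This is 3(a + 1)/4 rounded up.
  set x : ℕ → ℕ := fun a => (3 * (a + 1) + 3) / 4 with hx
  refine (prob_mono (Q := fun χ => ∃ J ∈ s, ∃ F ∈ powersetCard (x #J) B,
    ∀ e ∈ F, χ e ⊆ J) ?_).trans ?_
  · rintro χ - ⟨J, hJ1, hJ2, F, hFE, hF, hJ⟩
    obtain ⟨F', hF'1, hF'2⟩ := exists_subset_card_eq (show x #J ≤ #F by simp only [hx]; omega)
    exact ⟨J, mem_filter.2 ⟨mem_univ _, hJ1, hJ2⟩, F',
      mem_powersetCard.2 ⟨hF'1.trans hFE, hF'2⟩, fun e he => hJ e (hF'1 he)⟩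
  refine (prob_exists_colours_subset_le hk (by simpa using hkn) s B x).trans ?_
  rw [Fintype.card_fin, ← hMdef, ← one_mul (2 * (L * _))]
  refine sum_subsets_le s
    (fun a : ℕ => ((#B).choose (x a) : ℝ) * ((a : ℝ) / M) ^ (2 * x a))
    zero_le_one (by positivity) hr (fun J hJ => (mem_filter.1 hJ).2.1) ?_
  intro J hJ
  obtain ⟨-, hJ1, hJ2⟩ := mem_filter.1 hJ
  set a := #J with ha
  have ha1 : (1 : ℝ) ≤ a := by exact_mod_cast hJ1
  have ha0 : (0 : ℝ) < a := by linarith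
  have hx4 : 3 * a ≤ 4 * x a := by simp only [hx]; omega
  have hx4' : (3 * a : ℝ) ≤ 4 * x a := by exact_mod_cast hx4
  have hx0 : (0 : ℝ) < x a := by linarith
  have haM : (a : ℝ) ≤ M := by
    have : #J ≤ n - 1 := (card_le_univ J).trans_eq (Fintype.card_fin _)
    rw [hMdef, ha]
    exact_mod_cast this
  set b : ℝ := √n * (L / 20) with hb
  have hb0 : 0 < b := by rw [hb, hsq]; positivity
  have he1 : Real.exp 1 ≤ 3 := by linarith [Real.exp_one_lt_d9]
  have hbb : b ^ 2 = n * (L ^ 2 / 400) := by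
    rw [hb, mul_pow, Real.sq_sqrt hn.le]; ring
  -- z bounds the cost per edge and has order a L n^{-3/2}, because there are only about √n L
  -- candidate edges. With 3a/4 edges it beats the choice of J, since 3/4 exceeds 2/3.
  set z : ℝ := 4 * b * a / M ^ 2 with hz
  have hLn : L ^ 4 ≤ n := (pow_le_pow_right₀ (by linarith) (by norm_num)).trans h.log_pow_le
  have hz1 : z ≤ 1 := by
    rw [hz, div_le_one (by positivity)]
    have hbM : 4 * b ≤ M := by
      refine le_of_sq_le_sq ?_ hM0.le
      rw [mul_pow, hbb]
      have h10 : L ^ 2 ≤ n := (pow_le_pow_right₀ (by linarith) (by norm_num)).trans h.log_pow_le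
      have h11 : (999 / 1000 * (n : ℝ)) ^ 2 ≤ M ^ 2 := by gcongr
      nlinarith
    rw [sq]
    exact mul_le_mul hbM haM ha0.le hM0.le
  have h2 := choose_le_exp_mul_div_pow (n - 1) a
  have h3 := choose_le_exp_mul_div_pow #B (x a)
  rw [Fintype.card_fin, one_mul]
  have hstep : ((n - 1).choose a : ℝ) * (((#B).choose (x a) : ℝ) * ((a : ℝ) / M) ^ (2 * x a)) ≤
      (Real.exp 1 * M / a) ^ a * z ^ x a := by
    calc ((n - 1).choose a : ℝ) * (((#B).choose (x a) : ℝ) * ((a : ℝ) / M) ^ (2 * x a))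
        ≤ (Real.exp 1 * M / a) ^ a * ((Real.exp 1 * #B / x a) ^ x a *
            ((a : ℝ) / M) ^ (2 * x a)) := by gcongr
      _ = (Real.exp 1 * M / a) ^ a * (Real.exp 1 * #B / x a * ((a : ℝ) / M) ^ 2) ^ x a := by
          rw [pow_mul (_ / M), ← mul_pow]
      _ ≤ (Real.exp 1 * M / a) ^ a * z ^ x a := by
          gcongr
          rw [hz, div_pow, div_mul_div_comm, div_le_div_iff₀ (by positivity) (by positivity)]
          calc Real.exp 1 * #B * a ^ 2 * M ^ 2 ≤ 3 * b * a ^ 2 * M ^ 2 := by gcongr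
            _ = (3 * a) * (b * a * M ^ 2) := by ring
            _ ≤ (4 * x a) * (b * a * M ^ 2) := by gcongr
            _ = 4 * b * a * (x a * M ^ 2) := by ring
  refine hstep.trans ?_
  -- Fourth powers avoid the fractional exponent 3a/4.
  refine le_of_pow_le_pow_left₀ (n := 4) (by norm_num) (by positivity) ?_
  calc ((Real.exp 1 * M / a) ^ a * z ^ x a) ^ 4
      = ((Real.exp 1 * M / a) ^ 4) ^ a * z ^ (4 * x a) := by
        rw [mul_pow, ← pow_mul, ← pow_mul, ← pow_mul, mul_comm a 4, mul_comm (x a) 4]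
    _ ≤ ((Real.exp 1 * M / a) ^ 4) ^ a * z ^ (3 * a) := by
        refine mul_le_mul_of_nonneg_left ?_ (by positivity)
        exact pow_le_pow_of_le_one (by positivity) hz1 hx4
    _ = (Real.exp 1 ^ 4 * 64 * b ^ 3 / (a * M ^ 2)) ^ a := by
        rw [pow_mul, ← mul_pow, hz]
        congr 1
        field_simp
        norm_num
    _ ≤ (L ^ 4 * Real.exp (-(1 / 2 * L))) ^ a := by
        refine pow_le_pow_left₀ (by positivity) ?_ _
        rw [Real.exp_neg, ← hsq, ← div_eq_mul_inv, div_le_div_iff₀ (by positivity)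
          (Real.sqrt_pos.2 hn)]
        have hbs : b ^ 3 * √n = n ^ 2 * L ^ 3 / 8000 := by
          rw [hb]
          have : √(n : ℝ) * √n = n := Real.mul_self_sqrt hn.le
          calc (√(n : ℝ) * (L / 20)) ^ 3 * √n = (√(n : ℝ) * √n) * (√(n : ℝ) * √n) * L ^ 3 / 8000 := by
                ring
            _ = _ := by rw [this]; ring
        have h11 : (999 / 1000 * (n : ℝ)) ^ 2 ≤ M ^ 2 := by gcongr
        calc Real.exp 1 ^ 4 * 64 * b ^ 3 * √n = Real.exp 1 ^ 4 * 64 * (b ^ 3 * √n) := by ring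
          _ = Real.exp 1 ^ 4 * 64 * (n ^ 2 * L ^ 3 / 8000) := by rw [hbs]
          _ ≤ 3 ^ 4 * 64 * (n ^ 2 * L ^ 3 / 8000) := by gcongr
          _ ≤ L ^ 4 * (1 * (999 / 1000 * (n : ℝ)) ^ 2) := by
              have : 0 < (n : ℝ) ^ 2 * L ^ 3 := by positivity
              nlinarith
          _ ≤ L ^ 4 * (a * M ^ 2) := by gcongr
    _ = ((L * Real.exp (-(1 / 8 * L))) ^ a) ^ 4 := by
        rw [← pow_mul, mul_comm a 4, pow_mul, mul_pow L, ← Real.exp_nat_mul]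
        congr 3
        push_cast
        ring

/-- A small proportion of the colours contains many edges. -/
theorem IsDense.prob_many_edges_le (h : IsDense n m) (hk : 2 ≤ k) (hkn : k ≤ n - 1)
    {E : Finset (Sym2 (Fin n))} (hE : #E = m)
    (hr : Real.exp 1 * Real.log n ^ 4 * Real.exp (-(1 / 240 * Real.log n)) ≤ 1 / 2) :
    prob (colourings (Sym2 (Fin n)) (Fin (n - 1)) k) (fun χ =>
      ∃ J : Finset (Fin (n - 1)), n / Real.log n ^ 4 ≤ #J ∧ #J ≤ (n : ℝ) / 1000 ∧ ∃ F ⊆ E,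
        #J * (Real.log n / 20) / 12 ≤ #F ∧ ∀ e ∈ F, χ e ⊆ J) ≤
      2 * (Real.exp 1 * Real.log n ^ 4 * Real.exp (-(1 / 240 * Real.log n))) := by
  classical
  have hn := h.pos
  have hL := h.log_pos
  have hM1 := h.le_sub_one
  have hM2 := h.sub_one_le
  have hm := h.upper'
  have hM0 : (0 : ℝ) < (n - 1 : ℕ) := by linarith
  set L := Real.log n with hLdef
  set M : ℝ := ((n - 1 : ℕ) : ℝ) with hMdef
  set s := (univ : Finset (Finset (Fin (n - 1)))).filter
    (fun J => n / L ^ 4 ≤ #J ∧ (#J : ℝ) ≤ (n : ℝ) / 1000) with hs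
  set x : ℕ → ℕ := fun a => ⌈a * (L / 20) / 12⌉₊ with hx
  have hs0 : ∀ J ∈ s, (0 : ℝ) < #J := by
    intro J hJ
    have := (mem_filter.1 hJ).2.1
    have h2 : 0 < n / L ^ 4 := by positivity
    linarith
  refine (prob_mono (Q := fun χ => ∃ J ∈ s, ∃ F ∈ powersetCard (x #J) E,
    ∀ e ∈ F, χ e ⊆ J) ?_).trans ?_
  · rintro χ - ⟨J, hJ1, hJ2, F, hFE, hF, hJ⟩
    obtain ⟨F', hF'1, hF'2⟩ := exists_subset_card_eq (show x #J ≤ #F from Nat.ceil_le.2 hF)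
    exact ⟨J, mem_filter.2 ⟨mem_univ _, hJ1, hJ2⟩, F',
      mem_powersetCard.2 ⟨hF'1.trans hFE, hF'2⟩, fun e he => hJ e (hF'1 he)⟩
  refine (prob_exists_colours_subset_le hk (by simpa using hkn) s E x).trans ?_
  rw [hE, Fintype.card_fin, ← hMdef, ← one_mul (2 * (Real.exp 1 * _ * _))]
  refine sum_subsets_le s
    (fun a : ℕ => (m.choose (x a) : ℝ) * ((a : ℝ) / M) ^ (2 * x a))
    zero_le_one (by positivity) hr (fun J hJ => by exact_mod_cast hs0 J hJ) ?_
  intro J hJ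
  have ha0 := hs0 J hJ
  obtain ⟨-, hJ1, hJ2⟩ := mem_filter.1 hJ
  set a := #J with ha
  have hxa : a * (L / 20) / 12 ≤ x a := Nat.le_ceil _
  have hx0 : (0 : ℝ) < x a := lt_of_lt_of_le (by positivity) hxa
  have he1 : Real.exp 1 ≤ 2.7182818286 := Real.exp_one_lt_d9.le
  have h2 := choose_le_exp_mul_div_pow (n - 1) a
  have h3 := choose_le_exp_mul_div_pow m (x a)
  rw [Fintype.card_fin, one_mul]
  calc ((n - 1).choose a : ℝ) * ((m.choose (x a) : ℝ) * ((a : ℝ) / M) ^ (2 * x a))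
      ≤ (Real.exp 1 * M / a) ^ a * ((Real.exp 1 * m / x a) ^ x a *
          ((a : ℝ) / M) ^ (2 * x a)) := by gcongr
    _ = (Real.exp 1 * M / a) ^ a * (Real.exp 1 * m / x a * ((a : ℝ) / M) ^ 2) ^ x a := by
        rw [pow_mul (_ / M), ← mul_pow]
    -- The cutoff n/1000 is used here: as x ≥ aL/240, the base is at most e · 0.52 · 240 · a/M, and
    -- a/M ≤ 1/999 brings this below 1/e.
    _ ≤ (Real.exp 1 * M / a) ^ a * Real.exp (-1) ^ x a := by
        gcongr
        rw [div_pow, div_mul_div_comm, div_le_iff₀ (by positivity), Real.exp_neg,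
          inv_mul_eq_div, le_div_iff₀ (Real.exp_pos 1)]
        have haM : (a : ℝ) ≤ M / 999 := by linarith
        calc Real.exp 1 * m * a ^ 2 * Real.exp 1
            ≤ 2.7182818286 * (52 / 100 * (M * L)) * a ^ 2 * 2.7182818286 := by gcongr
          _ = (2.7182818286 * 2.7182818286 * (52 / 100) * 240) * (a * (L / 20) / 12) * (M * a) := by
              ring
          _ ≤ 999 * (x a) * (M * (M / 999)) := by gcongr; norm_num
          _ = x a * M ^ 2 := by ring
    _ ≤ (Real.exp 1 * L ^ 4) ^ a * Real.exp (-(1 / 240 * L)) ^ a := by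
        rw [← Real.exp_nat_mul, ← Real.exp_nat_mul]
        have h5 : Real.exp 1 * M / a ≤ Real.exp 1 * L ^ 4 := by
          rw [mul_div_assoc]
          gcongr
          rw [div_le_iff₀ ha0]
          rw [div_le_iff₀ (by positivity)] at hJ1
          linarith
        gcongr ?_ ^ a * Real.exp ?_
        linarith
    _ = _ := by rw [← mul_pow]

/-- A large proportion of the colours misses all edges crossing a partition into many classes. -/
theorem IsDense.prob_crossing_le (h : IsDense n m) (hk : 2 ≤ k) (hkn : k ≤ n - 1)
    {E : Finset (Sym2 (Fin n))} (hE : #E = m) {l Δ : ℝ}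
    (hnice : IsNice E (Real.log n / 20) (n / Real.log n ^ 4) l Δ) (hl : 6000 * l ≤ n)
    (hr : 4 * Real.log n ^ 9 * Real.exp (-(1 / 120000 * Real.log n)) ≤ 1 / 2) :
    prob (colourings (Sym2 (Fin n)) (Fin (n - 1)) k) (fun χ =>
      ∃ I : Finset (Fin (n - 1)), n / Real.log n ^ 4 < #I ∧ (n : ℝ) / 1000 < #Iᶜ ∧
        ∃ S ⊆ E, #S = #I ∧ ∀ e ∈ crossingEdges E (componentMap S), χ e ⊆ Iᶜ) ≤
      2 * (4 * Real.log n ^ 9 * Real.exp (-(1 / 120000 * Real.log n))) := by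
  classical
  have hn := h.pos
  have hL := h.log_pos
  have hL1 := h.log_ge
  have hM1 := h.le_sub_one
  have hM2 := h.sub_one_le
  have hup := h.upper
  have hpow := h.log_pow_le
  have hM0 : (0 : ℝ) < (n - 1 : ℕ) := by linarith
  set L := Real.log n with hLdef
  set M : ℝ := ((n - 1 : ℕ) : ℝ) with hMdef
  set s := (univ : Finset (Finset (Fin (n - 1)))).filter
    (fun I => n / L ^ 4 < #I ∧ (n : ℝ) / 1000 < #Iᶜ) with hs
  have hs0 : ∀ I ∈ s, (0 : ℝ) < #I := by
    intro J hJ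
    have := (mem_filter.1 hJ).2.1
    have h2 : 0 < n / L ^ 4 := by positivity
    linarith
  refine (prob_mono (Q := fun χ => ∃ I ∈ s, ∃ S ∈ powersetCard #I E,
    ∀ e ∈ crossingEdges E (componentMap S), χ e ⊆ Iᶜ) ?_).trans ?_
  · rintro χ - ⟨I, hI1, hI2, S, hSE, hS, hI⟩
    exact ⟨I, mem_filter.2 ⟨mem_univ _, hI1, hI2⟩, S, mem_powersetCard.2 ⟨hSE, hS⟩, hI⟩
  refine (prob_exists_le _ _).trans ?_
  have h1 : ∀ I ∈ s, prob (colourings (Sym2 (Fin n)) (Fin (n - 1)) k) (fun χ =>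
      ∃ S ∈ powersetCard #I E, ∀ e ∈ crossingEdges E (componentMap S), χ e ⊆ Iᶜ) ≤
      (m.choose #I : ℝ) * Real.exp (-(1 / 120000 * L)) ^ #I := by
    intro I hI
    obtain ⟨-, hI1, hI2⟩ := mem_filter.1 hI
    rw [← hE, ← card_powersetCard]
    refine prob_exists_le_mul le_rfl (by positivity) fun S hS => ?_
    obtain ⟨hSE, hSc⟩ := mem_powersetCard.1 hS
    have hcard : #I + #Iᶜ = n - 1 := by rw [card_add_card_compl, Fintype.card_fin]
    have hcc := edgeRank_add_card_connectedComponent S (fun e he => hnice.not_isDiag e (hSE he))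
    have hrk := edgeRank_le_card S
    rw [Nat.card_eq_fintype_card, Fintype.card_fin] at hcc
    -- S has at least |Iᶜ| + 1 > n/1000 components, whence at least nL/240000 crossing edges. Each
    -- is coloured inside Iᶜ with probability at most (1 - |I|/M)², which totals e^{-|I|L/120000}.
    have hcross := hnice.le_card_crossingEdges (by linarith) (componentMap S)
      (componentMap_surjective S) (r := n / 1000) (by positivity)
      (hI2.le.trans (by exact_mod_cast (by omega))) (by
        rw [Fintype.card_fin, div_mul_div_comm, le_div_iff₀ (by positivity)]
        have h10 : L ^ 4 * 1000 ≤ n := by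
          refine le_trans ?_ hpow
          have : (1000 : ℝ) ≤ L ^ 6 := hL1.trans (le_self_pow₀ (by linarith) (by norm_num))
          calc L ^ 4 * 1000 ≤ L ^ 4 * L ^ 6 := by gcongr
            _ = L ^ 10 := by ring
        gcongr) (by linarith)
    refine (prob_colours_subset_le hk (by simpa using hkn) _ Iᶜ).trans ?_
    rw [Fintype.card_fin, ← hMdef]
    have hIc : (#Iᶜ : ℝ) / M ≤ Real.exp (-(#I / M)) := by
      have : (#Iᶜ : ℝ) / M = 1 - #I / M := by
        rw [eq_sub_iff_add_eq, ← add_div, div_eq_one_iff_eq hM0.ne', hMdef]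
        exact_mod_cast (by omega)
      rw [this]
      have := Real.add_one_le_exp (-((#I : ℝ) / M))
      linarith
    calc ((#Iᶜ : ℝ) / M) ^ (2 * #(crossingEdges E (componentMap S)))
        ≤ Real.exp (-(#I / M)) ^ (2 * #(crossingEdges E (componentMap S))) := by gcongr
      _ ≤ _ := by
        rw [← Real.exp_nat_mul, ← Real.exp_nat_mul]
        refine Real.exp_le_exp.2 ?_
        push_cast
        have h11 : (M : ℝ) * L / 240000 ≤ #(crossingEdges E (componentMap S)) := by
          refine le_trans ?_ hcross
          have : n / 1000 * (L / 20) / 12 = n * L / 240000 := by ring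
          rw [this]
          gcongr
        have h12 : (#I : ℝ) / M * (M * L / 240000) = #I * L / 240000 := by field_simp
        have h13 : (#I : ℝ) / M * (M * L / 240000) ≤
          #I / M * #(crossingEdges E (componentMap S)) := by gcongr
        linarith
  refine (sum_le_sum h1).trans ?_
  rw [← one_mul (2 * (4 * _ * _))]
  refine sum_subsets_le s (fun a : ℕ => (m.choose a : ℝ) * Real.exp (-(1 / 120000 * L)) ^ a)
    zero_le_one (by positivity) hr (fun J hJ => by exact_mod_cast hs0 J hJ) ?_
  intro I hI
  have ha0 := hs0 I hI
  obtain ⟨-, hI1, -⟩ := mem_filter.1 hI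
  set a := #I with ha
  have h2 := choose_le_exp_mul_div_pow (n - 1) a
  have h3 := choose_le_exp_mul_div_pow m a
  rw [div_lt_iff₀ (by positivity)] at hI1
  rw [Fintype.card_fin, one_mul]
  calc ((n - 1).choose a : ℝ) * ((m.choose a : ℝ) * Real.exp (-(1 / 120000 * L)) ^ a)
      ≤ (Real.exp 1 * M / a) ^ a * ((Real.exp 1 * m / a) ^ a *
          Real.exp (-(1 / 120000 * L)) ^ a) := by gcongr
    _ = ((Real.exp 1 * M / a) * (Real.exp 1 * m / a) * Real.exp (-(1 / 120000 * L))) ^ a := by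
        rw [mul_pow, mul_pow, mul_assoc]
    -- The choices of I and of S: M/a ≤ L⁴, m/a ≤ 0.51 L⁵, and 0.51 e² < 4.
    _ ≤ (4 * L ^ 9 * Real.exp (-(1 / 120000 * L))) ^ a := by
        refine pow_le_pow_left₀ (by positivity)
          (mul_le_mul_of_nonneg_right ?_ (Real.exp_pos _).le) _
        have he1 : Real.exp 1 ≤ 2.7182818286 := Real.exp_one_lt_d9.le
        rw [div_mul_div_comm, div_le_iff₀ (by positivity)]
        have h5 : M ≤ a * L ^ 4 := by linarith
        have h6 : (m : ℝ) ≤ 51 / 100 * (a * L ^ 5) := by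
          refine hup.trans ?_
          have : (n : ℝ) * L ≤ a * L ^ 4 * L := by gcongr
          nlinarith
        calc Real.exp 1 * M * (Real.exp 1 * m)
            ≤ 2.7182818286 * (a * L ^ 4) * (2.7182818286 * (51 / 100 * (a * L ^ 5))) := by gcongr
          _ = (2.7182818286 * 2.7182818286 * (51 / 100)) * L ^ 9 * (a * a) := by ring
          _ ≤ 4 * L ^ 9 * (a * a) := by gcongr; norm_num

end ColourUnion

/-! ### Asymptotics of the binomial moments -/

section Asymptotics

theorem tendsto_log_pow_div_atTop (b : ℝ) (j : ℕ) :
    Tendsto (fun n : ℕ => Real.log n ^ j / ((n : ℝ) + b)) atTop (𝓝 0) := by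
  have := (Real.tendsto_pow_log_div_mul_add_atTop 1 b j one_ne_zero).comp
    tendsto_natCast_atTop_atTop
  simpa [Function.comp_def] using this

variable {m : ℕ → ℕ} {c : ℝ}

theorem tendsto_edges_div_sub_log (hm : ∀ᶠ n : ℕ in atTop,
      |(m n : ℝ) - (n : ℝ) / 2 * (Real.log n + c)| < 1) :
    Tendsto (fun n : ℕ => (m n : ℝ) / n - Real.log n / 2) atTop (𝓝 (c / 2)) := by
  rw [tendsto_iff_norm_sub_tendsto_zero]
  refine squeeze_zero' (Eventually.of_forall fun _ => norm_nonneg _) ?_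
    (tendsto_one_div_atTop_nhds_zero_nat (𝕜 := ℝ))
  filter_upwards [hm, eventually_gt_atTop 0] with n hn hn0
  have hn0 : (0 : ℝ) < n := by exact_mod_cast hn0
  have : (m n : ℝ) / n - Real.log n / 2 - c / 2 =
      ((m n : ℝ) - (n : ℝ) / 2 * (Real.log n + c)) / n := by
    field_simp
    ring
  rw [this, Real.norm_eq_abs, abs_div, abs_of_pos hn0]
  gcongr

theorem tendsto_edges_mul_log_div_sq
    (hm : Tendsto (fun n : ℕ => (m n : ℝ) / n - Real.log n / 2) atTop (𝓝 (c / 2))) (j : ℕ) :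
    Tendsto (fun n : ℕ => (m n : ℝ) * Real.log n ^ j / (n : ℝ) ^ 2) atTop (𝓝 0) := by
  have h1 := tendsto_log_pow_div_atTop 0 j
  have h2 := tendsto_log_pow_div_atTop 0 (j + 1)
  have h3 := (hm.mul h1).add (h2.mul_const (1 / 2))
  simp only [mul_zero, zero_mul, add_zero] at h3
  refine h3.congr' ?_
  filter_upwards [eventually_gt_atTop 0] with n hn0
  have hn0 : (0 : ℝ) < n := by exact_mod_cast hn0
  field_simp
  ring

/-- If `x n` is close enough to `2 r / n`, then `(1 - x n) ^ m n` behaves like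
`(exp (-c) / n) ^ r`. -/
theorem tendsto_pow_mul_one_sub_pow {x : ℕ → ℝ} {r : ℕ}
    (hm : Tendsto (fun n : ℕ => (m n : ℝ) / n - Real.log n / 2) atTop (𝓝 (c / 2)))
    (hx : Tendsto (fun n : ℕ => (n * x n - 2 * r) * Real.log n) atTop (𝓝 0)) :
    Tendsto x atTop (𝓝 0) ∧
    Tendsto (fun n : ℕ => (n : ℝ) ^ r * (1 - x n) ^ m n) atTop (𝓝 (Real.exp (-c) ^ r)) := by
  have hlog : Tendsto (fun n : ℕ => Real.log n) atTop atTop :=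
    Real.tendsto_log_atTop.comp tendsto_natCast_atTop_atTop
  have hpos : ∀ᶠ n : ℕ in atTop, (0 : ℝ) < n := by
    filter_upwards [eventually_gt_atTop 0] with n hn
    exact_mod_cast hn
  have hnx : Tendsto (fun n : ℕ => (n : ℝ) * x n) atTop (𝓝 (2 * r)) := by
    have h := (hx.div_atTop hlog).add_const (2 * r : ℝ)
    rw [zero_add] at h
    refine h.congr' ?_
    filter_upwards [hlog.eventually_gt_atTop 0] with n hn
    rw [mul_div_cancel_right₀ _ hn.ne']
    ring
  have hx0 : Tendsto x atTop (𝓝 0) := by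
    refine (hnx.div_atTop tendsto_natCast_atTop_atTop).congr' ?_
    filter_upwards [hpos] with n hn
    rw [mul_div_cancel_left₀ _ hn.ne']
  -- The expression is minus (m/n - log n/2) · nx + (nx - 2r) · log n/2. This is why nx must be
  -- known up to o(1/log n).
  have h1 : Tendsto (fun n : ℕ => r * Real.log n - m n * x n) atTop (𝓝 (-(r * c))) := by
    have h := ((hm.mul hnx).add (hx.mul_const (1 / 2))).neg
    have e : -(c / 2 * (2 * (r : ℝ)) + 0 * (1 / 2)) = -(r * c) := by ring
    rw [e] at h
    refine h.congr' ?_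
    filter_upwards [hpos] with n hn
    field_simp
    ring
  have h2 : Tendsto (fun n : ℕ => m n * x n ^ 2 * (1 - x n)⁻¹) atTop (𝓝 0) := by
    have h := ((tendsto_edges_mul_log_div_sq hm 0).mul (hnx.pow 2)).mul
      ((tendsto_const_nhds (x := (1 : ℝ))).sub hx0 |>.inv₀ (by norm_num))
    simp only [zero_mul, pow_zero, mul_one] at h
    refine h.congr' ?_
    filter_upwards [hpos] with n hn
    congr 1
    field_simp
  -- log(1 - x) lies between -x - x²/(1 - x) and -x, and m x² tends to 0.
  have h3 : Tendsto (fun n : ℕ => r * Real.log n + m n * Real.log (1 - x n)) atTop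
      (𝓝 (-(r * c))) := by
    have h4 := h1.sub h2
    rw [sub_zero] at h4
    have hlt : ∀ᶠ n in atTop, x n < 1 := hx0.eventually_lt_const one_pos
    refine tendsto_of_tendsto_of_tendsto_of_le_of_le' h4 h1 ?_ ?_
    · filter_upwards [hlt] with n hn
      have hn' : 0 < 1 - x n := by linarith
      have h5 := mul_le_mul_of_nonneg_left (Real.one_sub_inv_le_log_of_pos hn') (m n).cast_nonneg
      have h6 : (m n : ℝ) * (1 - (1 - x n)⁻¹) = -(m n * x n) - m n * x n ^ 2 * (1 - x n)⁻¹ := by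
        field_simp
        ring
      linarith
    · filter_upwards [hlt] with n hn
      have hn' : 0 < 1 - x n := by linarith
      have h5 := mul_le_mul_of_nonneg_left (Real.log_le_sub_one_of_pos hn') (m n).cast_nonneg
      linarith
  refine ⟨hx0, ?_⟩
  have h4 := (Real.continuous_exp.tendsto _).comp h3
  rw [← Real.exp_nat_mul, mul_neg]
  refine h4.congr' ?_
  filter_upwards [hpos, hx0.eventually_lt_const one_pos] with n hn hxn
  have hn' : 0 < 1 - x n := by linarith
  rw [Function.comp_apply, Real.exp_add, Real.exp_nat_mul, Real.exp_nat_mul, Real.exp_log hn,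
    Real.exp_log hn']

theorem mul_one_sub_choose_two_div {M r : ℕ} (hr : r ≤ M) (hM : 2 ≤ M) :
    (M : ℝ) * (1 - ((M - r).choose 2 : ℝ) / (M.choose 2 : ℝ)) - 2 * r =
      r * (1 - r) / ((M : ℝ) - 1) := by
  have hM' : (2 : ℝ) ≤ M := by exact_mod_cast hM
  have h1 : (M : ℝ) - 1 ≠ 0 := by linarith
  have h2 : (M : ℝ) ≠ 0 := by linarith
  rw [Nat.cast_choose_two, Nat.cast_choose_two, Nat.cast_sub hr]
  field_simp
  ring

theorem tendsto_mul_one_sub_choose_two_div (r : ℕ) :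
    Tendsto (fun n : ℕ => (n * (1 - ((n - r).choose 2 : ℝ) / (n.choose 2 : ℝ)) - 2 * r) *
      Real.log n) atTop (𝓝 0) := by
  have h := (tendsto_log_pow_div_atTop (-1) 1).const_mul (r * (1 - r) : ℝ)
  rw [mul_zero] at h
  refine h.congr' ?_
  filter_upwards [eventually_ge_atTop r, eventually_ge_atTop 2] with n h1 h2
  rw [mul_one_sub_choose_two_div h1 h2]
  ring

/-- The version for n - 1 colours; replacing n - 1 by n in the first factor changes it by O(1/n),
negligible even after multiplication by log n. -/
theorem tendsto_mul_one_sub_pred_choose_two_div (r : ℕ) :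
    Tendsto (fun n : ℕ => (n * (1 - ((n - 1 - r).choose 2 : ℝ) / ((n - 1).choose 2 : ℝ)) - 2 * r) *
      Real.log n) atTop (𝓝 0) := by
  have hinv : Tendsto (fun n : ℕ => 1 / ((n : ℝ) + -2)) atTop (𝓝 0) := by
    simpa using tendsto_log_pow_div_atTop (-2) 0
  have h := ((tendsto_log_pow_div_atTop (-2) 1).const_mul (r * (1 - r) : ℝ)).add
    (((hinv.const_mul (r * (1 - r) : ℝ)).const_add (2 * r : ℝ)).mul
      (tendsto_log_pow_div_atTop (-1) 1))
  rw [mul_zero, mul_zero, zero_add] at h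
  refine h.congr' ?_
  filter_upwards [eventually_ge_atTop (r + 1), eventually_ge_atTop 3] with n h1 h2
  have h3 := mul_one_sub_choose_two_div (M := n - 1) (r := r) (by omega) (by omega)
  set y : ℝ := 1 - ((n - 1 - r).choose 2 : ℝ) / ((n - 1).choose 2 : ℝ) with hy
  have hn : (3 : ℝ) ≤ n := by exact_mod_cast h2
  rw [Nat.cast_sub (by omega), Nat.cast_one] at h3
  have h4 : (n : ℝ) + -1 ≠ 0 := by linarith
  have h5 : (n : ℝ) + -2 ≠ 0 := by linarith
  have h6 : (n : ℝ) - 1 - 1 = n + -2 := by ring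
  rw [h6] at h3
  have h7 : y = (2 * r + r * (1 - r) * (1 / ((n : ℝ) + -2))) / ((n : ℝ) + -1) := by
    rw [eq_div_iff h4, mul_one_div]
    linarith
  have h8 : (n : ℝ) * y - 2 * r = r * (1 - r) / (n + -2) + y := by linarith
  rw [h8, h7]
  ring

/-- The lower bound `le_choose_div_choose` shifts numerator and denominator by m. Since m = o(n²/log
n), the expansion is unaffected to the required order. -/
theorem tendsto_mul_one_sub_shifted_choose_two_div (r : ℕ)
    (hm : Tendsto (fun n : ℕ => (m n : ℝ) / n - Real.log n / 2) atTop (𝓝 (c / 2))) :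
    (∀ᶠ n in atTop, m n < n.choose 2) ∧
    Tendsto (fun n : ℕ => (n * (1 - (((n - r).choose 2 : ℝ) - m n) / ((n.choose 2 : ℝ) - m n)) -
      2 * r) * Real.log n) atTop (𝓝 0) := by
  have hN : Tendsto (fun n : ℕ => ((n.choose 2 : ℝ) - m n) / (n : ℝ) ^ 2) atTop (𝓝 (1 / 2)) := by
    have h := (((tendsto_one_div_atTop_nhds_zero_nat (𝕜 := ℝ)).const_sub 1).mul_const
      (1 / 2 : ℝ)).sub (tendsto_edges_mul_log_div_sq hm 0)
    have e : (1 - 0) * (1 / 2 : ℝ) - 0 = 1 / 2 := by norm_num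
    rw [e] at h
    refine h.congr' ?_
    filter_upwards [eventually_gt_atTop 0] with n hn
    have hn : (0 : ℝ) < n := by exact_mod_cast hn
    rw [Nat.cast_choose_two]
    field_simp
  have hlt : ∀ᶠ n in atTop, m n < n.choose 2 := by
    filter_upwards [hN.eventually_const_lt (u := 0) (by norm_num), eventually_gt_atTop 0]
      with n h1 hn
    have hn : (0 : ℝ) < n := by exact_mod_cast hn
    have h2 := (div_pos_iff_of_pos_right (by positivity)).1 h1
    have : (m n : ℝ) < n.choose 2 := by linarith
    exact_mod_cast this
  refine ⟨hlt, ?_⟩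
  have hρ : Tendsto (fun n : ℕ => (m n : ℝ) / ((n.choose 2 : ℝ) - m n) * Real.log n) atTop
      (𝓝 0) := by
    have h := (tendsto_edges_mul_log_div_sq hm 1).div hN (by norm_num)
    rw [zero_div] at h
    refine h.congr' ?_
    filter_upwards [eventually_gt_atTop 0] with n hn
    have hn : (0 : ℝ) < n := by exact_mod_cast hn
    simp only [Pi.div_apply]
    rw [div_div_div_cancel_right₀ (by positivity)]
    ring
  have hρ0 : Tendsto (fun n : ℕ => (m n : ℝ) / ((n.choose 2 : ℝ) - m n)) atTop (𝓝 0) := by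
    have h := (tendsto_edges_mul_log_div_sq hm 0).div hN (by norm_num)
    rw [zero_div] at h
    refine h.congr' ?_
    filter_upwards [eventually_gt_atTop 0] with n hn
    have hn : (0 : ℝ) < n := by exact_mod_cast hn
    simp only [Pi.div_apply]
    rw [div_div_div_cancel_right₀ (by positivity)]
    ring
  have h := ((tendsto_mul_one_sub_choose_two_div r).mul (hρ0.const_add 1)).add
    (hρ.const_mul (2 * r : ℝ))
  rw [zero_mul, mul_zero, add_zero] at h
  refine h.congr' ?_
  filter_upwards [hlt] with n hn
  have hn' : (m n : ℝ) < n.choose 2 := by exact_mod_cast hn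
  have h1 : (n.choose 2 : ℝ) ≠ 0 := by
    have : (0 : ℝ) ≤ m n := Nat.cast_nonneg _
    linarith
  have h2 : (n.choose 2 : ℝ) - m n ≠ 0 := by linarith
  field_simp
  ring

theorem tendsto_choose_mul_of_tendsto {f : ℕ → ℝ} {r : ℕ} {l : ℝ}
    (h : Tendsto (fun n : ℕ => (n : ℝ) ^ r * f n) atTop (𝓝 l)) :
    Tendsto (fun n : ℕ => (n.choose r : ℝ) * f n) atTop (𝓝 (l / (Nat.factorial r : ℝ))) := by
  have h1 : Tendsto (fun n : ℕ => (n : ℝ) * (1 / n)) atTop (𝓝 1) :=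
    tendsto_const_nhds.congr' <| by
      filter_upwards [eventually_ne_atTop 0] with n hn
      rw [mul_one_div_cancel (by exact_mod_cast hn)]
  have h2 := (ProbabilityTheory.tendsto_choose_mul_pow_atTop r h1).mul h
  rw [one_pow, one_div_mul_eq_div] at h2
  refine h2.congr' ?_
  filter_upwards [eventually_ne_atTop 0] with n hn
  have hn : (n : ℝ) ≠ 0 := by exact_mod_cast hn
  rw [one_div, inv_pow, mul_assoc, inv_mul_cancel_left₀ (by positivity)]

theorem tendsto_pred_choose_mul_of_tendsto {f : ℕ → ℝ} {r : ℕ} {l : ℝ}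
    (h : Tendsto (fun n : ℕ => (n : ℝ) ^ r * f n) atTop (𝓝 l)) :
    Tendsto (fun n : ℕ => ((n - 1).choose r : ℝ) * f n) atTop
      (𝓝 (l / (Nat.factorial r : ℝ))) := by
  have h1 : Tendsto (fun n : ℕ => (n : ℝ) * (1 / ((n : ℝ) + 1))) atTop (𝓝 1) := by
    simpa [div_eq_mul_inv] using tendsto_natCast_div_add_atTop (1 : ℝ)
  have h2 := ((ProbabilityTheory.tendsto_choose_mul_pow_atTop r h1).comp
    (tendsto_sub_atTop_nat 1)).mul h
  rw [one_pow, one_div_mul_eq_div] at h2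
  refine h2.congr' ?_
  filter_upwards [eventually_ge_atTop 1] with n hn
  have hn' : (n : ℝ) ≠ 0 := by
    have : n ≠ 0 := by omega
    exact_mod_cast this
  simp only [Function.comp_apply]
  rw [Nat.cast_sub hn, Nat.cast_one, sub_add_cancel, one_div, inv_pow, mul_assoc,
    inv_mul_cancel_left₀ (by positivity)]

end Asymptotics

/-! ### Isolated vertices and unused colours -/

section Coverage
open Finset

variable {n k : ℕ}

/-- The expected number of `r`-sets of isolated vertices. -/
theorem binomialMoment_isolated (n m r : ℕ) :
    binomialMoment (powersetCard m (edgePairs n)) (fun (v : Fin n) E => ¬ ∃ e ∈ E, v ∈ e) r =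
      n.choose r * (((n - r).choose 2).choose m / (n.choose 2).choose m : ℝ) := by
  classical
  have h : ∀ R ∈ powersetCard r (univ : Finset (Fin n)),
      prob (powersetCard m (edgePairs n)) (fun E => ∀ v ∈ R, ¬ ∃ e ∈ E, v ∈ e) =
        (((n - r).choose 2).choose m / (n.choose 2).choose m : ℝ) := by
    intro R hR
    have hR' : #Rᶜ = n - r := by
      rw [card_compl, (mem_powersetCard.1 hR).2, Fintype.card_fin]
    unfold prob
    rw [card_powersetCard, card_edgePairs, ← hR', ← card_edgesInside_edgePairs,
      ← card_powersetCard]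
    congr 3
    ext E
    simp only [mem_filter, mem_powersetCard, subset_iff, mem_edgesInside, mem_compl]
    constructor
    · rintro ⟨⟨h1, h2⟩, h3⟩
      exact ⟨fun e he => ⟨h1 he, fun v hv hvR => h3 v hvR ⟨e, he, hv⟩⟩, h2⟩
    · rintro ⟨h1, h2⟩
      exact ⟨⟨fun e he => (h1 he).1, h2⟩, fun v hv ⟨e, he, hve⟩ => (h1 he).2 v hve hv⟩
  unfold binomialMoment
  rw [sum_congr rfl h, sum_const, nsmul_eq_mul, card_powersetCard, card_univ, Fintype.card_fin]

/-- The expected number of `r`-sets of colours that do not occur on `E`. -/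
theorem binomialMoment_unused {α : Type*} [Fintype α] {M : ℕ} (hk : k ≤ M) (E : Finset α) (r : ℕ) :
    binomialMoment (colourings α (Fin M) k) (fun (w : Fin M) χ => ¬ ∃ e ∈ E, w ∈ χ e) r =
      M.choose r * (((M - r).choose k / M.choose k : ℝ)) ^ #E := by
  classical
  have h : ∀ R ∈ powersetCard r (univ : Finset (Fin M)),
      prob (colourings α (Fin M) k) (fun χ => ∀ w ∈ R, ¬ ∃ e ∈ E, w ∈ χ e) =
        (((M - r).choose k / M.choose k : ℝ)) ^ #E := by
    intro R hR
    have hR' : #Rᶜ = M - r := by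
      rw [card_compl, (mem_powersetCard.1 hR).2, Fintype.card_fin]
    have h1 := prob_forall_colourings (α := α) (W := Fin M) (by simpa using hk) E
      (fun _ c => c ⊆ Rᶜ)
    rw [prob_colour_subset, prod_const, hR', Fintype.card_fin] at h1
    rw [← h1]
    refine prob_congr fun χ _ => ?_
    simp only [subset_iff, mem_compl]
    constructor
    · exact fun h e he w hw hwR => h w hwR ⟨e, he, hw⟩
    · exact fun h w hw ⟨e, he, hwe⟩ => h e he hwe hw
  unfold binomialMoment
  rw [sum_congr rfl h, sum_const, nsmul_eq_mul, card_powersetCard, card_univ, Fintype.card_fin]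

variable {m : ℕ → ℕ} {c : ℝ}

/-- The ratio of binomial coefficients in the r-th moment is squeezed between two m-th powers, both
asymptotic to (e^{-c}/n)^r. -/
theorem tendsto_prob_no_isolated
    (hm : Tendsto (fun n : ℕ => (m n : ℝ) / n - Real.log n / 2) atTop (𝓝 (c / 2))) :
    Tendsto (fun n => prob (powersetCard (m n) (edgePairs n)) fun E => ∀ v, ∃ e ∈ E, v ∈ e)
      atTop (𝓝 (Real.exp (-Real.exp (-c)))) := by
  have key := tendsto_prob_forall_not (Ω := fun n => Finset (Sym2 (Fin n))) (ι := fun n => Fin n)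
    (fun n => powersetCard (m n) (edgePairs n)) (fun n v E => ¬ ∃ e ∈ E, v ∈ e) (Real.exp (-c)) ?_
  · simpa only [not_not] using key
  intro r
  simp only [binomialMoment_isolated]
  obtain ⟨hlt, hB⟩ := tendsto_mul_one_sub_shifted_choose_two_div r hm
  obtain ⟨-, hA1⟩ := tendsto_pow_mul_one_sub_pow hm (tendsto_mul_one_sub_choose_two_div r)
  obtain ⟨hB0, hB1⟩ := tendsto_pow_mul_one_sub_pow hm hB
  refine tendsto_of_tendsto_of_tendsto_of_le_of_le' (tendsto_choose_mul_of_tendsto hB1)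
    (tendsto_choose_mul_of_tendsto hA1) ?_ ?_
  · filter_upwards [hlt, hB0.eventually_lt_const one_pos] with n h1 h2
    have h1' : (m n : ℝ) < n.choose 2 := by exact_mod_cast h1
    refine mul_le_mul_of_nonneg_left ?_ (Nat.cast_nonneg _)
    rw [sub_sub_cancel]
    refine le_choose_div_choose (Nat.choose_le_choose 2 (Nat.sub_le n r)) ?_ h1
    have h3 : 0 < (((n - r).choose 2 : ℝ) - m n) / ((n.choose 2 : ℝ) - m n) := by linarith
    have h4 := (div_pos_iff_of_pos_right (by linarith)).1 h3
    have h5 : (m n : ℝ) ≤ (n - r).choose 2 := by linarith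
    exact_mod_cast h5
  · filter_upwards with n
    refine mul_le_mul_of_nonneg_left ?_ (Nat.cast_nonneg _)
    rw [sub_sub_cancel]
    exact choose_div_choose_le (Nat.choose_le_choose 2 (Nat.sub_le n r)) _

/-- A pair of colours avoiding r colours is counted like a pair of vertices avoiding r vertices,
hence the same limit. Edges are coloured independently, so the moment is an exact power and only the
size of the edge set matters. -/
theorem tendsto_prob_all_colours_two
    (hm : Tendsto (fun n : ℕ => (m n : ℝ) / n - Real.log n / 2) atTop (𝓝 (c / 2)))
    {E : ∀ n, Finset (Sym2 (Fin n))} (hE : ∀ᶠ n in atTop, #(E n) = m n) :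
    Tendsto (fun n => prob (colourings (Sym2 (Fin n)) (Fin (n - 1)) 2)
      fun χ => ∀ w, ∃ e ∈ E n, w ∈ χ e) atTop (𝓝 (Real.exp (-Real.exp (-c)))) := by
  have key := tendsto_prob_forall_not (Ω := fun n => Sym2 (Fin n) → Finset (Fin (n - 1)))
    (ι := fun n => Fin (n - 1)) (fun n => colourings (Sym2 (Fin n)) (Fin (n - 1)) 2)
    (fun n w χ => ¬ ∃ e ∈ E n, w ∈ χ e) (Real.exp (-c)) ?_
  · simpa only [not_not] using key
  intro r
  obtain ⟨-, hA⟩ := tendsto_pow_mul_one_sub_pow hm (tendsto_mul_one_sub_pred_choose_two_div r)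
  refine (tendsto_pred_choose_mul_of_tendsto hA).congr' ?_
  filter_upwards [hE, eventually_ge_atTop 3] with n h1 h2
  rw [binomialMoment_unused (by omega), h1, sub_sub_cancel]

/-- First moment: with three colours per edge the expected number of unused colours is at most n
e^{-3m/n} ≤ n^{1 - 147/100}. -/
theorem IsDense.prob_not_all_colours_le {m : ℕ} (h : IsDense n m) (hk : 3 ≤ k) (hkn : k ≤ n - 1)
    {E : Finset (Sym2 (Fin n))} (hE : #E = m) :
    prob (colourings (Sym2 (Fin n)) (Fin (n - 1)) k) (fun χ => ¬ ∀ w, ∃ e ∈ E, w ∈ χ e) ≤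
      Real.exp (-(47 / 100 * Real.log n)) := by
  have h1 : prob (colourings (Sym2 (Fin n)) (Fin (n - 1)) k)
      (fun χ => ¬ ∀ w, ∃ e ∈ E, w ∈ χ e) ≤
        binomialMoment (colourings (Sym2 (Fin n)) (Fin (n - 1)) k)
          (fun (w : Fin (n - 1)) χ => ¬ ∃ e ∈ E, w ∈ χ e) 1 := by
    unfold binomialMoment
    rw [powersetCard_one, sum_map]
    simp only [Function.Embedding.coeFn_mk, mem_singleton, forall_eq]
    refine le_trans (prob_mono fun χ _ h => ?_) (prob_exists_le univ _)
    obtain ⟨w, hw⟩ := not_forall.1 h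
    exact ⟨w, mem_univ w, hw⟩
  refine h1.trans ?_
  rw [binomialMoment_unused hkn, Nat.choose_one_right, hE]
  have hn : (0 : ℝ) < n := h.pos
  have hM : 0 < n - 1 := by omega
  have hM0 : (0 : ℝ) < (n - 1 : ℕ) := by exact_mod_cast hM
  have hMn : ((n - 1 : ℕ) : ℝ) ≤ n := by exact_mod_cast Nat.sub_le n 1
  have h2 : (((n - 1 - 1).choose k : ℝ) / (n - 1).choose k) ≤ Real.exp (-(3 / n)) := by
    refine (choose_div_choose_le (Nat.sub_le _ 1) k).trans ?_
    have h3 : ((n - 1 - 1 : ℕ) : ℝ) / (n - 1 : ℕ) ≤ Real.exp (-(1 / n)) := by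
      have h4 : ((n - 1 - 1 : ℕ) : ℝ) / (n - 1 : ℕ) = -(1 / (n - 1 : ℕ)) + 1 := by
        rw [Nat.cast_sub hM]
        field_simp
        push_cast
        ring
      rw [h4]
      refine (Real.add_one_le_exp _).trans (Real.exp_le_exp.2 (neg_le_neg ?_))
      gcongr
    calc (((n - 1 - 1 : ℕ) : ℝ) / (n - 1 : ℕ)) ^ k ≤ (((n - 1 - 1 : ℕ) : ℝ) / (n - 1 : ℕ)) ^ 3 := by
          refine pow_le_pow_of_le_one (by positivity) ?_ hk
          exact div_le_one_of_le₀ (by exact_mod_cast Nat.sub_le _ 1) hM0.le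
      _ ≤ Real.exp (-(1 / n)) ^ 3 := by gcongr
      _ = Real.exp (-(3 / n)) := by
          rw [← Real.exp_nat_mul]
          congr 1
          push_cast
          ring
  calc ((n - 1 : ℕ) : ℝ) * (((n - 1 - 1).choose k : ℝ) / (n - 1).choose k) ^ m
      ≤ Real.exp (Real.log n) * Real.exp (-(3 / n)) ^ m := by
        rw [h.exp_log]
        gcongr
    _ = Real.exp (Real.log n - m * (3 / n)) := by
        rw [← Real.exp_nat_mul, ← Real.exp_add]
        congr 1
        ring
    _ ≤ _ := by
        refine Real.exp_le_exp.2 ?_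
        have h5 := h.lower
        have h6 : 49 / 100 * (n * Real.log n) * (3 / n) ≤ m * (3 / n) := by gcongr
        have h7 : 49 / 100 * (n * Real.log n) * (3 / n) = 147 / 100 * Real.log n := by
          field_simp
          ring
        linarith

end Coverage

/-! ### Reduction to isolated vertices and unused colours -/

section Comparison
open Finset

theorem prob_not {Ω : Type*} {s : Finset Ω} (hs : s.Nonempty) (P : Ω → Prop) :
    prob s (fun ω => ¬ P ω) = 1 - prob s P := by
  classical
  have h1 : (#s : ℝ) ≠ 0 := by exact_mod_cast hs.card_pos.ne'
  have h2 := card_filter_add_card_filter_not (s := s) P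
  unfold prob
  rw [eq_sub_iff_add_eq, ← add_div, div_eq_one_iff_eq h1, ← h2, Nat.cast_add, add_comm]
  congr!

/-- Only an inequality, because probabilities on an empty `t` are 0. -/
theorem prob_product_fst_le {Ω Ω' : Type*} (s : Finset Ω) (t : Finset Ω') (P : Ω → Prop) :
    prob (s ×ˢ t) (fun ω => P ω.1) ≤ prob s P := by
  classical
  rw [prob_product s t fun a _ => P a, prob_eq_sum s P]
  refine div_le_div_of_nonneg_right (sum_le_sum fun a _ => ?_) (Nat.cast_nonneg _)
  by_cases h : P a
  · simp only [h, if_true, prob, filter_true]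
    exact div_self_le_one _
  · simp [h, prob]

/-- Near-independence: the conditional probability of `Q` is almost the same constant for every `a`,
so it can be averaged over any event `P`. -/
theorem abs_prob_product_and_sub_le {Ω Ω' : Type*} {s : Finset Ω} {t : Finset Ω'} {P : Ω → Prop}
    {Q : Ω → Ω' → Prop} {p δ : ℝ} (hδ : 0 ≤ δ) (h : ∀ a ∈ s, |prob t (Q a) - p| ≤ δ) :
    |prob (s ×ˢ t) (fun ω => P ω.1 ∧ Q ω.1 ω.2) - prob s P * p| ≤ δ := by
  classical
  rw [prob_product s t fun a b => P a ∧ Q a b, prob_eq_sum s P, div_mul_eq_mul_div, ← sub_div,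
    sum_mul, ← sum_sub_distrib, abs_div, abs_of_nonneg (Nat.cast_nonneg (#s) : (0 : ℝ) ≤ _)]
  refine div_le_of_le_mul₀ (Nat.cast_nonneg _) hδ ?_
  refine (abs_sum_le_sum_abs _ _).trans ?_
  rw [mul_comm, ← nsmul_eq_mul, ← sum_const]
  refine sum_le_sum fun a ha => ?_
  by_cases hP : P a
  · simpa [hP] using h a ha
  · simpa [hP, prob] using hδ

/-- A limit along all sequences is uniform. -/
theorem exists_tendsto_zero_of_forall_tendsto {Ω : ℕ → Type*} [∀ n, Nonempty (Ω n)]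
    {s : ∀ n, Finset (Ω n)} {f : ∀ n, Ω n → ℝ} {p : ℝ} (hs : ∀ᶠ n in atTop, (s n).Nonempty)
    (h : ∀ E : ∀ n, Ω n, (∀ᶠ n in atTop, E n ∈ s n) →
      Tendsto (fun n => f n (E n)) atTop (𝓝 p)) :
    ∃ δ : ℕ → ℝ, Tendsto δ atTop (𝓝 0) ∧ ∀ᶠ n in atTop, ∀ a ∈ s n, |f n a - p| ≤ δ n := by
  have hmax : ∀ n, ∃ a : Ω n, (s n).Nonempty → a ∈ s n ∧ ∀ b ∈ s n, |f n b - p| ≤ |f n a - p| := by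
    intro n
    by_cases hn : (s n).Nonempty
    · obtain ⟨a, ha, hab⟩ := exists_max_image (s n) (fun a => |f n a - p|) hn
      exact ⟨a, fun _ => ⟨ha, hab⟩⟩
    · exact ⟨Classical.arbitrary _, fun h => absurd h hn⟩
  choose E hE using hmax
  refine ⟨fun n => |f n (E n) - p|, ?_, hs.mono fun n hn => (hE n hn).2⟩
  have h1 := h E (hs.mono fun n hn => (hE n hn).1)
  simpa using (h1.sub_const p).abs

variable {n m k : ℕ}

/-- The bound for the probability that a nice graph without isolated vertices, on which all colours
occur, has no rainbow spanning tree; here `L = log n`. -/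
noncomputable def colourError (k : ℕ) (L : ℝ) : ℝ :=
  4 * k ^ 2 * Real.exp (64 * k + 1) * (L ^ 5 * Real.exp (-(17 / 100 * L))) +
    (4 * k ^ 4 * Real.exp (64 * k + 1) * (L ^ 6 * Real.exp (-(17 / 100 * L))) +
    (2 * (4 * L ^ 9 * Real.exp (-(1 / 120000 * L))) +
    (2 * (Real.exp 1 * L ^ 4 * Real.exp (-(1 / 240 * L))) +
    (4 / L ^ 2 + 2 * (L * Real.exp (-(1 / 8 * L)))))))

theorem colourError_nonneg (k : ℕ) {L : ℝ} (hL : 0 ≤ L) : 0 ≤ colourError k L := by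
  unfold colourError
  positivity

/-- The ratios of the geometric series in the union bounds are at most `1 / 2`. -/
structure IsSmallRatios (L : ℝ) : Prop where
  inside : Real.exp 1 * L ^ 4 * Real.exp (-(3 / 8 * L)) ≤ 1 / 2
  low : L * Real.exp (-(1 / 8 * L)) ≤ 1 / 2
  many : Real.exp 1 * L ^ 4 * Real.exp (-(1 / 240 * L)) ≤ 1 / 2
  crossing : 4 * L ^ 9 * Real.exp (-(1 / 120000 * L)) ≤ 1 / 2

theorem IsDense.log_pow_five_le_sqrt (h : IsDense n m) : Real.log n ^ 5 ≤ √n := by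
  refine Real.le_sqrt_of_sq_le ?_
  rw [← pow_mul]
  exact h.log_pow_le

theorem IsDense.prob_not_hasRainbowSpanningTree_le (h : IsDense n m)
    (hr : IsSmallRatios (Real.log n)) (hk : 2 ≤ k) (hkn : k ≤ n - 1)
    {E : Finset (Sym2 (Fin n))} (hE : #E = m)
    (hnice : IsNice E (Real.log n / 20) (n / Real.log n ^ 4) (√n) (Real.log n ^ 2))
    (hiso : ∀ v, ∃ e ∈ E, v ∈ e) :
    prob (colourings (Sym2 (Fin n)) (Fin (n - 1)) k) (fun χ => (∀ w, ∃ e ∈ E, w ∈ χ e) ∧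
      ¬ HasRainbowSpanningTree (SimpleGraph.fromEdgeSet (E : Set (Sym2 (Fin n))))
        (fun e => χ e.1)) ≤ colourError k (Real.log n) := by
  have hn := h.pos
  have hL := h.log_pos
  have hL1 := h.log_ge
  have hs := h.log_pow_five_le_sqrt
  have hsq : √(n : ℝ) * √n = n := Real.mul_self_sqrt hn.le
  have hs0 : 0 < √(n : ℝ) := Real.sqrt_pos.2 hn
  have h1L : (1 : ℝ) ≤ Real.log n := by linarith
  have hlow := hnice.card_lowEdges_le (by positivity)
  have hsL : 6000 ≤ √(n : ℝ) := by
    refine le_trans ?_ hs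
    calc (6000 : ℝ) ≤ 1000 ^ 5 := by norm_num
      _ ≤ _ := by gcongr
  -- L⁵ ≤ √n makes u = n/L⁴ at least √n L; both n ≤ u² and 6√n ≤ u follow.
  have hu : √(n : ℝ) * Real.log n ≤ n / Real.log n ^ 4 := by
    rw [le_div_iff₀ (by positivity)]
    calc √(n : ℝ) * Real.log n * Real.log n ^ 4 = √n * Real.log n ^ 5 := by ring
      _ ≤ √n * √n := by gcongr
      _ = n := hsq
  have hsu : √(n : ℝ) ≤ n / Real.log n ^ 4 := le_trans (le_mul_of_one_le_right hs0.le h1L) hu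
  have hnm : n ≤ m := by
    have h1 : (n : ℝ) ≤ m := by
      refine le_trans ?_ h.lower
      have : (n : ℝ) * 1000 ≤ n * Real.log n := by gcongr
      linarith
    exact_mod_cast h1
  unfold colourError
  refine le_trans ?_ (add_le_add (h.prob_rareColoursClose_le hk hkn hE hnice.card_edgesAt_le)
    (add_le_add (h.prob_rareColoursLinked_le hk hkn hE hnice.card_edgesAt_le)
    (add_le_add (h.prob_crossing_le hk hkn hE hnice (by nlinarith) hr.crossing)
    (add_le_add (h.prob_many_edges_le hk hkn hE hr.many)
    (add_le_add (h.prob_two_mul_le hk hkn hE) (h.prob_lowEdges_le hk hkn hlow hr.low))))))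
  refine le_trans ?_ (add_le_add le_rfl (add_le_add le_rfl (add_le_add le_rfl
    (add_le_add le_rfl (prob_or_le _ _)))))
  refine le_trans ?_ (add_le_add le_rfl (add_le_add le_rfl (add_le_add le_rfl (prob_or_le _ _))))
  refine le_trans ?_ (add_le_add le_rfl (add_le_add le_rfl (prob_or_le _ _)))
  refine le_trans ?_ (add_le_add le_rfl (prob_or_le _ _))
  refine le_trans ?_ (prob_or_le _ _)
  refine prob_mono fun χ hχ hcov => ?_
  refine hnice.cases_of_not_hasRainbowSpanningTree (by linarith) hk (by positivity) ?_ ?_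
    (by exact_mod_cast hn) (by omega) (mem_colourings.1 hχ) hiso hcov.1 hcov.2
  · calc (n : ℝ) = √n * √n := hsq.symm
      _ ≤ _ := by gcongr
  · refine le_trans ?_ hu
    rw [mul_comm]
    gcongr
    linarith

/-- Up to a small error, the only obstructions to a rainbow spanning tree are isolated vertices and
unused colours. -/
theorem IsDense.prob_covered_sub_le_rainbowProb (h : IsDense n m)
    (hr : IsSmallRatios (Real.log n)) (hk : 2 ≤ k) (hkn : k ≤ n - 1) :
    prob (powersetCard m (edgePairs n) ×ˢ colourings (Sym2 (Fin n)) (Fin (n - 1)) k)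
        (fun ω => (∀ v, ∃ e ∈ ω.1, v ∈ e) ∧ ∀ w, ∃ e ∈ ω.1, w ∈ ω.2 e) -
      (niceError (Real.log n) + colourError k (Real.log n)) ≤ rainbowProb n m k ∧
    rainbowProb n m k ≤
      prob (powersetCard m (edgePairs n) ×ˢ colourings (Sym2 (Fin n)) (Fin (n - 1)) k)
        (fun ω => (∀ v, ∃ e ∈ ω.1, v ∈ e) ∧ ∀ w, ∃ e ∈ ω.1, w ∈ ω.2 e) := by
  rw [rainbowProb_eq_prob hkn]
  have hn2 : 2 ≤ n := by omega
  refine ⟨?_, prob_mono fun ω _ hω => hω.exists_mem hn2⟩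
  have h1 := (prob_product_fst_le (powersetCard m (edgePairs n))
    (colourings (Sym2 (Fin n)) (Fin (n - 1)) k) _).trans (h.prob_not_isNice_le hr.inside)
  have hpos := colourError_nonneg k h.log_pos.le
  have h2 := prob_product_le (s := powersetCard m (edgePairs n))
    (t := colourings (Sym2 (Fin n)) (Fin (n - 1)) k)
    (P := fun (E : Finset (Sym2 (Fin n))) (χ : Sym2 (Fin n) → Finset (Fin (n - 1))) =>
      (IsNice E (Real.log n / 20) (n / Real.log n ^ 4) (√n) (Real.log n ^ 2) ∧
        ∀ v, ∃ e ∈ E, v ∈ e) ∧ (∀ w, ∃ e ∈ E, w ∈ χ e) ∧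
        ¬ HasRainbowSpanningTree (SimpleGraph.fromEdgeSet (E : Set (Sym2 (Fin n))))
          (fun e => χ e.1)) hpos (by
    intro E hE
    by_cases hc : IsNice E (Real.log n / 20) (n / Real.log n ^ 4) (√n) (Real.log n ^ 2) ∧
        ∀ v, ∃ e ∈ E, v ∈ e
    · exact (prob_mono fun χ _ hχ => hχ.2).trans
        (h.prob_not_hasRainbowSpanningTree_le hr hk hkn (mem_powersetCard.1 hE).2 hc.1 hc.2)
    · rw [prob_eq_zero fun χ _ h => hc h.1]
      exact hpos)
  -- A covered outcome has a rainbow tree, or a graph that is not nice, or a bad colouring of a nice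
  -- graph without isolated vertices.
  rw [sub_le_iff_le_add]
  refine le_trans ?_ (add_le_add le_rfl (add_le_add h1 h2))
  refine le_trans ?_ (add_le_add le_rfl (prob_or_le _ _))
  refine le_trans ?_ (prob_or_le _ _)
  refine prob_mono fun ω _ hω => ?_
  tauto

end Comparison

/-! ### The error terms vanish -/

section Limit
open Finset

theorem tendsto_pow_mul_exp_neg_mul (j : ℕ) {b : ℝ} (hb : 0 < b) :
    Tendsto (fun L : ℝ => L ^ j * Real.exp (-(b * L))) atTop (𝓝 0) := by
  simpa [neg_mul] using tendsto_rpow_mul_exp_neg_mul_atTop_nhds_zero (j : ℝ) b hb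

theorem tendsto_const_div_sq (a : ℝ) : Tendsto (fun L : ℝ => a / L ^ 2) atTop (𝓝 0) :=
  tendsto_const_nhds.div_atTop (tendsto_pow_atTop (by norm_num))

theorem tendsto_niceError : Tendsto niceError atTop (𝓝 0) := by
  have h1 := (tendsto_pow_mul_exp_neg_mul 1 (b := 3 / 10) (by norm_num)).const_mul
    (2 * Real.exp 5)
  have h2 := (tendsto_pow_mul_exp_neg_mul 2 (b := 3 / 10) (by norm_num)).const_mul
    (4 * Real.exp 5)
  have h3 := tendsto_const_div_sq 24
  have h4 := (tendsto_pow_mul_exp_neg_mul 4 (b := 3 / 8) (by norm_num)).const_mul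
    (Real.exp 32 * (2 * Real.exp 1))
  have h5 := (tendsto_pow_mul_exp_neg_mul 0 (b := 3 / 20) (by norm_num)).const_mul (Real.exp 1)
  have h6 := tendsto_pow_mul_exp_neg_mul 0 (b := 1) one_pos
  have h := ((((h1.add h2).add h3).add h4).add h5).add h6
  simp only [mul_zero, add_zero] at h
  refine h.congr fun L => ?_
  unfold niceError
  simp only [sub_eq_add_neg, Real.exp_add]
  ring_nf

theorem tendsto_colourError (k : ℕ) : Tendsto (colourError k) atTop (𝓝 0) := by
  have h1 := (tendsto_pow_mul_exp_neg_mul 5 (b := 17 / 100) (by norm_num)).const_mul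
    (4 * k ^ 2 * Real.exp (64 * k + 1))
  have h2 := (tendsto_pow_mul_exp_neg_mul 6 (b := 17 / 100) (by norm_num)).const_mul
    (4 * k ^ 4 * Real.exp (64 * k + 1))
  have h3 := (tendsto_pow_mul_exp_neg_mul 9 (b := 1 / 120000) (by norm_num)).const_mul 8
  have h4 := (tendsto_pow_mul_exp_neg_mul 4 (b := 1 / 240) (by norm_num)).const_mul
    (2 * Real.exp 1)
  have h5 := tendsto_const_div_sq 4
  have h6 := (tendsto_pow_mul_exp_neg_mul 1 (b := 1 / 8) (by norm_num)).const_mul 2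
  have h := h1.add (h2.add (h3.add (h4.add (h5.add h6))))
  simp only [mul_zero, add_zero] at h
  refine h.congr fun L => ?_
  unfold colourError
  ring

theorem eventually_isSmallRatios : ∀ᶠ L in atTop, IsSmallRatios L := by
  have h1 := (tendsto_pow_mul_exp_neg_mul 4 (b := 3 / 8) (by norm_num)).const_mul (Real.exp 1)
  have h2 := tendsto_pow_mul_exp_neg_mul 1 (b := 1 / 8) (by norm_num)
  have h3 := (tendsto_pow_mul_exp_neg_mul 4 (b := 1 / 240) (by norm_num)).const_mul (Real.exp 1)
  have h4 := (tendsto_pow_mul_exp_neg_mul 9 (b := 1 / 120000) (by norm_num)).const_mul 4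
  rw [mul_zero] at h1 h3 h4
  have hhalf : (0 : ℝ) < 1 / 2 := by norm_num
  filter_upwards [h1.eventually_le_const hhalf, h2.eventually_le_const hhalf,
    h3.eventually_le_const hhalf, h4.eventually_le_const hhalf] with L l1 l2 l3 l4
  refine ⟨?_, ?_, ?_, ?_⟩
  · rwa [mul_assoc]
  · rwa [pow_one] at l2
  · rwa [mul_assoc]
  · rwa [mul_assoc]

theorem tendsto_log_natCast_atTop : Tendsto (fun n : ℕ => Real.log n) atTop atTop :=
  Real.tendsto_log_atTop.comp tendsto_natCast_atTop_atTop

variable {m : ℕ → ℕ} {c : ℝ}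

theorem eventually_isDense
    (hm : Tendsto (fun n : ℕ => (m n : ℝ) / n - Real.log n / 2) atTop (𝓝 (c / 2))) :
    ∀ᶠ n in atTop, IsDense n (m n) := by
  filter_upwards [tendsto_log_natCast_atTop.eventually_ge_atTop 1000,
    tendsto_log_natCast_atTop.eventually_ge_atTop (100 * (c / 2 + 1)),
    tendsto_log_natCast_atTop.eventually_ge_atTop (-(100 * (c / 2 - 1))),
    hm.eventually_lt_const (lt_add_one _), hm.eventually_const_lt (sub_one_lt _),
    (tendsto_log_pow_div_atTop 0 10).eventually_lt_const one_pos,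
    eventually_gt_atTop 0] with n h1 h2 h3 h4 h5 h6 h7
  have hn : (0 : ℝ) < n := by exact_mod_cast h7
  have e : (m n : ℝ) = m n / n * n := by field_simp
  refine ⟨?_, ?_, h1, ?_⟩
  · have : 49 / 100 * Real.log n ≤ m n / n := by linarith
    rw [e]
    nlinarith
  · have : (m n : ℝ) / n ≤ 51 / 100 * Real.log n := by linarith
    rw [e]
    nlinarith
  · rw [add_zero, div_lt_one hn] at h6
    exact h6.le

/-- All colours occur with asymptotically the same probability, whatever the edges. -/
theorem exists_bound_prob_all_colours {k : ℕ} (hk : 2 ≤ k)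
    (hm : Tendsto (fun n : ℕ => (m n : ℝ) / n - Real.log n / 2) atTop (𝓝 (c / 2))) :
    ∃ δ : ℕ → ℝ, Tendsto δ atTop (𝓝 0) ∧ ∀ᶠ n in atTop, ∀ E ∈ powersetCard (m n) (edgePairs n),
      |prob (colourings (Sym2 (Fin n)) (Fin (n - 1)) k) (fun χ => ∀ w, ∃ e ∈ E, w ∈ χ e) -
        if k = 2 then Real.exp (-Real.exp (-c)) else 1| ≤ δ n := by
  have hdense := eventually_isDense hm
  split_ifs with h2
  · subst h2
    refine exists_tendsto_zero_of_forall_tendsto (Ω := fun n => Finset (Sym2 (Fin n))) ?_ ?_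
    · filter_upwards [hdense] with n hn
      exact powersetCard_nonempty.2 (by have := hn.eight_mul_le; omega)
    · exact fun E hE => tendsto_prob_all_colours_two hm
        (hE.mono fun n hn => (mem_powersetCard.1 hn).2)
  · refine ⟨fun n => Real.exp (-(47 / 100 * Real.log n)), ?_, ?_⟩
    · have h := (tendsto_pow_mul_exp_neg_mul 0 (b := 47 / 100) (by norm_num)).comp
        tendsto_log_natCast_atTop
      simpa [Function.comp_def] using h
    · filter_upwards [hdense, eventually_ge_atTop (k + 1)] with n hn hkn E hE
      have h1 := hn.prob_not_all_colours_le (k := k) (by omega) (by omega)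
        (mem_powersetCard.1 hE).2
      have hne : (colourings (Sym2 (Fin n)) (Fin (n - 1)) k).Nonempty := by
        rw [← card_pos, card_colourings, Fintype.card_fin]
        exact pow_pos (Nat.choose_pos (by omega)) _
      have h0 := prob_nonneg (colourings (Sym2 (Fin n)) (Fin (n - 1)) k)
        (fun χ => ¬ ∀ w, ∃ e ∈ E, w ∈ χ e)
      rw [prob_not hne] at h0 h1
      rw [abs_sub_comm, abs_of_nonneg h0]
      exact h1

end Limit

/-! ### The limit theorem -/

theorem corollary1p2 (k : ℕ) (hk : 2 ≤ k) (c : ℝ) (m : ℕ → ℕ)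
    (hm : ∀ᶠ n : ℕ in atTop, |(m n : ℝ) - (n : ℝ) / 2 * (Real.log n + c)| < 1) :
    Tendsto (fun n : ℕ => rainbowProb n (m n) k) atTop
      (𝓝 (if k = 2 then Real.exp (-2 * Real.exp (-c)) else Real.exp (-Real.exp (-c)))) := by
  have hm' := tendsto_edges_div_sub_log hm
  obtain ⟨δ, hδ, hbound⟩ := exists_bound_prob_all_colours hk hm'
  have hiso := tendsto_prob_no_isolated hm'
  -- For k = 2 isolated vertices and unused colours each contribute exp(-e^{-c}); for k ≥ 3 the
  -- second factor is 1.
  have hlim : (if k = 2 then Real.exp (-2 * Real.exp (-c)) else Real.exp (-Real.exp (-c))) =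
      Real.exp (-Real.exp (-c)) * if k = 2 then Real.exp (-Real.exp (-c)) else 1 := by
    split_ifs
    · rw [← Real.exp_add]
      congr 1
      ring
    · rw [mul_one]
  set p : ℝ := if k = 2 then Real.exp (-Real.exp (-c)) else 1 with hp
  have hprod := hiso.mul_const p
  have herr : Tendsto (fun n : ℕ => niceError (Real.log n) + colourError k (Real.log n)) atTop
      (𝓝 0) := by
    have h := (tendsto_niceError.add (tendsto_colourError k)).comp tendsto_log_natCast_atTop
    rwa [add_zero] at h
  have hlow := (hprod.sub hδ.abs).sub herr
  have hup := hprod.add hδ.abs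
  rw [abs_zero, sub_zero, sub_zero] at hlow
  rw [abs_zero, add_zero] at hup
  rw [hlim]
  have hall : ∀ᶠ n in atTop, IsDense n (m n) ∧ IsSmallRatios (Real.log n) ∧ k ≤ n - 1 := by
    filter_upwards [eventually_isDense hm',
      tendsto_log_natCast_atTop.eventually eventually_isSmallRatios,
      eventually_ge_atTop (k + 1)] with n h1 h2 h3
    exact ⟨h1, h2, by omega⟩
  refine tendsto_of_tendsto_of_tendsto_of_le_of_le' hlow hup ?_ ?_
  · filter_upwards [hall, hbound] with n ⟨h1, h2, h3⟩ h4
    have h5 := (h1.prob_covered_sub_le_rainbowProb h2 hk h3).1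
    have h6 := abs_prob_product_and_sub_le (P := fun E => ∀ v, ∃ e ∈ E, v ∈ e) (abs_nonneg (δ n))
      fun E hE => (h4 E hE).trans (le_abs_self _)
    linarith [(abs_le.1 h6).1]
  · filter_upwards [hall, hbound] with n ⟨h1, h2, h3⟩ h4
    have h5 := (h1.prob_covered_sub_le_rainbowProb h2 hk h3).2
    have h6 := abs_prob_product_and_sub_le (P := fun E => ∀ v, ∃ e ∈ E, v ∈ e) (abs_nonneg (δ n))
      fun E hE => (h4 E hE).trans (le_abs_self _)
    linarith [(abs_le.1 h6).2]
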